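/- **Setting.** λ-terms are taken up to α-equivalence; $|t|$ is the number of constructors of $t$. *Neutral* means $\beta$-normal and not an abstraction. *Maximal contexts* are generated by: $\langle\cdot\rangle$; $C\,t$ for $C$ maximal and not of the form $\lambda x.D$; $\lambda x.C$ for $C$ maximal; $(\lambda x.t)\,C$ for $C$ maximal and $x\notin\mathrm{fv}(t)$; $t\,C$ for $t$ neutral and $C$ maximal. The *maximal strategy* is $C\langle(\lambda x.t)s\rangle\to_{\max}C\langle t\{x\leftarrow s\}\rangle$ for $C$ maximal and ($x\in\mathrm{fv}(t)$ or $s$ normal). A *maximal derivation* $d:t\to_{\max}^*s$ is a finite sequence of $|d|$ such steps. *Codes* are named λ-terms, not up to α. A code is *well-named* if its binders are pairwise distinct and distinct from its free names. A state $(\varphi,F,t,\pi,E)$ has a phase $\varphi\in\{\blacktriangledown,\blacktriangle\}$, a frame $F$ with items $x$, $t\lozenge\pi$ and $(\lambda x.t)^\pi$, a code $t$, a stack $\pi$ of codes, and an environment $E$ of entries $[x\leftarrow u]^l$ with $l\in\{abs,neu,(red,n)\}$. *Commutative transitions* ($E$ is unchanged): - $c_1$: $(\blacktriangledown,F,tu,\pi)\to(\blacktriangledown,F,t,u::\pi)$;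 - $c_2$: $(\blacktriangledown,F,\lambda x.t,\epsilon)\to(\blacktriangledown,F::x,t,\epsilon)$; - $c_3$: $(\blacktriangledown,F,x,\pi)\to(\blacktriangle,F,x,\pi)$ if $E(x)$ is undefined, or has label $neu$, or has label $abs$ and $\pi=\epsilon$; - $c_4$: $(\blacktriangle,F::x,t,\epsilon)\to(\blacktriangle,F,\lambda x.t,\epsilon)$; - $c_5$: $(\blacktriangle,F::t\lozenge\pi,u,\epsilon)\to(\blacktriangle,F,tu,\pi)$; - $c_6$: $(\blacktriangle,F,t,u::\pi)\to(\blacktriangledown,F::t\lozenge\pi,u,\epsilon)$; - $c_7$: $(\blacktriangledown,F,\lambda x.t,u::\pi)\to(\blacktriangledown,F::(\lambda x.t)^\pi,u,\epsilon)$ if $x\notin\mathrm{fv}(t)$. The *Checking AM* on $u$ and $E$ runs these transitions from $(\blacktriangledown,\epsilon,u,\epsilon,E)$ and outputs: $(red,1)$ at $(\blacktriangledown,F,\lambda x.t,v::\pi)$ with $x\in\mathrm{fv}(t)$ and at $(\blacktriangle,F::(\lambda x.t)^\pi,v,\epsilon)$; $(red,n+1)$ at $(\blacktriangledown,F,x,\pi)$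 with $E(x)$ labelled $(red,n)$; $(red,2)$ at $(\blacktriangledown,F,x,v::\pi)$ with $E(x)$ labelled $abs$; $neu$, resp. $abs$, at $(\blacktriangle,\epsilon,t,\epsilon)$ with $t$ an application, resp. an abstraction. The *Max MAM* has the commutative transitions, the *multiplicative* transitions - $m_1$: $(\blacktriangledown,F,\lambda x.t,y::\pi,E)\to(\blacktriangledown,F,t\{x\leftarrow y\},\pi,E)$ if $x\in\mathrm{fv}(t)$ and $y$ is a variable; - $m_2$: $(\blacktriangledown,F,\lambda x.t,u::\pi,E)\to(\blacktriangledown,F,t,\pi,[x\leftarrow u]^l::E)$ if $x\in\mathrm{fv}(t)$, $u$ is not a variable, and $l$ is the output of the Checking AM on $u$ and $E$; - $m_3$: $(\blacktriangle,F::(\lambda x.t)^\pi,u,\epsilon,E)\to(\blacktriangledown,F,t,\pi,E)$; and the *exponential* transition $(\blacktriangledown,F,x,\pi,E)\to(\blacktriangledown,F,t^\alpha,\pi,E)$ if $E(x)=[x\leftarrow t]^{l}$ with $l=(red,n)$, or with $l=abs$ and $\pi\neq\epsilon$, where $t^\alpha$ is any well-named α-variant of $t$ whose bound names do not occur in $F,\pi,E$.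 A state decodes to a term by plugging its code into the context given by $\pi$ and $F$ and then replacing, with capture allowed, the names defined in $E$ by their codes, from the most recent entry to the oldest. An execution $\rho$ from the initial state $(\blacktriangledown,\epsilon,\bar t,\epsilon,\epsilon)$, with $\bar t$ a well-named code of $t$, *simulates* $d:t\to_{\max}^*s$ if it has exactly $|d|$ multiplicative transitions and its last state decodes to $s$. $|\rho|$ is its number of transitions. **Theorem (Max MAM Overhead Bound).** For every maximal derivation $d:t\to_{\max}^*s$ and every well-named code $\bar t$ of $t$ there is a Max MAM execution $\rho$ from $\bar t$ that simulates $d$. Moreover, with absolute constants in the $O$'s: 1. *(Length)* every such $\rho$ satisfies $|\rho|=O((1+|d|^2)\cdot|t|)$; 2. *(Cost)* $\rho$ is implementable on a RAM in $O((1+|d|^2)\cdot|t|)$ steps: there is one program of a unit-cost RAM (with constants, addition, truncated subtraction, indirect addressing and jumps) that, for all $d$, $\bar t$ and $\rho$ as above, started on $\bar t$ written in prefix notation, reaches within that many steps a configuration whose memory holds, as a linked data structure with sharing, the last state of $\rho$ (up to a bijective renaming of names and α-equivalence of the codes, and with the same decoding $s$), and has halted there if that state is final. Hence the maximal strategy is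 reasonably implementable: there are a RAM program and a polynomial $p$ such that, on every well-named code of a term $t$, the program halts if and only if $t$ has a maximal derivation $d$ to a normal form, and then it does so within $p(|d|,|t|)$ steps with a shared representation of this normal form (a code and an environment that unfold to it) in memory. -/

import Mathlib

namespace MaxMAM

/-! ## The lambda-calculus, modulo alpha-equivalence -/

/-- Lambda-terms modulo alpha-equivalence, in de Bruijn notation: under `k` abstractions, the
index `k + x` denotes the free variable number `x`. -/
inductive Term : Type
  | var (n : ℕ)
  | lam (t : Term)
  | app (t s : Term)

namespace Term

/-- The size `|t|`: the number of constructors. -/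
def size : Term → ℕ
  | var _ => 1
  | lam t => t.size + 1
  | app t s => t.size + s.size + 1

/-- The variable of index `k` occurs free in the term. -/
def Occurs : ℕ → Term → Prop
  | k, var n => n = k
  | k, lam t => Occurs (k + 1) t
  | k, app t s => Occurs k t ∨ Occurs k s

/-- Shift the indices that are at least `c` by one. -/
def lift : ℕ → Term → Term
  | c, var n => if n < c then var n else var (n + 1)
  | c, lam t => lam (lift (c + 1) t)
  | c, app t s => app (lift c t) (lift c s)

/-- `t.subst k s`: capture-avoiding substitution of `s` for the index `k` in `t`; the indices
above `k` are decremented. -/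
def subst : Term → ℕ → Term → Term
  | var n, k, s => if n < k then var n else if n = k then s else var (n - 1)
  | lam t, k, s => lam (subst t (k + 1) (lift 0 s))
  | app t u, k, s => app (subst t k s) (subst u k s)

end Term

/-- Contexts `C ::= ⟨·⟩ | λx.C | C t | t C`. -/
inductive Ctx : Type
  | hole
  | lam (C : Ctx)
  | appL (C : Ctx) (t : Term)
  | appR (t : Term) (C : Ctx)

/-- `C⟨t⟩` (plugging may capture variables). -/
def Ctx.plug : Ctx → Term → Term
  | .hole, t => t
  | .lam C, t => .lam (C.plug t)
  | .appL C u, t => .app (C.plug t) u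
  | .appR u C, t => .app u (C.plug t)

/-- Beta-reduction `t →β s`. -/
def BetaStep (t s : Term) : Prop :=
  ∃ (C : Ctx) (u v : Term), t = C.plug (.app (.lam u) v) ∧ s = C.plug (u.subst 0 v)

/-- Beta-normal terms. -/
def Normal (t : Term) : Prop := ∀ s, ¬ BetaStep t s

/-- Neutral terms: normal and not an abstraction. -/
def Neutral (t : Term) : Prop := Normal t ∧ ∀ u, t ≠ .lam u

/-- Maximal contexts. -/
inductive IsMaxCtx : Ctx → Prop
  | ax : IsMaxCtx .hole
  | appL {C : Ctx} {t : Term} : IsMaxCtx C → (∀ D, C ≠ .lam D) → IsMaxCtx (.appL C t)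
  | lam {C : Ctx} : IsMaxCtx C → IsMaxCtx (.lam C)
  | gc {C : Ctx} {t : Term} : ¬ t.Occurs 0 → IsMaxCtx C → IsMaxCtx (.appR (.lam t) C)
  | appR {C : Ctx} {t : Term} : Neutral t → IsMaxCtx C → IsMaxCtx (.appR t C)

/-- One step of the maximal strategy: a redex `(λx.u) v` with `x` free in `u` or `v` normal is
fired in a maximal context. -/
def MaxStep (t s : Term) : Prop :=
  ∃ (C : Ctx) (u v : Term), IsMaxCtx C ∧ (u.Occurs 0 ∨ Normal v) ∧
    t = C.plug (.app (.lam u) v) ∧ s = C.plug (u.subst 0 v)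

/-- Derivations: finite, possibly empty, sequences of steps of `R`. -/
inductive Derivation (R : Term → Term → Prop) : Term → Term → Type
  | nil (t : Term) : Derivation R t t
  | snoc {t s u : Term} (d : Derivation R t s) (h : R s u) : Derivation R t u

/-- The length `|d|` of a derivation. -/
def Derivation.length {R : Term → Term → Prop} {t s : Term} : Derivation R t s → ℕ
  | .nil _ => 0
  | .snoc d _ => d.length + 1

/-! ## Codes -/

/-- Codes: lambda-terms with named variables, not considered up to alpha-equivalence. -/
inductive Code : Type
  | var (x : ℕ)
  | lam (x : ℕ) (t : Code)
  | app (t u : Code)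

namespace Code

/-- The free names of a code. -/
def fv : Code → Finset ℕ
  | var x => {x}
  | lam x t => t.fv.erase x
  | app t u => t.fv ∪ u.fv

/-- The list of the binders of a code. -/
def binders : Code → List ℕ
  | var _ => []
  | lam x t => x :: t.binders
  | app t u => t.binders ++ u.binders

/-- All names of a code, free and bound. -/
def names : Code → Finset ℕ
  | var x => {x}
  | lam x t => insert x t.names
  | app t u => t.names ∪ u.names

/-- Distinct binders have distinct names, that are also distinct from the free names. -/
def WellNamed (t : Code) : Prop := t.binders.Nodup ∧ ∀ x ∈ t.binders, x ∉ t.fv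

/-- The term denoted by a code below the binders `Γ`, innermost first. -/
def toTermAux : List ℕ → Code → Term
  | Γ, var x => .var (if x ∈ Γ then Γ.idxOf x else Γ.length + x)
  | Γ, lam x t => .lam (toTermAux (x :: Γ) t)
  | Γ, app t u => .app (toTermAux Γ t) (toTermAux Γ u)

/-- The term denoted by a code, i.e. its class modulo alpha-equivalence. -/
def toTerm (t : Code) : Term := toTermAux [] t

/-- `t{x ← y}`: replace the free occurrences of the name `x` by `y`. (The machine only does so
when `y` is not bound in `t`, so that no capture occurs.) -/
def substVar (x y : ℕ) : Code → Code
  | var z => if z = x then var y else var z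
  | lam z t => if z = x then lam z t else lam z (substVar x y t)
  | app t u => app (substVar x y t) (substVar x y u)

/-- Grafting `t.graft x u`: capture-allowing substitution of the code `u` for the name `x` in the
code `t`. -/
def graft : Code → ℕ → Code → Code
  | var z, x, u => if z = x then u else var z
  | lam z t, x, u => lam z (graft t x u)
  | app t s, x, u => app (graft t x u) (graft s x u)

/-- Apply a function to all names of a code, free and bound. -/
def map (f : ℕ → ℕ) : Code → Code
  | var x => var (f x)
  | lam x t => lam (f x) (t.map f)
  | app t u => app (t.map f) (u.map f)

end Code

/-! ## States of the machines -/

/-- Labels of environment entries. -/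
inductive Label : Type
  | abs
  | red (n : ℕ)
  | neu

/-- An environment entry `[x ← u]^l`. -/
structure Entry : Type where
  name : ℕ
  code : Code
  label : Label

/-- Environments; the most recent entry comes first. -/
abbrev Env := List Entry

/-- Stacks of arguments; the head of the list is the top. -/
abbrev Stack := List Code

/-- Items of a frame: a variable, a head argument context `t ◊ π`, or an erasing context
`(λx.t)^π`. -/
inductive Item : Type
  | var (x : ℕ)
  | head (t : Code) (π : Stack)
  | erasing (x : ℕ) (t : Code) (π : Stack)

/-- Frames; the head of the list is the item pushed last. -/
abbrev Frame := List Item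

/-- The two phases: evaluation and backtracking. -/
inductive Phase : Type
  | eval
  | back

/-- States, shared by the Checking AM and the Max MAM. -/
structure State : Type where
  phase : Phase
  frame : Frame
  code : Code
  stack : Stack
  env : Env

/-- `E(x)`: the most recent entry for `x`, if any. -/
def Env.lookup (E : Env) (x : ℕ) : Option Entry := E.find? (fun e => e.name = x)

/-- The names in a stack. -/
def Stack.Mentions (π : Stack) (x : ℕ) : Prop := ∃ t ∈ π, x ∈ t.names

/-- The names in a frame item. -/
def Item.Mentions : Item → ℕ → Prop
  | .var y, x => x = y
  | .head t π, x => x ∈ t.names ∨ Stack.Mentions π x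
  | .erasing y t π, x => x = y ∨ x ∈ t.names ∨ Stack.Mentions π x

/-- The names in an environment. -/
def Env.Mentions (E : Env) (x : ℕ) : Prop := ∃ e ∈ E, x = e.name ∨ x ∈ e.code.names

/-- `u` is an alpha-renaming of `t` that is well-named and whose bound names are fresh with
respect to `F`, `π` and `E`. -/
def IsRenaming (F : Frame) (π : Stack) (E : Env) (t u : Code) : Prop :=
  u.toTerm = t.toTerm ∧ u.WellNamed ∧
    ∀ x ∈ u.binders, (∀ φ ∈ F, ¬ φ.Mentions x) ∧ ¬ Stack.Mentions π x ∧ ¬ Env.Mentions E x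

/-- The variable `x` with stack `π` is useless to replace: it has no entry in `E`, or a neutral
one, or an abstraction one while `π` is empty. -/
def Useless (E : Env) (x : ℕ) (π : Stack) : Prop :=
  E.lookup x = none ∨ ∃ e, E.lookup x = some e ∧
    (e.label = .neu ∨ (e.label = .abs ∧ π = []))

/-! ## The commutative transitions, common to both machines -/

/-- Names of the transitions of the Max MAM. -/
inductive Trans : Type
  | m1 | m2 | m3
  | ered | eabs
  | c1 | c2 | c3 | c4 | c5 | c6 | c7

/-- The multiplicative transitions. -/
def Trans.IsMul : Trans → Bool
  | .m1 | .m2 | .m3 => true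
  | _ => false

/-- The commutative transitions. -/
inductive CommStep : Trans → State → State → Prop
  | c1 (F : Frame) (t u : Code) (π : Stack) (E : Env) :
      CommStep .c1 ⟨.eval, F, .app t u, π, E⟩ ⟨.eval, F, t, u :: π, E⟩
  | c2 (F : Frame) (x : ℕ) (t : Code) (E : Env) :
      CommStep .c2 ⟨.eval, F, .lam x t, [], E⟩ ⟨.eval, .var x :: F, t, [], E⟩
  | c3 (F : Frame) (x : ℕ) (π : Stack) (E : Env) : Useless E x π →
      CommStep .c3 ⟨.eval, F, .var x, π, E⟩ ⟨.back, F, .var x, π, E⟩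
  | c4 (F : Frame) (x : ℕ) (t : Code) (E : Env) :
      CommStep .c4 ⟨.back, .var x :: F, t, [], E⟩ ⟨.back, F, .lam x t, [], E⟩
  | c5 (F : Frame) (t u : Code) (π : Stack) (E : Env) :
      CommStep .c5 ⟨.back, .head t π :: F, u, [], E⟩ ⟨.back, F, .app t u, π, E⟩
  | c6 (F : Frame) (t u : Code) (π : Stack) (E : Env) :
      CommStep .c6 ⟨.back, F, t, u :: π, E⟩ ⟨.eval, .head t π :: F, u, [], E⟩
  | c7 (F : Frame) (x : ℕ) (t u : Code) (π : Stack) (E : Env) : x ∉ t.fv →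
      CommStep .c7 ⟨.eval, F, .lam x t, u :: π, E⟩ ⟨.eval, .erasing x t π :: F, u, [], E⟩

/-! ## The Checking AM -/

/-- The output transitions of the Checking AM. -/
inductive CheckOutput : State → Label → Prop
  | o1 (F : Frame) (x : ℕ) (t u : Code) (π : Stack) (E : Env) : x ∈ t.fv →
      CheckOutput ⟨.eval, F, .lam x t, u :: π, E⟩ (.red 1)
  | o2 (F : Frame) (x : ℕ) (π : Stack) (E : Env) (e : Entry) (n : ℕ) :
      E.lookup x = some e → e.label = .red n →
      CheckOutput ⟨.eval, F, .var x, π, E⟩ (.red (n + 1))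
  | o3 (F : Frame) (x : ℕ) (u : Code) (π : Stack) (E : Env) (e : Entry) :
      E.lookup x = some e → e.label = .abs →
      CheckOutput ⟨.eval, F, .var x, u :: π, E⟩ (.red 2)
  | o4 (t u : Code) (E : Env) : CheckOutput ⟨.back, [], .app t u, [], E⟩ .neu
  | o5 (x : ℕ) (t : Code) (E : Env) : CheckOutput ⟨.back, [], .lam x t, [], E⟩ .abs
  | o6 (F : Frame) (x : ℕ) (t u : Code) (π : Stack) (E : Env) :
      CheckOutput ⟨.back, .erasing x t π :: F, u, [], E⟩ (.red 1)

/-- `l` is the output of the Checking AM on `u` and `E`. -/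
def Checks (u : Code) (E : Env) (l : Label) : Prop :=
  ∃ s : State, Relation.ReflTransGen (fun s₁ s₂ => ∃ τ, CommStep τ s₁ s₂)
    ⟨.eval, [], u, [], E⟩ s ∧ CheckOutput s l

/-! ## The Max MAM -/

/-- The transitions of the Max MAM. On a redex `(λx.t) u`, the transition is `c7` if the redex is
erasing (whether or not `u` is a variable: a variable may stand for a non-normal entry of the
environment, which has to be evaluated before it is erased), `m1` if it is not erasing and `u` is
a variable, and `m2` otherwise. -/
inductive Step : Trans → State → State → Prop
  | comm {τ : Trans} {s s' : State} : CommStep τ s s' → Step τ s s'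
  | m1 (F : Frame) (x y : ℕ) (t : Code) (π : Stack) (E : Env) : x ∈ t.fv →
      Step .m1 ⟨.eval, F, .lam x t, .var y :: π, E⟩ ⟨.eval, F, t.substVar x y, π, E⟩
  | m2 (F : Frame) (x : ℕ) (t u : Code) (π : Stack) (E : Env) (l : Label) :
      x ∈ t.fv → (∀ y, u ≠ .var y) → Checks u E l →
      Step .m2 ⟨.eval, F, .lam x t, u :: π, E⟩ ⟨.eval, F, t, π, ⟨x, u, l⟩ :: E⟩
  | m3 (F : Frame) (x : ℕ) (t u : Code) (π : Stack) (E : Env) :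
      Step .m3 ⟨.back, .erasing x t π :: F, u, [], E⟩ ⟨.eval, F, t, π, E⟩
  | ered (F : Frame) (x : ℕ) (u : Code) (π : Stack) (E : Env) (e : Entry) (n : ℕ) :
      E.lookup x = some e → e.label = .red n → IsRenaming F π E e.code u →
      Step .ered ⟨.eval, F, .var x, π, E⟩ ⟨.eval, F, u, π, E⟩
  | eabs (F : Frame) (x : ℕ) (v u : Code) (π : Stack) (E : Env) (e : Entry) :
      E.lookup x = some e → e.label = .abs → IsRenaming F (v :: π) E e.code u →
      Step .eabs ⟨.eval, F, .var x, v :: π, E⟩ ⟨.eval, F, u, v :: π, E⟩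

/-- The initial state of code `t`. -/
def State.initial (t : Code) : State := ⟨.eval, [], t, [], []⟩

/-- Final states: no transition applies. -/
def State.Final (s : State) : Prop := ∀ τ s', ¬ Step τ s s'

/-- Executions of the Max MAM. -/
inductive Exec : State → State → Type
  | nil (s : State) : Exec s s
  | snoc {s s' s'' : State} (ρ : Exec s s') (τ : Trans) (h : Step τ s' s'') : Exec s s''

/-- The number `|ρ|` of transitions. -/
def Exec.length {s s' : State} : Exec s s' → ℕ
  | .nil _ => 0
  | .snoc ρ _ _ => ρ.length + 1

/-- The number `|ρ|ₘ` of multiplicative transitions. -/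
def Exec.numMul {s s' : State} : Exec s s' → ℕ
  | .nil _ => 0
  | .snoc ρ τ _ => ρ.numMul + if τ.IsMul then 1 else 0

/-! ## Decoding -/

/-- The unfolding of `E` on a code. -/
def Env.unfold : Env → Code → Code
  | [], t => t
  | e :: E, t => Env.unfold E (t.graft e.name e.code)

/-- Plug a code in the context that a stack decodes to. -/
def Stack.plug : Stack → Code → Code
  | [], t => t
  | u :: π, t => Stack.plug π (.app t u)

/-- Plug a code in the context that a frame decodes to. -/
def Frame.plug : Frame → Code → Code
  | [], t => t
  | .var x :: F, t => Frame.plug F (.lam x t)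
  | .head u π :: F, t => Frame.plug F (Stack.plug π (.app u t))
  | .erasing x u π :: F, t => Frame.plug F (Stack.plug π (.app (.lam x u) t))

/-- The term that a state decodes to. -/
def State.decode (s : State) : Term :=
  (Env.unfold s.env (Frame.plug s.frame (Stack.plug s.stack s.code))).toTerm

/-- The execution `ρ` simulates the maximal derivation `d : t →* s`. -/
def Simulates {q q' : State} {t s : Term} (ρ : Exec q q') (d : Derivation MaxStep t s) : Prop :=
  ρ.numMul = d.length ∧ q'.decode = s

/-! ## Random access machines -/

/-- Instructions of a RAM with memory `X : ℕ → ℕ`. -/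
inductive Instr : Type
  /-- `X i := c` -/
  | const (i c : ℕ)
  /-- `X i := X j + X k` -/
  | add (i j k : ℕ)
  /-- `X i := X j - X k` (truncated) -/
  | sub (i j k : ℕ)
  /-- `X i := X (X j + c)` -/
  | load (i j c : ℕ)
  /-- `X (X i + c) := X j` -/
  | store (i c j : ℕ)
  /-- go to `l` if `X i = 0` -/
  | jz (i l : ℕ)
  /-- go to `l` -/
  | jmp (l : ℕ)
  | halt

/-- RAM programs. -/
abbrev Program := List Instr

/-- Configurations of a RAM. -/
structure Config : Type where
  pc : ℕ
  mem : ℕ → ℕ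

/-- The effect of an instruction; `none` for `halt`. -/
def Instr.exec (c : Config) : Instr → Option Config
  | .const i a => some ⟨c.pc + 1, Function.update c.mem i a⟩
  | .add i j k => some ⟨c.pc + 1, Function.update c.mem i (c.mem j + c.mem k)⟩
  | .sub i j k => some ⟨c.pc + 1, Function.update c.mem i (c.mem j - c.mem k)⟩
  | .load i j a => some ⟨c.pc + 1, Function.update c.mem i (c.mem (c.mem j + a))⟩
  | .store i a j => some ⟨c.pc + 1, Function.update c.mem (c.mem i + a) (c.mem j)⟩
  | .jz i l => some ⟨if c.mem i = 0 then l else c.pc + 1, c.mem⟩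
  | .jmp l => some ⟨l, c.mem⟩
  | .halt => none

/-- One step of a program, of unit cost; `none` if the program has halted. -/
def Program.step (P : Program) (c : Config) : Option Config :=
  match P[c.pc]? with
  | some i => i.exec c
  | none => none

/-- The program has halted in the configuration `c`. -/
def Program.Halted (P : Program) (c : Config) : Prop := P.step c = none

/-- The configuration after `n` steps (it does not change any more after halting). -/
def Program.run (P : Program) : ℕ → Config → Config
  | 0, c => c
  | n + 1, c => (P.step (P.run n c)).getD (P.run n c)

/-! ## Inputs and outputs of RAM programs -/

/-- The input format of codes: prefix notation. -/
def Code.encode : Code → List ℕ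
  | .var x => [0, x]
  | .lam x t => 1 :: x :: t.encode
  | .app t u => 2 :: (t.encode ++ u.encode)

/-- The initial configuration on input `t`: the encoding of `t` is stored from address `base` on,
and all other cells hold zero. -/
def Config.init (base : ℕ) (t : Code) : Config :=
  ⟨0, fun a => if base ≤ a then t.encode.getD (a - base) 0 else 0⟩

/-- The pointer `p` points to the code `t`; nodes may be shared. -/
inductive ReadCode (X : ℕ → ℕ) : ℕ → Code → Prop
  | var {p : ℕ} : X p = 0 → ReadCode X p (.var (X (p + 1)))
  | lam {p : ℕ} {t : Code} : X p = 1 → ReadCode X (X (p + 2)) t →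
      ReadCode X p (.lam (X (p + 1)) t)
  | app {p : ℕ} {t u : Code} : X p = 2 → ReadCode X (X (p + 1)) t → ReadCode X (X (p + 2)) u →
      ReadCode X p (.app t u)

/-- The pointer `p` points to the stack `π`, a linked list; `0` is the null pointer. -/
inductive ReadStack (X : ℕ → ℕ) : ℕ → Stack → Prop
  | nil : ReadStack X 0 []
  | cons {p : ℕ} {t : Code} {π : Stack} : p ≠ 0 → ReadCode X (X p) t →
      ReadStack X (X (p + 1)) π → ReadStack X p (t :: π)

/-- The pointer `p` points to the frame `F`, a linked list of tagged items. -/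
inductive ReadFrame (X : ℕ → ℕ) : ℕ → Frame → Prop
  | nil : ReadFrame X 0 []
  | var {p : ℕ} {F : Frame} : p ≠ 0 → X p = 0 →
      ReadFrame X (X (p + 3)) F → ReadFrame X p (.var (X (p + 1)) :: F)
  | head {p : ℕ} {t : Code} {π : Stack} {F : Frame} : p ≠ 0 → X p = 1 →
      ReadCode X (X (p + 1)) t → ReadStack X (X (p + 2)) π →
      ReadFrame X (X (p + 3)) F → ReadFrame X p (.head t π :: F)
  | erasing {p x : ℕ} {t : Code} {π : Stack} {F : Frame} : p ≠ 0 → X p = 2 →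
      ReadCode X (X (p + 1)) (.lam x t) → ReadStack X (X (p + 2)) π →
      ReadFrame X (X (p + 3)) F → ReadFrame X p (.erasing x t π :: F)

/-- Labels as numbers. -/
def Label.encode : Label → ℕ
  | .abs => 0
  | .neu => 1
  | .red n => n + 2

/-- The pointer `p` points to the environment `E`, a linked list of entries. -/
inductive ReadEnv (X : ℕ → ℕ) : ℕ → Env → Prop
  | nil : ReadEnv X 0 []
  | cons {p : ℕ} {u : Code} {l : Label} {E : Env} : p ≠ 0 → ReadCode X (X (p + 1)) u →
      X (p + 2) = l.encode → ReadEnv X (X (p + 3)) E → ReadEnv X p (⟨X p, u, l⟩ :: E)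

/-- Phases as numbers. -/
def Phase.encode : Phase → ℕ
  | .eval => 0
  | .back => 1

/-- The memory `X` holds the state `s`, whose components are given by the cells `0, …, 4`. -/
structure ReadState (X : ℕ → ℕ) (s : State) : Prop where
  phase : X 0 = s.phase.encode
  code : ReadCode X (X 1) s.code
  stack : ReadStack X (X 2) s.stack
  frame : ReadFrame X (X 3) s.frame
  env : ReadEnv X (X 4) s.env

/-- Equality of codes up to the renaming `σ` of names and alpha-equivalence. -/
def Code.Equiv (σ : Equiv.Perm ℕ) (t u : Code) : Prop := (t.map σ).toTerm = u.toTerm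

/-- Equality of frame items up to the renaming `σ` of names and alpha-equivalence of codes. -/
inductive Item.Equiv (σ : Equiv.Perm ℕ) : Item → Item → Prop
  | var (x : ℕ) : Item.Equiv σ (.var x) (.var (σ x))
  | head {t t' : Code} {π π' : Stack} : t.Equiv σ t' → List.Forall₂ (Code.Equiv σ) π π' →
      Item.Equiv σ (.head t π) (.head t' π')
  | erasing {x x' : ℕ} {t t' : Code} {π π' : Stack} :
      (Code.lam x t).Equiv σ (.lam x' t') → List.Forall₂ (Code.Equiv σ) π π' →
      Item.Equiv σ (.erasing x t π) (.erasing x' t' π')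

/-- Equality of states up to renaming of names and alpha-equivalence of codes, with the same
decoding. -/
def State.Equiv (s s' : State) : Prop :=
  s.decode = s'.decode ∧ s.phase = s'.phase ∧ ∃ σ : Equiv.Perm ℕ,
    s.code.Equiv σ s'.code ∧
    List.Forall₂ (Code.Equiv σ) s.stack s'.stack ∧
    List.Forall₂ (Item.Equiv σ) s.frame s'.frame ∧
    List.Forall₂ (fun e e' => σ e.name = e'.name ∧ e.code.Equiv σ e'.code ∧ e.label = e'.label)
      s.env s'.env

/-- Within `N` steps on input `c`, the program reaches a configuration whose memory holds the
state `q`, up to the choice of names; and it has halted there if `q` is final. -/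
def Program.ReachesWithin (P : Program) (base : ℕ) (c : Code) (q : State) (N : ℕ) : Prop :=
  ∃ n ≤ N, (∃ q', ReadState (P.run n (Config.init base c)).mem q' ∧ q'.Equiv q) ∧
    (q.Final → P.Halted (P.run n (Config.init base c)))

/-- The memory `X` holds a shared representation of the term `s`: a code and an environment,
pointed to by the cells `1` and `4`, such that the unfolding of the environment on the code
is `s`. -/
def ReadTerm (X : ℕ → ℕ) (s : Term) : Prop :=
  ∃ u E, ReadCode X (X 1) u ∧ ReadEnv X (X 4) E ∧ (Env.unfold E u).toTerm = s

/-- The strategy `R` is reasonably implementable: a RAM program computes (a shared representation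
of) the `R`-normal form of `t` whenever it exists, in time polynomial in `|t|` and in the number
of `R`-steps to reach it, and diverges otherwise. -/
def ReasonablyImplementable (R : Term → Term → Prop) : Prop :=
  ∃ (P : Program) (base : ℕ) (p : MvPolynomial (Fin 2) ℕ),
    ∀ (t : Term) (c : Code), c.WellNamed → c.toTerm = t →
      (∀ (s : Term) (d : Derivation R t s), (∀ u, ¬ R s u) →
        ∃ n ≤ MvPolynomial.eval ![d.length, t.size] p,
          P.Halted (P.run n (Config.init base c)) ∧
          ReadTerm (P.run n (Config.init base c)).mem s) ∧
      ((∃ n, P.Halted (P.run n (Config.init base c))) →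
        ∃ s, Nonempty (Derivation R t s) ∧ ∀ u, ¬ R s u)

end MaxMAM

/-! Correctness is a simulation. If no name in use is also a binder of a code still to be evaluated
or stored (`Clean`), then unfolding the environment is capture-free substitution (`dec_eq_inst`).
Commutative and exponential transitions preserve the decoding, and a multiplicative transition
decodes to one step of the maximal strategy (`GStep.decode`): heads kept in the frame decode to
neutral terms and the items (λx.t)^π are erasing, so the decoded context is maximal. The machine
stops only on normal forms (`Stopped.nf`), the strategy is deterministic (`MS.deterministic`), and a
run without multiplicative transitions is finite. Hence the machine follows every derivation
(`exists_simulation`).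

For the length, every code that is not yet evaluated has size at most |t|, since such codes are
renamed subcodes of the input (`GStep.sizes`). The labels tell truthfully whether an entry decodes
to a neutral term, to a normal abstraction or to a reducible term (`chk_sound`). So an exponential
transition either puts an abstraction in front of an argument, where its size is not charged until
the redex is fired, or copies an entry whose decoding is reducible. In the second case the machine
cannot leave the copy before the next multiplicative transition, because codes on which it
backtracks decode to normal terms; and the copy mentions only older entries. The entries copied in
this way get older and older, so between two multiplicative transitions there are at most |d| of
them, each of size at most |t|. This gives |d|²·|t|; `GStep.pot_false` and `GStep.pot_true` phrase
it with a potential.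

For the cost, the RAM runs the same machine with names of its own choice. Both are instances of a
transition system `GStep` that ignores the names of the code evaluated next and is deterministic up
to a permutation of names (`GStep.deterministic`). Copying an abstraction in front of an argument
would not be paid for by the potential, so the RAM shares it with the environment and copies its
body when the redex is fired; this is why the name invariant `Inv` comes in two versions. A run of
the Checking AM is linear in the checked code, as it has no exponential transitions. Copies and
checks are paid for by five times the potential (`Ran.step`). The RAM program iterates one loop-free
command, verified with weakest preconditions; it comes back to its first instruction forever unless
a normal form is reached, which gives both directions of the halting statement. -/

namespace MaxMAM

/-! ## Renaming and parallel substitution of terms -/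

/-- Extend a renaming below a binder. -/
def upr (f : ℕ → ℕ) : ℕ → ℕ
  | 0 => 0
  | n + 1 => f n + 1

@[simp] theorem upr_zero (f : ℕ → ℕ) : upr f 0 = 0 := rfl
@[simp] theorem upr_succ (f : ℕ → ℕ) (n : ℕ) : upr f (n + 1) = f n + 1 := rfl

namespace Term

/-- Renaming of the free variables. -/
def rename : Term → (ℕ → ℕ) → Term
  | var n, f => var (f n)
  | lam t, f => lam (t.rename (upr f))
  | app t s, f => app (t.rename f) (s.rename f)

/-- Extend a parallel substitution below a binder. -/
def ups (f : ℕ → Term) : ℕ → Term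
  | 0 => var 0
  | n + 1 => (f n).rename Nat.succ

@[simp] theorem ups_zero (f : ℕ → Term) : ups f 0 = var 0 := rfl
@[simp] theorem ups_succ (f : ℕ → Term) (n : ℕ) : ups f (n + 1) = (f n).rename Nat.succ := rfl

/-- Parallel substitution. -/
def inst : Term → (ℕ → Term) → Term
  | var n, f => f n
  | lam t, f => lam (t.inst (ups f))
  | app t s, f => app (t.inst f) (s.inst f)

/-- Not an abstraction. -/
def NotLam (t : Term) : Prop := ∀ u, t ≠ lam u

theorem rename_congr {f g : ℕ → ℕ} {t : Term} (h : ∀ n, Occurs n t → f n = g n) :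
    t.rename f = t.rename g := by
  induction t generalizing f g with
  | var n => simp [rename, h n rfl]
  | lam t ih =>
    simp only [rename]
    rw [ih]
    rintro (_ | n) hn
    · rfl
    · simp [h n hn]
  | app t s iht ihs =>
    simp only [rename]
    rw [iht fun n hn => h n (Or.inl hn), ihs fun n hn => h n (Or.inr hn)]

theorem inst_congr {f g : ℕ → Term} {t : Term} (h : ∀ n, Occurs n t → f n = g n) :
    t.inst f = t.inst g := by
  induction t generalizing f g with
  | var n => exact h n rfl
  | lam t ih =>
    simp only [inst]
    rw [ih]
    rintro (_ | n) hn
    · rfl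
    · simp [h n hn]
  | app t s iht ihs =>
    simp only [inst]
    rw [iht fun n hn => h n (Or.inl hn), ihs fun n hn => h n (Or.inr hn)]

theorem rename_rename (t : Term) (f g : ℕ → ℕ) : (t.rename f).rename g = t.rename (g ∘ f) := by
  induction t generalizing f g with
  | var n => rfl
  | lam t ih =>
    simp only [rename, ih]
    congr 2
    funext n
    cases n <;> rfl
  | app t s iht ihs => simp [rename, iht, ihs]

theorem rename_inst (t : Term) (f : ℕ → ℕ) (g : ℕ → Term) :
    (t.rename f).inst g = t.inst (g ∘ f) := by
  induction t generalizing f g with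
  | var n => rfl
  | lam t ih =>
    simp only [rename, inst, ih]
    congr 2
    funext n
    cases n <;> rfl
  | app t s iht ihs => simp [rename, inst, iht, ihs]

theorem inst_rename (t : Term) (f : ℕ → Term) (g : ℕ → ℕ) :
    (t.inst f).rename g = t.inst (fun n => (f n).rename g) := by
  induction t generalizing f g with
  | var n => rfl
  | lam t ih =>
    simp only [rename, inst, ih]
    congr 2
    funext n
    cases n with
    | zero => rfl
    | succ n => simp only [ups_succ, rename_rename]; rfl
  | app t s iht ihs => simp [rename, inst, iht, ihs]

theorem inst_inst (t : Term) (f g : ℕ → Term) :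
    (t.inst f).inst g = t.inst (fun n => (f n).inst g) := by
  induction t generalizing f g with
  | var n => rfl
  | lam t ih =>
    simp only [inst, ih]
    congr 2
    funext n
    cases n with
    | zero => rfl
    | succ n => simp only [ups_succ, rename_inst, inst_rename]; rfl
  | app t s iht ihs => simp [inst, iht, ihs]

theorem rename_eq_inst (t : Term) (f : ℕ → ℕ) : t.rename f = t.inst (fun n => var (f n)) := by
  induction t generalizing f with
  | var n => rfl
  | lam t ih =>
    simp only [rename, inst, ih]
    congr 2
    funext n
    cases n <;> rfl
  | app t s iht ihs => simp [rename, inst, iht, ihs]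

theorem inst_id {f : ℕ → Term} (t : Term) (h : ∀ n, Occurs n t → f n = var n) : t.inst f = t := by
  induction t generalizing f with
  | var n => exact h n rfl
  | lam t ih =>
    simp only [inst]
    rw [ih]
    rintro (_ | n) hn
    · rfl
    · simp [h n hn, rename]
  | app t s iht ihs =>
    simp only [inst]
    rw [iht fun n hn => h n (Or.inl hn), ihs fun n hn => h n (Or.inr hn)]

theorem rename_id {f : ℕ → ℕ} (t : Term) (h : ∀ n, Occurs n t → f n = n) : t.rename f = t := by
  rw [rename_eq_inst]
  exact inst_id t fun n hn => by rw [h n hn]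

theorem occurs_rename {t : Term} {f : ℕ → ℕ} {k : ℕ} :
    Occurs k (t.rename f) ↔ ∃ n, Occurs n t ∧ f n = k := by
  induction t generalizing f k with
  | var n => simp [rename, Occurs]
  | lam t ih =>
    simp only [rename, Occurs, ih]
    constructor
    · rintro ⟨_ | n, h, e⟩
      · simp at e
      · exact ⟨n, h, by simpa using e⟩
    · rintro ⟨n, h, e⟩
      exact ⟨n + 1, h, by simpa using e⟩
  | app t s iht ihs => simp only [rename, Occurs, iht, ihs, or_and_right, exists_or]

theorem occurs_inst {t : Term} {f : ℕ → Term} {k : ℕ} :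
    Occurs k (t.inst f) ↔ ∃ n, Occurs n t ∧ Occurs k (f n) := by
  induction t generalizing f k with
  | var n => simp [inst, Occurs]
  | lam t ih =>
    simp only [inst, Occurs, ih]
    constructor
    · rintro ⟨_ | n, h, e⟩
      · simp [Occurs] at e
      · refine ⟨n, h, ?_⟩
        rw [ups_succ, occurs_rename] at e
        obtain ⟨m, hm, e⟩ := e
        rwa [← Nat.succ.inj e]
    · rintro ⟨n, h, e⟩
      exact ⟨n + 1, h, by rw [ups_succ, occurs_rename]; exact ⟨k, e, rfl⟩⟩
  | app t s iht ihs => simp only [inst, Occurs, iht, ihs, or_and_right, exists_or]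

theorem occurs_rename_upr {t : Term} {f : ℕ → ℕ} : Occurs 0 (t.rename (upr f)) ↔ Occurs 0 t := by
  rw [occurs_rename]
  constructor
  · rintro ⟨_ | n, h, e⟩
    · exact h
    · simp at e
  · exact fun h => ⟨0, h, rfl⟩

/-- With this and `subst_eq_inst`, lifting and single substitution become cases of parallel renaming
and substitution, where the composition laws above need no index arithmetic. -/
theorem lift_eq_rename (c : ℕ) (t : Term) :
    t.lift c = t.rename (fun n => if n < c then n else n + 1) := by
  induction t generalizing c with
  | var n => simp only [lift, rename]; split <;> rfl
  | lam t ih =>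
    simp only [lift, rename, ih]
    congr 2
    funext n
    cases n with
    | zero => simp
    | succ n => simp only [upr_succ, Nat.add_lt_add_iff_right]; split <;> rfl
  | app t s iht ihs => simp [lift, rename, iht, ihs]

theorem subst_eq_inst (t : Term) (k : ℕ) (s : Term) :
    t.subst k s = t.inst (fun n => if n < k then var n else if n = k then s else var (n - 1)) := by
  induction t generalizing k s with
  | var n => rfl
  | lam t ih =>
    simp only [subst, inst, ih]
    congr 2
    funext n
    cases n with
    | zero => simp
    | succ n =>
      simp only [ups_succ, Nat.add_lt_add_iff_right, Nat.add_right_cancel_iff,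
        Nat.add_sub_cancel]
      split_ifs with h1 h2
      · rfl
      · rw [lift_eq_rename]
        congr 1
      · simp only [rename, Term.var.injEq]; omega
  | app t u iht ihu => simp [subst, inst, iht, ihu]

theorem subst_zero (t s : Term) :
    t.subst 0 s = t.inst (fun n => n.casesOn s (fun m => var m)) := by
  rw [subst_eq_inst]
  congr 1
  funext n
  cases n <;> simp

theorem rename_subst (t s : Term) (f : ℕ → ℕ) :
    (t.subst 0 s).rename f = (t.rename (upr f)).subst 0 (s.rename f) := by
  rw [subst_zero, subst_zero, inst_rename, rename_inst]
  congr 1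
  funext n
  cases n <;> rfl

@[simp] theorem size_rename (t : Term) (f : ℕ → ℕ) : (t.rename f).size = t.size := by
  induction t generalizing f <;> simp_all [rename, size]

theorem size_pos (t : Term) : 0 < t.size := by cases t <;> simp [size]

theorem notLam_var (n : ℕ) : NotLam (var n) := by simp [NotLam]
theorem notLam_app (t s : Term) : NotLam (app t s) := by simp [NotLam]

theorem notLam_rename {t : Term} {f : ℕ → ℕ} : NotLam (t.rename f) ↔ NotLam t := by
  cases t <;> simp [NotLam, rename]

/-- A syntactic characterization of normal terms. -/
def NF : Term → Prop
  | var _ => True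
  | lam t => t.NF
  | app t s => t.NF ∧ s.NF ∧ t.NotLam

theorem nf_rename {t : Term} {f : ℕ → ℕ} : NF (t.rename f) ↔ NF t := by
  induction t generalizing f with
  | var n => simp [rename, NF]
  | lam t ih => simp [rename, NF, ih]
  | app t s iht ihs => simp [rename, NF, iht, ihs, notLam_rename]

end Term

/-! ### Beta-normal terms, syntactically. -/

open Term

theorem BetaStep.plug {t s : Term} (h : BetaStep t s) (C : Ctx) :
    BetaStep (C.plug t) (C.plug s) := by
  induction C with
  | hole => exact h
  | lam C ih =>
    obtain ⟨D, u, v, e1, e2⟩ := ih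
    exact ⟨.lam D, u, v, by simp [Ctx.plug, e1], by simp [Ctx.plug, e2]⟩
  | appL C r ih =>
    obtain ⟨D, u, v, e1, e2⟩ := ih
    exact ⟨.appL D r, u, v, by simp [Ctx.plug, e1], by simp [Ctx.plug, e2]⟩
  | appR r C ih =>
    obtain ⟨D, u, v, e1, e2⟩ := ih
    exact ⟨.appR r D, u, v, by simp [Ctx.plug, e1], by simp [Ctx.plug, e2]⟩

theorem normal_iff_nf {t : Term} : Normal t ↔ NF t := by
  constructor
  · intro h
    induction t with
    | var n => trivial
    | lam t ih => exact ih fun s hs => h _ (hs.plug (.lam .hole))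
    | app t u iht ihu =>
      refine ⟨iht fun s hs => h _ (hs.plug (.appL .hole u)),
        ihu fun s hs => h _ (hs.plug (.appR t .hole)), ?_⟩
      rintro w rfl
      exact h _ ⟨.hole, w, u, rfl, rfl⟩
  · rintro h s ⟨C, u, v, rfl, -⟩
    induction C with
    | hole => exact h.2.2 u rfl
    | lam C ih => exact ih h
    | appL C r ih => exact ih h.1
    | appR r C ih => exact ih h.2.1

theorem neutral_iff_nf {t : Term} : Neutral t ↔ NF t ∧ NotLam t := by
  rw [Neutral, normal_iff_nf]; rfl

/-! ## The maximal strategy -/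

/-- The maximal strategy, as an inductive closure. -/
inductive MS : Term → Term → Prop
  | root {u v : Term} : (u.Occurs 0 ∨ NF v) → MS (.app (.lam u) v) (u.subst 0 v)
  | appL {t t' u : Term} : NotLam t → MS t t' → MS (.app t u) (.app t' u)
  | lam {t t' : Term} : MS t t' → MS (.lam t) (.lam t')
  | gc {t u u' : Term} : ¬ t.Occurs 0 → MS u u' → MS (.app (.lam t) u) (.app (.lam t) u')
  | appR {t u u' : Term} : NF t → NotLam t → MS u u' → MS (.app t u) (.app t u')

theorem maxStep_iff_ms {t s : Term} : MaxStep t s ↔ MS t s := by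
  constructor
  · rintro ⟨C, u, v, hC, h, rfl, rfl⟩
    rw [normal_iff_nf] at h
    induction hC with
    | ax => exact .root h
    | @appL C r hC hl ih =>
      refine .appL ?_ ih
      cases C with
      | hole => exact notLam_app _ _
      | lam D => exact absurd rfl (hl D)
      | appL => exact notLam_app _ _
      | appR => exact notLam_app _ _
    | lam _ ih => exact .lam ih
    | gc h _ ih => exact .gc h ih
    | appR h _ ih => exact .appR (neutral_iff_nf.1 h).1 h.2 ih
  · intro h
    induction h with
    | @root u v h => exact ⟨.hole, u, v, .ax, h.imp_right normal_iff_nf.2, rfl, rfl⟩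
    | @appL t t' r hl _ ih =>
      obtain ⟨C, u, v, hC, h, rfl, rfl⟩ := ih
      exact ⟨.appL C r, u, v, .appL hC (by rintro D rfl; exact hl _ rfl), h, rfl, rfl⟩
    | lam _ ih =>
      obtain ⟨C, u, v, hC, h, rfl, rfl⟩ := ih
      exact ⟨.lam C, u, v, .lam hC, h, rfl, rfl⟩
    | @gc t _ _ hx _ ih =>
      obtain ⟨C, u, v, hC, h, rfl, rfl⟩ := ih
      exact ⟨.appR (.lam t) C, u, v, .gc hx hC, h, rfl, rfl⟩
    | @appR t _ _ h1 h2 _ ih =>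
      obtain ⟨C, u, v, hC, h, rfl, rfl⟩ := ih
      exact ⟨.appR t C, u, v, .appR (neutral_iff_nf.2 ⟨h1, h2⟩) hC, h, rfl, rfl⟩

theorem MS.not_nf {t s : Term} (h : MS t s) : ¬ NF t := by
  rw [← normal_iff_nf]
  obtain ⟨C, u, v, -, -, rfl, -⟩ := maxStep_iff_ms.2 h
  exact fun hn => hn _ ⟨C, u, v, rfl, rfl⟩

/-- Two different rules could overlap only on a subterm that is both reducible and normal, or on a
head that both is and is not an abstraction. For an abstraction head, `root` and `gc` exclude each
other: an erasing redex is fired exactly when its argument is normal. -/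
theorem MS.deterministic {t s s' : Term} (h : MS t s) (h' : MS t s') : s = s' := by
  induction h generalizing s' with
  | @root u v h =>
    cases h' with
    | root => rfl
    | appL hl => exact absurd rfl (hl _)
    | gc hx hv => exact absurd h (not_or.2 ⟨hx, hv.not_nf⟩)
    | appR _ hl => exact absurd rfl (hl _)
  | @appL t t' u hl ht ih =>
    cases h' with
    | root => exact absurd rfl (hl _)
    | appL _ h => rw [ih h]
    | gc => exact absurd rfl (hl _)
    | appR h => exact absurd h ht.not_nf
  | lam _ ih =>
    cases h' with
    | lam h => rw [ih h]
  | gc hx hu ih =>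
    cases h' with
    | root h => exact absurd h (not_or.2 ⟨hx, hu.not_nf⟩)
    | appL hl => exact absurd rfl (hl _)
    | gc _ h => rw [ih h]
    | appR _ hl => exact absurd rfl (hl _)
  | appR h1 hl _ ih =>
    cases h' with
    | root => exact absurd rfl (hl _)
    | appL _ h => exact absurd h1 h.not_nf
    | gc => exact absurd rfl (hl _)
    | appR _ _ h => rw [ih h]

theorem MS.rename {t s : Term} (h : MS t s) (f : ℕ → ℕ) : MS (t.rename f) (s.rename f) := by
  induction h generalizing f with
  | @root u v h =>
    rw [rename_subst]
    exact .root (h.imp occurs_rename_upr.2 nf_rename.2)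
  | appL hl _ ih => exact .appL (notLam_rename.2 hl) (ih f)
  | lam _ ih => exact .lam (ih _)
  | gc hx _ ih => exact .gc (occurs_rename_upr.not.2 hx) (ih f)
  | appR h hl _ ih => exact .appR (nf_rename.2 h) (notLam_rename.2 hl) (ih f)

/-! ## Codes and terms -/

/-- Closing the name `x`: it becomes the index `0`. -/
def cl (x n : ℕ) : ℕ := if n = x then 0 else n + 1

@[simp] theorem cl_self (x : ℕ) : cl x x = 0 := by simp [cl]
theorem cl_ne {x n : ℕ} (h : n ≠ x) : cl x n = n + 1 := by simp [cl, h]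

namespace Code

/-- This removes the list of binders: an abstraction is then read by one closing renaming `cl`, and
alpha-equivalence of codes becomes equality of terms computed compositionally. -/
theorem toTermAux_eq (Γ : List ℕ) (t : Code) :
    toTermAux Γ t = t.toTerm.rename (fun n => if n ∈ Γ then Γ.idxOf n else Γ.length + n) := by
  induction t generalizing Γ with
  | var x => simp [toTerm, toTermAux, rename]
  | lam x t ih =>
    simp only [toTerm, toTermAux, rename]
    rw [ih, ih [x], rename_rename]
    congr 2
    funext n
    by_cases h : n = x
    · subst h; simp
    · have h' : x ≠ n := fun e => h e.symm
      simp only [List.mem_cons, h, false_or, Function.comp, List.not_mem_nil, if_false,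
        List.length_cons, List.length_nil, Nat.add_comm (0 + 1) n, upr_succ, List.idxOf_cons_ne _ h']
      split <;> simp [Nat.add_right_comm]
  | app t u iht ihu =>
    simp only [toTerm, toTermAux, rename]
    rw [iht, ihu, iht [], ihu []]
    simp [rename_rename, Function.comp_def]

@[simp] theorem toTerm_var (x : ℕ) : (var x).toTerm = .var x := by simp [toTerm, toTermAux]

theorem toTerm_lam (x : ℕ) (t : Code) : (lam x t).toTerm = .lam (t.toTerm.rename (cl x)) := by
  simp only [toTerm, toTermAux]
  rw [toTermAux_eq]
  congr 2
  funext n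
  by_cases h : n = x
  · simp [h]
  · simp [h, cl, Nat.add_comm]

@[simp] theorem toTerm_app (t u : Code) : (app t u).toTerm = .app t.toTerm u.toTerm := rfl

theorem mem_fv {t : Code} {x : ℕ} : x ∈ t.fv ↔ t.toTerm.Occurs x := by
  induction t generalizing x with
  | var y => simp [fv, Occurs, eq_comm]
  | lam y t ih =>
    simp only [fv, Finset.mem_erase, toTerm_lam, Occurs, occurs_rename, ih, cl]
    constructor
    · rintro ⟨h, h'⟩; exact ⟨x, h', by simp [h]⟩
    · rintro ⟨n, h, e⟩
      split at e
      · omega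
      · obtain rfl : n = x := by omega
        exact ⟨by assumption, h⟩
  | app t u iht ihu => simp [fv, Occurs, iht, ihu]

theorem occurs_body {x : ℕ} {t : Code} : (t.toTerm.rename (cl x)).Occurs 0 ↔ x ∈ t.fv := by
  rw [occurs_rename, mem_fv]
  constructor
  · rintro ⟨n, h, e⟩
    obtain rfl : n = x := by by_contra h; simp [cl, h] at e
    exact h
  · exact fun h => ⟨x, h, cl_self x⟩

theorem fv_eq_of_toTerm {t u : Code} (h : t.toTerm = u.toTerm) : t.fv = u.fv := by
  ext x; rw [mem_fv, mem_fv, h]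

theorem fv_subset_names (t : Code) : t.fv ⊆ t.names := by
  induction t with
  | var x => simp [fv, names]
  | lam x t ih =>
    intro y hy
    simp only [fv, Finset.mem_erase] at hy
    exact Finset.mem_insert_of_mem (ih hy.2)
  | app t u iht ihu => exact Finset.union_subset_union iht ihu

theorem mem_names {t : Code} {x : ℕ} : x ∈ t.names ↔ x ∈ t.fv ∨ x ∈ t.binders := by
  induction t with
  | var y => simp [fv, names, binders]
  | lam y t ih =>
    simp only [names, fv, binders, Finset.mem_insert, ih, Finset.mem_erase, List.mem_cons]
    tauto
  | app t u iht ihu =>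
    simp only [names, fv, binders, Finset.mem_union, iht, ihu, List.mem_append]
    tauto

/-- The size of a code. -/
def size (t : Code) : ℕ := t.toTerm.size

@[simp] theorem size_var (x : ℕ) : (var x).size = 1 := by simp [size, Term.size]
@[simp] theorem size_lam (x : ℕ) (t : Code) : (lam x t).size = t.size + 1 := by
  simp [size, Term.size, toTerm_lam]
@[simp] theorem size_app (t u : Code) : (app t u).size = t.size + u.size + 1 := rfl

theorem size_pos (t : Code) : 0 < t.size := Term.size_pos _

/-- The code is an abstraction. -/
def IsLam : Code → Prop
  | lam _ _ => True
  | _ => False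

instance : DecidablePred IsLam := fun t => by
  cases t <;> simp only [IsLam] <;> infer_instance

theorem isLam_iff {t : Code} : IsLam t ↔ ¬ t.toTerm.NotLam := by
  cases t <;> simp [IsLam, NotLam, toTerm_lam]

theorem toTerm_map {t : Code} {f : ℕ → ℕ} (hf : Function.Injective f) :
    (t.map f).toTerm = t.toTerm.rename f := by
  induction t with
  | var x => simp [map, rename]
  | lam x t ih =>
    simp only [map, toTerm_lam, ih, rename, rename_rename]
    congr 2
    funext n
    by_cases h : n = x
    · simp [h]
    · have : f n ≠ f x := fun e => h (hf e)
      simp [cl, h, this]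
  | app t u iht ihu => simp [map, rename, iht, ihu]

/-- The renaming of `x` into `y`. -/
def ren1 (x y n : ℕ) : ℕ := if n = x then y else n

theorem rename_ren1_self (t : Term) (x : ℕ) : t.rename (ren1 x x) = t :=
  t.rename_id fun n _ => by simp only [ren1]; split <;> simp_all

/-- As `y` is not a binder, no occurrence is captured. Occurrences of `x` below a binder `x` are
closed to index 0, which the renaming of free names does not reach. -/
theorem toTerm_substVar {t : Code} {x y : ℕ} (h : y ∉ t.binders) :
    (t.substVar x y).toTerm = t.toTerm.rename (ren1 x y) := by
  induction t with
  | var z => simp only [substVar, toTerm_var, rename, ren1]; split <;> simp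
  | lam z t ih =>
    simp only [binders, List.mem_cons, not_or] at h
    simp only [substVar]
    split
    · next e =>
      subst e
      simp only [toTerm_lam, rename, rename_rename]
      congr 2
      funext n
      by_cases h : n = z <;> simp [cl, h, ren1]
    · next e =>
      simp only [toTerm_lam, rename, rename_rename, ih h.2]
      congr 2
      funext n
      by_cases h1 : n = z
      · subst h1; simp [ren1, e]
      · by_cases h2 : n = x
        · subst h2; simp [ren1, cl_ne h.1, cl_ne h1]
        · simp [ren1, h2, cl_ne h1]
  | app t u iht ihu =>
    simp only [binders, List.mem_append, not_or] at h
    simp [substVar, rename, iht h.1, ihu h.2]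

theorem binders_substVar (t : Code) (x y : ℕ) : (t.substVar x y).binders = t.binders := by
  induction t with
  | var z => simp only [substVar]; split <;> rfl
  | lam z t ih => simp only [substVar]; split <;> simp [binders, ih]
  | app t u iht ihu => simp [substVar, binders, iht, ihu]

/-! ### Fresh copies of codes. -/

/-- A copy of a code, where the free names are renamed by `f` and the bound names are taken
from `n` on; the second component is the next unused name. -/
def fresh : (ℕ → ℕ) → Code → ℕ → Code × ℕ
  | f, var x, n => (var (f x), n)
  | f, lam x t, n =>
    (lam n (fresh (Function.update f x n) t (n + 1)).1, (fresh (Function.update f x n) t (n + 1)).2)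
  | f, app t u, n =>
    (app (fresh f t n).1 (fresh f u (fresh f t n).2).1, (fresh f u (fresh f t n).2).2)

theorem le_fresh (f : ℕ → ℕ) (t : Code) (n : ℕ) : n ≤ (fresh f t n).2 := by
  induction t generalizing f n with
  | var x => simp [fresh]
  | lam x t ih => exact le_trans (Nat.le_succ n) (ih _ _)
  | app t u iht ihu => exact le_trans (iht _ _) (ihu _ _)

theorem mem_binders_fresh {f : ℕ → ℕ} {t : Code} {n x : ℕ} (h : x ∈ (fresh f t n).1.binders) :
    n ≤ x ∧ x < (fresh f t n).2 := by
  induction t generalizing f n with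
  | var y => simp [fresh, binders] at h
  | lam y t ih =>
    simp only [fresh, binders, List.mem_cons] at h ⊢
    rcases h with rfl | h
    · exact ⟨le_rfl, le_fresh _ _ _⟩
    · have := ih h; omega
  | app t u iht ihu =>
    simp only [fresh, binders, List.mem_append] at h ⊢
    rcases h with h | h
    · have := iht h; have := le_fresh f u (fresh f t n).2; omega
    · have := ihu h; have := le_fresh f t n; omega

theorem nodup_fresh (f : ℕ → ℕ) (t : Code) (n : ℕ) : (fresh f t n).1.binders.Nodup := by
  induction t generalizing f n with
  | var y => simp [fresh, binders]
  | lam y t ih =>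
    simp only [fresh, binders, List.nodup_cons]
    refine ⟨fun h => ?_, ih _ _⟩
    have := mem_binders_fresh h; omega
  | app t u iht ihu =>
    simp only [fresh, binders, List.nodup_append]
    refine ⟨iht _ _, ihu _ _, ?_⟩
    rintro a ha b hb rfl
    have := mem_binders_fresh ha; have := mem_binders_fresh hb; omega

/-- All new binders are at least `n`, hence above every image of a free name: nothing is captured.
-/
theorem toTerm_fresh {f : ℕ → ℕ} {t : Code} {n : ℕ} (h : ∀ x ∈ t.fv, f x < n) :
    (fresh f t n).1.toTerm = t.toTerm.rename f := by
  induction t generalizing f n with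
  | var y => simp [fresh, rename]
  | lam y t ih =>
    simp only [fresh, toTerm_lam, rename]
    rw [ih, rename_rename, rename_rename]
    · congr 1
      apply rename_congr
      intro m hm
      by_cases e : m = y
      · subst e; simp
      · have := h m (by simp [fv, e, mem_fv, hm])
        simp [Function.update_of_ne e, cl_ne e, cl_ne this.ne]
    · intro m hm
      by_cases e : m = y
      · subst e; simp
      · have := h m (by simp [fv, e, hm])
        rw [Function.update_of_ne e]; omega
  | app t u iht ihu =>
    simp only [fresh, toTerm_app, rename]
    rw [iht fun x hx => h x (by simp [fv, hx]),
      ihu fun x hx => lt_of_lt_of_le (h x (by simp [fv, hx])) (le_fresh _ _ _)]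

theorem wellNamed_fresh {f : ℕ → ℕ} {t : Code} {n : ℕ} (h : ∀ x ∈ t.fv, f x < n) :
    (fresh f t n).1.WellNamed := by
  refine ⟨nodup_fresh _ _ _, fun x hx hx' => ?_⟩
  rw [mem_fv, toTerm_fresh h, occurs_rename] at hx'
  obtain ⟨m, hm, rfl⟩ := hx'
  have := h m (mem_fv.2 hm); have := mem_binders_fresh hx; omega

end Code

end MaxMAM

namespace MaxMAM

open Term Code

/-! ## Names of states -/

/-- The names that are free in a stack. -/
def Stack.Live (π : Stack) (y : ℕ) : Prop := ∃ u ∈ π, y ∈ u.fv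

/-- The names that matter in a frame item: the free ones, and all names of evaluated codes. -/
def Item.Live : Item → ℕ → Prop
  | .var x, y => y = x
  | .head h π, y => y ∈ h.names ∨ Stack.Live π y
  | .erasing x t π, y => y ∈ (Code.lam x t).fv ∨ Stack.Live π y

/-- The names that matter in a frame. -/
def Frame.Live (F : Frame) (y : ℕ) : Prop := ∃ φ ∈ F, Item.Live φ y

/-- The names that are defined or used in an environment. -/
def Env.Live (E : Env) (y : ℕ) : Prop := ∃ e ∈ E, y = e.name ∨ y ∈ e.code.fv

/-- The names that matter in the code of a state. -/
def Phase.Live : Phase → Code → ℕ → Prop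
  | .eval, t, y => y ∈ t.fv
  | .back, t, y => y ∈ t.names

/-- The names in use in a state: names defined in the environment or the frame, free names, and
all names of evaluated codes. -/
def State.Live (s : State) (y : ℕ) : Prop :=
  s.phase.Live s.code y ∨ Stack.Live s.stack y ∨ Frame.Live s.frame y ∨ Env.Live s.env y

/-- The binders of a stack. -/
def Stack.bs : Stack → List ℕ
  | [] => []
  | u :: π => u.binders ++ Stack.bs π

/-- The binders of a frame item that are still to be opened. If `b` is false then erasing
abstractions are not counted: they have to be copied before they are evaluated. -/
def Item.act (b : Bool) : Item → List ℕ
  | .var _ => []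
  | .head _ π => Stack.bs π
  | .erasing x t π => (if b then x :: t.binders else []) ++ Stack.bs π

/-- The binders of a frame that are still to be opened. -/
def Frame.act (b : Bool) : Frame → List ℕ
  | [] => []
  | φ :: F => φ.act b ++ Frame.act b F

/-- The code is an abstraction that is to be applied to an argument. -/
def Redex (t : Code) (π : Stack) : Prop := t.IsLam ∧ π ≠ []

instance (t : Code) (π : Stack) : Decidable (Redex t π) := by
  unfold Redex; infer_instance

/-- The binders of the code that are still to be opened. -/
def codeAct (b : Bool) : Phase → Code → Stack → List ℕ
  | .eval, t, π => if b = false ∧ Redex t π then [] else t.binders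
  | .back, _, _ => []

/-- The binders of a state that are still to be opened. -/
def State.act (b : Bool) (s : State) : List ℕ :=
  codeAct b s.phase s.code s.stack ++ (Stack.bs s.stack ++ Frame.act b s.frame)

/-- The binders of a frame item that are never opened. -/
def Item.Frozen (b : Bool) : Item → ℕ → Prop
  | .erasing x t _, y => b = false ∧ y ∈ (Code.lam x t).binders
  | _, _ => False

/-- The binders of a frame that are never opened. -/
def Frame.Frozen (b : Bool) (F : Frame) (y : ℕ) : Prop := ∃ φ ∈ F, Item.Frozen b φ y

/-- The binders of the codes of an environment. -/
def Env.Bound (E : Env) (y : ℕ) : Prop := ∃ e ∈ E, y ∈ e.code.binders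

/-- The binders of the code that are never opened. -/
def codeFrozen (b : Bool) : Phase → Code → Stack → ℕ → Prop
  | .eval, t, π, y => b = false ∧ Redex t π ∧ y ∈ t.binders
  | .back, _, _, _ => False

/-- The binders of a state that are never opened. -/
def State.Frozen (b : Bool) (s : State) (y : ℕ) : Prop :=
  codeFrozen b s.phase s.code s.stack y ∨ Frame.Frozen b s.frame y ∨ Env.Bound s.env y

/-- The invariant on names. -/
structure Inv (b : Bool) (s : State) : Prop where
  nodup : (s.act b).Nodup
  act_frozen : ∀ y ∈ s.act b, ¬ s.Frozen b y
  act_live : ∀ y ∈ s.act b, ¬ s.Live y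
  frozen_live : ∀ y, s.Frozen b y → ¬ s.Live y

/-- The binders of a frame item that is not evaluated. -/
def Item.Bound : Item → ℕ → Prop
  | .var _, _ => False
  | .head _ π, y => y ∈ Stack.bs π
  | .erasing x t π, y => y ∈ (Code.lam x t).binders ∨ y ∈ Stack.bs π

/-- The binders of the codes of a state that are not evaluated. -/
def State.Bound (s : State) (y : ℕ) : Prop :=
  (s.phase = .eval ∧ y ∈ s.code.binders) ∨ y ∈ Stack.bs s.stack ∨
    (∃ φ ∈ s.frame, φ.Bound y) ∨ Env.Bound s.env y

/-- No capture can occur. -/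
def Clean (s : State) : Prop := ∀ y, s.Bound y → ¬ s.Live y

/-! ### Binders and live names of a state. -/

theorem mem_frame_act {b : Bool} {F : Frame} {y : ℕ} :
    y ∈ Frame.act b F ↔ ∃ φ ∈ F, y ∈ φ.act b := by
  induction F <;> simp_all [Frame.act]

theorem mem_stack_bs {π : Stack} {y : ℕ} : y ∈ Stack.bs π ↔ ∃ u ∈ π, y ∈ u.binders := by
  induction π <;> simp_all [Stack.bs]

theorem Item.bound_iff (b : Bool) (φ : Item) (y : ℕ) :
    φ.Bound y ↔ y ∈ φ.act b ∨ φ.Frozen b y := by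
  cases φ <;> cases b <;> simp [Item.Bound, Item.act, Item.Frozen, Code.binders] <;> tauto

/-- The flag `b` only decides which binders count as still to be opened and which as frozen. Their
union does not depend on it, so both versions of `Inv` entail `Clean`. -/
theorem State.bound_iff (b : Bool) (s : State) (y : ℕ) :
    s.Bound y ↔ y ∈ s.act b ∨ s.Frozen b y := by
  obtain ⟨φ, F, t, π, E⟩ := s
  simp only [State.Bound, State.act, State.Frozen, Frame.Frozen, List.mem_append, mem_frame_act,
    Item.bound_iff b, and_or_left, exists_or]
  cases φ
  · simp only [codeAct, codeFrozen]
    split <;> grind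
  · simp only [codeAct, codeFrozen]; grind

theorem Inv.clean {b : Bool} {s : State} (h : Inv b s) : Clean s := fun y hy =>
  ((s.bound_iff b y).1 hy).elim (h.act_live y) (h.frozen_live y)

theorem Env.lookup_eq_some {E : Env} {x : ℕ} {e : Entry} (h : E.lookup x = some e) :
    e ∈ E ∧ e.name = x :=
  ⟨List.mem_of_find?_eq_some h, by simpa using List.find?_some h⟩

theorem Env.lookup_eq_none {E : Env} {x : ℕ} : E.lookup x = none ↔ ∀ e ∈ E, e.name ≠ x := by
  simp [Env.lookup]

theorem Inv.initial {b : Bool} {t : Code} (h : t.WellNamed) : Inv b (State.initial t) := by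
  have : State.act b (State.initial t) = t.binders := by
    simp [State.act, State.initial, codeAct, Redex, Stack.bs, Frame.act]
  constructor
  · rw [this]; exact h.1
  · simp [State.Frozen, State.initial, codeFrozen, Redex, Frame.Frozen, Env.Bound]
  · rw [this]; intro y hy
    simpa [State.Live, State.initial, Phase.Live, Stack.Live, Frame.Live, Env.Live] using h.2 y hy
  · simp [State.Frozen, State.initial, codeFrozen, Redex, Frame.Frozen, Env.Bound]

theorem Stack.live_nil (y : ℕ) : ¬ Stack.Live [] y := by simp [Stack.Live]
theorem Stack.live_cons {u : Code} {π : Stack} {y : ℕ} :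
    Stack.Live (u :: π) y ↔ y ∈ u.fv ∨ Stack.Live π y := by simp [Stack.Live]
theorem Frame.live_cons {φ : Item} {F : Frame} {y : ℕ} :
    Frame.Live (φ :: F) y ↔ φ.Live y ∨ Frame.Live F y := by simp [Frame.Live]
theorem Env.live_cons {e : Entry} {E : Env} {y : ℕ} :
    Env.Live (e :: E) y ↔ (y = e.name ∨ y ∈ e.code.fv) ∨ Env.Live E y := by simp [Env.Live]

theorem Frame.frozen_cons {b : Bool} {φ : Item} {F : Frame} {y : ℕ} :
    Frame.Frozen b (φ :: F) y ↔ φ.Frozen b y ∨ Frame.Frozen b F y := by simp [Frame.Frozen]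
theorem Env.bound_cons {e : Entry} {E : Env} {y : ℕ} :
    Env.Bound (e :: E) y ↔ y ∈ e.code.binders ∨ Env.Bound E y := by simp [Env.Bound]

theorem inv_iff {b : Bool} {s : State} : Inv b s ↔ (s.act b).Nodup ∧
    (∀ y ∈ s.act b, ¬ s.Frozen b y) ∧ (∀ y ∈ s.act b, ¬ s.Live y) ∧
    ∀ y, s.Frozen b y → ¬ s.Live y :=
  ⟨fun h => ⟨h.1, h.2, h.3, h.4⟩, fun h => ⟨h.1, h.2.1, h.2.2.1, h.2.2.2⟩⟩

theorem Item.frozen_var {b : Bool} {x y : ℕ} : ¬ (Item.var x).Frozen b y := id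
theorem Item.frozen_head {b : Bool} {t : Code} {π : Stack} {y : ℕ} :
    ¬ (Item.head t π).Frozen b y := id
theorem Item.frozen_erasing {b : Bool} {x y : ℕ} {t : Code} {π : Stack} :
    (Item.erasing x t π).Frozen b y ↔ b = false ∧ (y = x ∨ y ∈ t.binders) := by
  simp [Item.Frozen, Code.binders]

/-! ### Preservation of the name invariant. -/

set_option linter.unusedSimpArgs false
set_option linter.unnecessarySeqFocus false

-- Commutative transitions create no binder. An opened binder leaves the active list and becomes
-- live; an abstraction that meets an argument passes, when `b` is false, from the active binders to
-- the frozen ones. After unfolding, only reasoning about membership and `Nodup` remains.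
set_option maxHeartbeats 1000000 in
theorem CommStep.inv {b : Bool} {τ : Trans} {s s' : State} (h : CommStep τ s s')
    (hs : Inv b s) : Inv b s' := by
  rw [inv_iff] at hs ⊢
  cases h <;> cases b <;>
  simp only [State.act, State.Frozen, State.Live, codeAct, codeFrozen, Phase.Live,
    Stack.live_cons, Frame.live_cons, Env.live_cons, Stack.bs, Frame.act, Item.act,
    Item.frozen_var, Item.frozen_head, Item.frozen_erasing, Item.Live, Stack.live_nil,
    Code.binders, Code.fv, Code.names, Redex, Code.IsLam, Frame.frozen_cons, Env.bound_cons,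
    List.mem_cons, List.nodup_append, List.nodup_cons, mem_names, List.mem_append,
    Finset.mem_union, Finset.mem_erase, Finset.mem_insert, Finset.mem_singleton, if_true,
    if_false, true_and, false_and, and_true, and_false, false_or, or_false, reduceCtorEq,
    List.nil_append, List.not_mem_nil, ne_eq, not_true, not_false_iff, Bool.false_eq_true] at hs ⊢ <;>
  obtain ⟨h1, h2, h3, h4⟩ := hs <;> refine ⟨?_, ?_, ?_, ?_⟩ <;> grind

/-- The names that occur in a frame, a stack or an environment. -/
def Occupied (F : Frame) (π : Stack) (E : Env) (y : ℕ) : Prop :=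
  (∃ φ ∈ F, φ.Mentions y) ∨ Stack.Mentions π y ∨ Env.Mentions E y

theorem Stack.mentions_iff {π : Stack} {y : ℕ} :
    Stack.Mentions π y ↔ Stack.Live π y ∨ y ∈ Stack.bs π := by
  simp only [Stack.Mentions, Stack.Live, mem_stack_bs, mem_names, and_or_left, exists_or]

theorem Env.mentions_iff {E : Env} {y : ℕ} : Env.Mentions E y ↔ Env.Live E y ∨ Env.Bound E y := by
  simp only [Env.Mentions, Env.Live, Env.Bound, mem_names, and_or_left, exists_or, or_assoc]

theorem Item.mentions_of {φ : Item} {b : Bool} {y : ℕ}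
    (h : φ.Live y ∨ y ∈ φ.act b ∨ φ.Frozen b y) : φ.Mentions y := by
  cases φ <;> cases b <;>
  simp only [Item.Live, Item.act, Item.Frozen, Item.Mentions, Stack.mentions_iff, mem_names,
    Code.fv, Code.binders, Finset.mem_erase, List.mem_append, List.mem_cons] at * <;> grind

theorem not_occupied {F : Frame} {π : Stack} {E : Env} {y : ℕ} (h : ¬ Occupied F π E y) (b : Bool) :
    ¬ Frame.Live F y ∧ y ∉ Frame.act b F ∧ ¬ Frame.Frozen b F y ∧ ¬ Stack.Live π y ∧
      y ∉ Stack.bs π ∧ ¬ Env.Live E y ∧ ¬ Env.Bound E y := by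
  simp only [Occupied, Stack.mentions_iff, Env.mentions_iff, not_or] at h
  refine ⟨fun ⟨φ, h1, h2⟩ => h.1 ⟨φ, h1, φ.mentions_of (b := b) (.inl h2)⟩, fun hy => ?_,
    fun ⟨φ, h1, h2⟩ => h.1 ⟨φ, h1, φ.mentions_of (.inr (.inr h2))⟩, h.2.1.1, h.2.1.2, h.2.2.1,
    h.2.2.2⟩
  obtain ⟨φ, h1, h2⟩ := mem_frame_act.1 hy
  exact h.1 ⟨φ, h1, φ.mentions_of (.inr (.inl h2))⟩

/-- The code that replaces the variable brings binders occurring nowhere else, while its free names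
were already live through the environment. -/
theorem Inv.exp {b : Bool} {F : Frame} {π : Stack} {E : Env} {x : ℕ} {u : Code}
    (hs : Inv b ⟨.eval, F, .var x, π, E⟩) (hn : u.binders.Nodup)
    (hf : ∀ y ∈ u.binders, ¬ Occupied F π E y) (hl : ∀ y ∈ u.fv, Env.Live E y) :
    Inv b ⟨.eval, F, u, π, E⟩ := by
  replace hf := fun y hy => not_occupied (hf y hy) b
  rw [inv_iff] at hs ⊢
  cases b <;>
  simp only [State.act, State.Frozen, State.Live, codeAct, codeFrozen, Phase.Live,
    Stack.live_cons, Frame.live_cons, Env.live_cons, Stack.bs, Frame.act, Item.act,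
    Item.frozen_var, Item.frozen_head, Item.frozen_erasing, Item.Live, Stack.live_nil,
    Code.binders, Code.fv, Code.names, Redex, Code.IsLam, Frame.frozen_cons, Env.bound_cons,
    List.mem_cons, List.nodup_append, List.nodup_cons, mem_names, List.mem_append,
    Finset.mem_union, Finset.mem_erase, Finset.mem_insert, Finset.mem_singleton, if_true,
    if_false, true_and, false_and, and_true, and_false, false_or, or_false, reduceCtorEq,
    List.nil_append, List.not_mem_nil, ne_eq, not_true, not_false_iff, Bool.false_eq_true] at hs ⊢ <;>
  obtain ⟨h1, h2, h3, h4⟩ := hs <;> refine ⟨?_, ?_, ?_, ?_⟩ <;> grind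

/-- Evaluating the entry itself duplicates its binders, which is harmless for `b = false`: in front
of an argument they count as frozen, as they already do in the environment, and frozen binders need
not be distinct. -/
theorem Inv.share {F : Frame} {π : Stack} {E : Env} {x : ℕ} {e : Entry}
    (hs : Inv false ⟨.eval, F, .var x, π, E⟩) (he : e ∈ E) (hr : Redex e.code π) :
    Inv false ⟨.eval, F, e.code, π, E⟩ := by
  have hb : ∀ y ∈ e.code.binders, Env.Bound E y := fun y hy => ⟨e, he, hy⟩
  have hl : ∀ y ∈ e.code.fv, Env.Live E y := fun y hy => ⟨e, he, .inr hy⟩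
  obtain ⟨hr1, hr2⟩ := hr
  generalize e.code = w at *
  cases w with
  | var => exact hr1.elim
  | app => exact hr1.elim
  | lam z w =>
  simp only [Code.binders, Code.fv, List.mem_cons, Finset.mem_erase] at hb hl
  rw [inv_iff] at hs ⊢
  simp only [State.act, State.Frozen, State.Live, codeAct, codeFrozen, Phase.Live,
    Stack.live_cons, Frame.live_cons, Env.live_cons, Stack.bs, Frame.act, Item.act,
    Item.frozen_var, Item.frozen_head, Item.frozen_erasing, Item.Live, Stack.live_nil,
    Code.binders, Code.fv, Code.names, Redex, Code.IsLam, Frame.frozen_cons, Env.bound_cons,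
    List.mem_cons, List.nodup_append, List.nodup_cons, mem_names, List.mem_append,
    Finset.mem_union, Finset.mem_erase, Finset.mem_insert, Finset.mem_singleton, if_true,
    if_false, true_and, false_and, and_true, and_false, false_or, or_false, reduceCtorEq,
    List.nil_append, List.not_mem_nil, ne_eq, not_true, not_false_iff, Bool.false_eq_true] at hs ⊢ <;>
  obtain ⟨h1, h2, h3, h4⟩ := hs <;> refine ⟨?_, ?_, ?_, ?_⟩ <;> grind

/-- For `b = true` the binders of an applied abstraction are active, so its body can be evaluated
without a copy, as the transitions of the Max MAM do. -/
theorem Inv.inPlace {F : Frame} {π : Stack} {E : Env} {x : ℕ} {t u v : Code}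
    (hs : Inv true ⟨.eval, F, .lam x t, v :: π, E⟩) (hn : u.binders = t.binders)
    (hl : ∀ y ∈ u.fv, y ∈ v.fv ∨ y ∈ t.fv ∧ y ≠ x) : Inv true ⟨.eval, F, u, π, E⟩ := by
  rw [inv_iff] at hs ⊢
  simp only [State.act, State.Frozen, State.Live, codeAct, codeFrozen, Phase.Live,
    Stack.live_cons, Frame.live_cons, Env.live_cons, Stack.bs, Frame.act, Item.act,
    Item.frozen_var, Item.frozen_head, Item.frozen_erasing, Item.Live, Stack.live_nil,
    Code.binders, Code.fv, Code.names, Redex, Code.IsLam, Frame.frozen_cons, Env.bound_cons,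
    List.mem_cons, List.nodup_append, List.nodup_cons, mem_names, List.mem_append,
    Finset.mem_union, Finset.mem_erase, Finset.mem_insert, Finset.mem_singleton, if_true,
    if_false, true_and, false_and, and_true, and_false, false_or, or_false, reduceCtorEq,
    List.nil_append, List.not_mem_nil, ne_eq, not_true, not_false_iff, Bool.false_eq_true] at hs ⊢ <;>
  obtain ⟨h1, h2, h3, h4⟩ := hs <;> refine ⟨?_, ?_, ?_, ?_⟩ <;> grind

theorem Inv.inPlace_entry {F : Frame} {π : Stack} {E : Env} {x : ℕ} {t v : Code} {l : Label}
    (hs : Inv true ⟨.eval, F, .lam x t, v :: π, E⟩) :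
    Inv true ⟨.eval, F, t, π, ⟨x, v, l⟩ :: E⟩ := by
  rw [inv_iff] at hs ⊢
  simp only [State.act, State.Frozen, State.Live, codeAct, codeFrozen, Phase.Live,
    Stack.live_cons, Frame.live_cons, Env.live_cons, Stack.bs, Frame.act, Item.act,
    Item.frozen_var, Item.frozen_head, Item.frozen_erasing, Item.Live, Stack.live_nil,
    Code.binders, Code.fv, Code.names, Redex, Code.IsLam, Frame.frozen_cons, Env.bound_cons,
    List.mem_cons, List.nodup_append, List.nodup_cons, mem_names, List.mem_append,
    Finset.mem_union, Finset.mem_erase, Finset.mem_insert, Finset.mem_singleton, if_true,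
    if_false, true_and, false_and, and_true, and_false, false_or, or_false, reduceCtorEq,
    List.nil_append, List.not_mem_nil, ne_eq, not_true, not_false_iff, Bool.false_eq_true] at hs ⊢ <;>
  obtain ⟨h1, h2, h3, h4⟩ := hs <;> refine ⟨?_, ?_, ?_, ?_⟩ <;> grind

theorem Inv.inPlace_erase {F : Frame} {π : Stack} {E : Env} {x : ℕ} {t v : Code}
    (hs : Inv true ⟨.back, .erasing x t π :: F, v, [], E⟩) (hx : x ∉ t.fv) :
    Inv true ⟨.eval, F, t, π, E⟩ := by
  rw [inv_iff] at hs ⊢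
  simp only [State.act, State.Frozen, State.Live, codeAct, codeFrozen, Phase.Live,
    Stack.live_cons, Frame.live_cons, Env.live_cons, Stack.bs, Frame.act, Item.act,
    Item.frozen_var, Item.frozen_head, Item.frozen_erasing, Item.Live, Stack.live_nil,
    Code.binders, Code.fv, Code.names, Redex, Code.IsLam, Frame.frozen_cons, Env.bound_cons,
    List.mem_cons, List.nodup_append, List.nodup_cons, mem_names, List.mem_append,
    Finset.mem_union, Finset.mem_erase, Finset.mem_insert, Finset.mem_singleton, if_true,
    if_false, true_and, false_and, and_true, and_false, false_or, or_false, reduceCtorEq,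
    List.nil_append, List.not_mem_nil, ne_eq, not_true, not_false_iff, Bool.false_eq_true] at hs ⊢ <;>
  obtain ⟨h1, h2, h3, h4⟩ := hs <;> refine ⟨?_, ?_, ?_, ?_⟩ <;> grind

/-- For `b = false` the abstraction may be shared with the environment; a body with fresh binders
takes its place. This is how the RAM fires redexes. -/
theorem Inv.copy {F : Frame} {π : Stack} {E : Env} {x : ℕ} {t u v : Code}
    (hs : Inv false ⟨.eval, F, .lam x t, v :: π, E⟩) (hn : u.binders.Nodup)
    (hf : ∀ y ∈ u.binders, ¬ Occupied F π E y ∧ y ∉ u.fv)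
    (hl : ∀ y ∈ u.fv, y ∈ v.fv ∨ y ∈ t.fv ∧ y ≠ x) : Inv false ⟨.eval, F, u, π, E⟩ := by
  replace hf := fun y hy => (⟨not_occupied (hf y hy).1 false, (hf y hy).2⟩ : _ ∧ _)
  rw [inv_iff] at hs ⊢
  simp only [State.act, State.Frozen, State.Live, codeAct, codeFrozen, Phase.Live,
    Stack.live_cons, Frame.live_cons, Env.live_cons, Stack.bs, Frame.act, Item.act,
    Item.frozen_var, Item.frozen_head, Item.frozen_erasing, Item.Live, Stack.live_nil,
    Code.binders, Code.fv, Code.names, Redex, Code.IsLam, Frame.frozen_cons, Env.bound_cons,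
    List.mem_cons, List.nodup_append, List.nodup_cons, mem_names, List.mem_append,
    Finset.mem_union, Finset.mem_erase, Finset.mem_insert, Finset.mem_singleton, if_true,
    if_false, true_and, false_and, and_true, and_false, false_or, or_false, reduceCtorEq,
    List.nil_append, List.not_mem_nil, ne_eq, not_true, not_false_iff, Bool.false_eq_true] at hs ⊢ <;>
  obtain ⟨h1, h2, h3, h4⟩ := hs <;> refine ⟨?_, ?_, ?_, ?_⟩ <;> grind

theorem Inv.copy_entry {F : Frame} {π : Stack} {E : Env} {x x' : ℕ} {t u v : Code} {l : Label}
    (hs : Inv false ⟨.eval, F, .lam x t, v :: π, E⟩) (hn : u.binders.Nodup)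
    (hf : ∀ y, y ∈ u.binders ∨ y = x' → ¬ Occupied F (v :: π) E y)
    (hx : x' ∉ u.binders) (hu : ∀ y ∈ u.binders, y ∉ u.fv)
    (hl : ∀ y ∈ u.fv, y = x' ∨ y ∈ t.fv ∧ y ≠ x) :
    Inv false ⟨.eval, F, u, π, ⟨x', v, l⟩ :: E⟩ := by
  replace hf := fun y hy => not_occupied (hf y hy) false
  -- The body may itself be an abstraction in front of an argument, and then its binders are frozen
  -- rather than active. Only these abstract facts on the two sets are needed, so both are
  -- generalized below.
  have ha : (codeAct false .eval u π).Nodup ∧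
      ∀ y ∈ codeAct false .eval u π, y ∈ u.binders := by
    simp only [codeAct]; split <;> simp [hn]
  have hb : ∀ y, codeFrozen false .eval u π y → y ∈ u.binders := fun y hy => hy.2.2
  have hc : ∀ y ∈ codeAct false .eval u π, ¬ codeFrozen false .eval u π y := by
    intro y hy hy'
    simp [codeAct, hy'.2.1] at hy
  rw [inv_iff] at hs ⊢
  simp only [State.act, State.Frozen, Stack.live_cons, Stack.bs, List.mem_append] at hs hf ⊢
  generalize codeAct false .eval u π = A at *
  generalize codeFrozen false .eval u π = B at *
  simp only [State.act, State.Frozen, State.Live, codeAct, codeFrozen, Phase.Live,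
    Stack.live_cons, Frame.live_cons, Env.live_cons, Stack.bs, Frame.act, Item.act,
    Item.frozen_var, Item.frozen_head, Item.frozen_erasing, Item.Live, Stack.live_nil,
    Code.binders, Code.fv, Code.names, Redex, Code.IsLam, Frame.frozen_cons, Env.bound_cons,
    List.mem_cons, List.nodup_append, List.nodup_cons, mem_names, List.mem_append,
    Finset.mem_union, Finset.mem_erase, Finset.mem_insert, Finset.mem_singleton, if_true,
    if_false, true_and, false_and, and_true, and_false, false_or, or_false, reduceCtorEq,
    List.nil_append, List.not_mem_nil, ne_eq, not_true, not_false_iff, Bool.false_eq_true] at hs ⊢ <;>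
  obtain ⟨h1, h2, h3, h4⟩ := hs <;> refine ⟨?_, ?_, ?_, ?_⟩ <;> grind

theorem Inv.copy_erase {F : Frame} {π : Stack} {E : Env} {x : ℕ} {t u v : Code}
    (hs : Inv false ⟨.back, .erasing x t π :: F, v, [], E⟩) (hn : u.binders.Nodup)
    (hf : ∀ y ∈ u.binders, ¬ Occupied F π E y ∧ y ∉ u.fv)
    (hl : ∀ y ∈ u.fv, y ∈ t.fv ∧ y ≠ x) : Inv false ⟨.eval, F, u, π, E⟩ := by
  replace hf := fun y hy => (⟨not_occupied (hf y hy).1 false, (hf y hy).2⟩ : _ ∧ _)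
  rw [inv_iff] at hs ⊢
  simp only [State.act, State.Frozen, State.Live, codeAct, codeFrozen, Phase.Live,
    Stack.live_cons, Frame.live_cons, Env.live_cons, Stack.bs, Frame.act, Item.act,
    Item.frozen_var, Item.frozen_head, Item.frozen_erasing, Item.Live, Stack.live_nil,
    Code.binders, Code.fv, Code.names, Redex, Code.IsLam, Frame.frozen_cons, Env.bound_cons,
    List.mem_cons, List.nodup_append, List.nodup_cons, mem_names, List.mem_append,
    Finset.mem_union, Finset.mem_erase, Finset.mem_insert, Finset.mem_singleton, if_true,
    if_false, true_and, false_and, and_true, and_false, false_or, or_false, reduceCtorEq,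
    List.nil_append, List.not_mem_nil, ne_eq, not_true, not_false_iff, Bool.false_eq_true] at hs ⊢ <;>
  obtain ⟨h1, h2, h3, h4⟩ := hs <;> refine ⟨?_, ?_, ?_, ?_⟩ <;> grind

/-! ## The machine up to alpha-equivalence -/

/-- The transitions of the Max MAM, up to the names of the code that is evaluated next. The
Boolean tells whether the transition is multiplicative. -/
inductive GStep : Bool → State → State → Prop
  | comm {τ : Trans} {s s' : State} : CommStep τ s s' → GStep false s s'
  | m1 (F : Frame) (x y : ℕ) (t u : Code) (π : Stack) (E : Env) : x ∈ t.fv →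
      u.toTerm = t.toTerm.rename (ren1 x y) →
      GStep true ⟨.eval, F, .lam x t, .var y :: π, E⟩ ⟨.eval, F, u, π, E⟩
  | m2 (F : Frame) (x x' : ℕ) (t u v : Code) (π : Stack) (E : Env) (l : Label) :
      x ∈ t.fv → (∀ y, v ≠ .var y) → Checks v E l →
      u.toTerm = t.toTerm.rename (ren1 x x') →
      ¬ State.Live ⟨.eval, F, .lam x t, v :: π, E⟩ x' →
      GStep true ⟨.eval, F, .lam x t, v :: π, E⟩ ⟨.eval, F, u, π, ⟨x', v, l⟩ :: E⟩
  | m3 (F : Frame) (x : ℕ) (t u v : Code) (π : Stack) (E : Env) : u.toTerm = t.toTerm →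
      GStep true ⟨.back, .erasing x t π :: F, v, [], E⟩ ⟨.eval, F, u, π, E⟩
  | exp (F : Frame) (x : ℕ) (u : Code) (π : Stack) (E : Env) (e : Entry) :
      E.lookup x = some e → ((∃ n, e.label = .red n) ∨ e.label = .abs ∧ π ≠ []) →
      u.toTerm = e.code.toTerm →
      GStep false ⟨.eval, F, .var x, π, E⟩ ⟨.eval, F, u, π, E⟩

/-- The erasing items of a frame are erasing. -/
def Frame.Erases (F : Frame) : Prop := ∀ x t π, Item.erasing x t π ∈ F → x ∉ t.fv

theorem GStep.erases {m : Bool} {s s' : State} (h : GStep m s s') (hs : Frame.Erases s.frame) :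
    Frame.Erases s'.frame := by
  cases h with
  | comm h => cases h <;> simp only [Frame.Erases, List.mem_cons] at * <;> grind
  | _ => simp only [Frame.Erases, List.mem_cons] at * <;> grind

theorem IsRenaming.not_occupied {F : Frame} {π : Stack} {E : Env} {t u : Code}
    (h : IsRenaming F π E t u) {y : ℕ} (hy : y ∈ u.binders) : ¬ Occupied F π E y := by
  have := h.2.2 y hy
  simp only [Occupied, not_or, not_exists, not_and]
  exact this

theorem Inv.isRenaming {b : Bool} {F : Frame} {π : Stack} {E : Env} {x : ℕ} {e : Entry} {u : Code}
    (hs : Inv b ⟨.eval, F, .var x, π, E⟩) (he : E.lookup x = some e)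
    (h : IsRenaming F π E e.code u) : Inv b ⟨.eval, F, u, π, E⟩ :=
  hs.exp h.2.1.1 (fun _ hy => h.not_occupied hy)
    (fun _ hy => ⟨e, (Env.lookup_eq_some he).1, .inr (fv_eq_of_toTerm h.1 ▸ hy)⟩)

theorem mem_fv_of_ren1 {t u : Code} {x y z : ℕ} (h : u.toTerm = t.toTerm.rename (ren1 x y))
    (hz : z ∈ u.fv) : z = y ∨ z ∈ t.fv ∧ z ≠ x := by
  rw [mem_fv, h, occurs_rename] at hz
  obtain ⟨n, hn, rfl⟩ := hz
  by_cases e : n = x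
  · simp [ren1, e]
  · simp only [ren1, e, if_false]
    exact .inr ⟨mem_fv.2 hn, e⟩

/-- The Max MAM is an instance of the machine up to alpha-equivalence. -/
theorem Step.gstep {τ : Trans} {s s' : State} (h : Step τ s s') (hs : Inv true s)
    (he : Frame.Erases s.frame) : GStep τ.IsMul s s' ∧ Inv true s' := by
  cases h with
  | comm h =>
    refine ⟨?_, h.inv hs⟩
    have := GStep.comm h
    cases h <;> exact this
  | m1 F x y t π E hx =>
    -- The argument `y` is live, being free in the stack, and so cannot be a binder: the
    -- substitution performed by the machine is capture-free.
    have hy : y ∉ t.binders := fun h =>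
      hs.clean y (.inl ⟨rfl, by simp [Code.binders, h]⟩)
        (.inr (.inl (Stack.live_cons.2 (.inl (by simp [Code.fv])))))
    have hu := toTerm_substVar (x := x) hy
    refine ⟨.m1 F x y t _ π E hx hu, hs.inPlace (binders_substVar _ _ _) fun z hz => ?_⟩
    simpa [Code.fv] using mem_fv_of_ren1 hu hz
  | m2 F x t u π E l hx hv hl =>
    -- The Max MAM keeps the name of the binder for the new entry, so the renaming is trivial.
    refine ⟨.m2 F x x t t u π E l hx hv hl (rename_ren1_self _ _).symm ?_, hs.inPlace_entry⟩
    exact hs.clean x (.inl ⟨rfl, by simp [Code.binders]⟩)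
  | m3 F x t u π E =>
    exact ⟨.m3 F x t t u π E rfl, hs.inPlace_erase (he x t π (by simp))⟩
  | ered F x u π E e n h1 h2 h3 =>
    exact ⟨.exp F x u π E e h1 (.inl ⟨n, h2⟩) h3.1, hs.isRenaming h1 h3⟩
  | eabs F x v u π E e h1 h2 h3 =>
    exact ⟨.exp F x u _ E e h1 (.inr ⟨h2, by simp⟩) h3.1, hs.isRenaming h1 h3⟩

end MaxMAM

namespace MaxMAM

open Term Code

/-! ## The label computed by the Checking AM -/

/-- The first label if it is `red`, and the second one otherwise. -/
def Label.seq : Label → Label → Label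
  | .red n, _ => .red n
  | _, l => l

/-- Extend a labelling of the names below a binder. -/
def upL (L : ℕ → Option Label) : ℕ → Option Label
  | 0 => none
  | n + 1 => L n

open Classical in
/-- The label of a term whose free variables are labelled by `L`; the Boolean tells whether the
term is applied to an argument. -/
noncomputable def chk : (ℕ → Option Label) → Term → Bool → Label
  | L, .var n, a =>
    match L n with
    | none => .neu
    | some .neu => .neu
    | some .abs => if a then .red 2 else .abs
    | some (.red k) => .red (k + 1)
  | L, .lam t, _ => (chk (upL L) t false).seq .abs
  | L, .app (.lam t) u, _ => if t.Occurs 0 then .red 1 else (chk L u false).seq (.red 1)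
  | L, .app t u, _ => (chk L t true).seq ((chk L u false).seq .neu)

theorem chk_app {L : ℕ → Option Label} {t u : Term} {a : Bool} (h : t.NotLam) :
    chk L (.app t u) a = (chk L t true).seq ((chk L u false).seq .neu) := by
  cases t with
  | lam t => exact absurd rfl (h t)
  | var n => simp only [chk]
  | app t t' => simp only [chk]

theorem chk_redex {L : ℕ → Option Label} {t u : Term} {a : Bool} (h : t.Occurs 0) :
    chk L (.app (.lam t) u) a = .red 1 := by rw [chk]; simp [h]

theorem chk_erasing {L : ℕ → Option Label} {t u : Term} {a : Bool} (h : ¬ t.Occurs 0) :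
    chk L (.app (.lam t) u) a = (chk L u false).seq (.red 1) := by rw [chk]; simp [h]

theorem upL_comp (L : ℕ → Option Label) (f : ℕ → ℕ) : upL L ∘ upr f = upL (L ∘ f) := by
  funext n; cases n <;> rfl

/-- Labels depend on names only through `L`. This makes the output of the Checking AM insensitive to
the choice of names. -/
theorem chk_rename (L : ℕ → Option Label) (t : Term) (f : ℕ → ℕ) (a : Bool) :
    chk L (t.rename f) a = chk (L ∘ f) t a := by
  induction t generalizing L f a with
  | var n => simp [Term.rename, chk]
  | lam t ih => simp [Term.rename, chk, ih, upL_comp]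
  | app t u iht ihu =>
    cases t with
    | lam t =>
      simp only [Term.rename]
      by_cases h : t.Occurs 0
      · rw [chk_redex h, chk_redex (occurs_rename_upr.2 h)]
      · rw [chk_erasing h, chk_erasing (occurs_rename_upr.not.2 h), ihu]
    | var n =>
      have := iht L f true
      simp only [Term.rename] at this ⊢
      rw [chk_app (notLam_var _), chk_app (notLam_var _), ihu, this]
    | app t t' =>
      have := iht L f true
      simp only [Term.rename] at this ⊢
      rw [chk_app (notLam_app _ _), chk_app (notLam_app _ _), ihu, this]

/-- The labels of the names of an environment. -/
def Env.label (E : Env) (x : ℕ) : Option Label := (E.lookup x).map Entry.label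

/-- The label of an application to the arguments of a stack, where `l` is the label of the head. -/
noncomputable def argsLabel (L : ℕ → Option Label) : Stack → Label → Label
  | [], l => l
  | u :: π, l => l.seq (argsLabel L π ((chk L u.toTerm false).seq .neu))

/-- The label of a frame around a code of label `l`. -/
noncomputable def frameLabel (L : ℕ → Option Label) : Frame → Label → Label
  | [], l => l
  | .var _ :: F, l => l.seq (frameLabel L F .abs)
  | .head _ π :: F, l => l.seq (frameLabel L F (argsLabel L π .neu))
  | .erasing _ _ _ :: _, l => l.seq (.red 1)

/-- The label of an evaluated code. -/
def backLabel (L : ℕ → Option Label) : Code → Label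
  | .var x => match L x with
    | some .abs => .abs
    | _ => .neu
  | .lam _ _ => .abs
  | .app _ _ => .neu

/-- The label of a state of the Checking AM. -/
noncomputable def stateLabel (s : State) : Label :=
  match s.phase with
  | .eval => frameLabel s.env.label s.frame
      (chk s.env.label (Stack.plug s.stack s.code).toTerm false)
  | .back => frameLabel s.env.label s.frame
      (argsLabel s.env.label s.stack (backLabel s.env.label s.code))

theorem backLabel_seq (L : ℕ → Option Label) (t : Code) (k : Label) :
    (backLabel L t).seq k = k := by
  cases t <;> simp only [backLabel] <;> (try split) <;> rfl

theorem argsLabel_red (L : ℕ → Option Label) (π : Stack) (n : ℕ) :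
    argsLabel L π (.red n) = .red n := by cases π <;> rfl

theorem frameLabel_red (L : ℕ → Option Label) (F : Frame) (n : ℕ) :
    frameLabel L F (.red n) = .red n := by
  rcases F with _ | ⟨_ | _ | _, F⟩ <;> rfl

theorem argsLabel_seq (L : ℕ → Option Label) (π : Stack) (l k : Label) :
    argsLabel L π (l.seq k) = l.seq (argsLabel L π k) := by
  cases l <;> simp [Label.seq, argsLabel_red]

/-- An application has the same label whether or not it is itself applied, so the label can be
computed argument by argument from the head outwards. -/
theorem chk_plug_app (L : ℕ → Option Label) (π : Stack) (t u : Code) :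
    chk L (Stack.plug π (.app t u)).toTerm false =
      argsLabel L π (chk L (Code.app t u).toTerm false) := by
  induction π generalizing t u with
  | nil => rfl
  | cons v π ih =>
    rw [Stack.plug, ih, toTerm_app, toTerm_app, chk_app (notLam_app _ _), argsLabel_seq, argsLabel]
    congr 1
    by_cases h : t.toTerm.NotLam
    · rw [chk_app h, chk_app h]
    · cases t with
      | lam x t => simp only [toTerm_lam]; rw [chk, chk]
      | var => simp [notLam_var] at h
      | app => exact absurd (notLam_app _ _) h

theorem chk_plug (L : ℕ → Option Label) (π : Stack) {t u : Code} (h : t.toTerm.NotLam) :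
    chk L (Stack.plug (u :: π) t).toTerm false = argsLabel L (u :: π) (chk L t.toTerm true) := by
  rw [Stack.plug, chk_plug_app, toTerm_app, chk_app h, argsLabel_seq, argsLabel]

theorem CommStep.bound {τ : Trans} {s s' : State} (h : CommStep τ s s') {y : ℕ}
    (hy : s'.Bound y) : s.Bound y := by
  cases h <;> simp only [State.Bound, Code.binders, Stack.bs, List.mem_append, List.mem_cons,
    Item.Bound, reduceCtorEq] at * <;> grind [Item.Bound, Code.binders]

theorem Env.label_eq {E : Env} {x : ℕ} {l : Label} :
    E.label x = some l ↔ ∃ e, E.lookup x = some e ∧ e.label = l := by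
  simp [Env.label]

/-- The Checking AM searches for the first redex in the order in which `chk` combines labels with
`Label.seq`, so the label of what remains to be searched is invariant. Bound names must have no
entry: `chk` treats an opened binder as unlabelled, whereas the machine looks it up in the
environment. -/
theorem CommStep.stateLabel {τ : Trans} {s s' : State} (h : CommStep τ s s')
    (hb : ∀ y, s.Bound y → s.env.lookup y = none) : stateLabel s = stateLabel s' := by
  cases h with
  | c1 => rfl
  | c2 F x t E =>
    have hx : E.label x = none := by
      simpa [Env.label] using hb x (.inl ⟨rfl, by simp [Code.binders]⟩)
    have : upL E.label ∘ cl x = E.label := by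
      funext n
      by_cases h : n = x
      · subst h; simp [upL, hx]
      · simp [cl_ne h, upL]
    simp only [MaxMAM.stateLabel, Stack.plug, toTerm_lam, chk, chk_rename, this, frameLabel]
    cases chk E.label t.toTerm false <;> simp [Label.seq, frameLabel_red]
  | c3 F x π E hu =>
    simp only [MaxMAM.stateLabel]
    congr 1
    cases π with
    | nil =>
      simp only [Stack.plug, toTerm_var, chk, argsLabel, backLabel]
      rcases hu with h | ⟨e, h, h' | ⟨h', -⟩⟩
      · simp [Env.label, h]
      · simp [Env.label, h, h']
      · simp [Env.label, h, h']
    | cons u π =>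
      rw [chk_plug _ _ (by simp [notLam_var])]
      simp only [toTerm_var, chk, argsLabel, backLabel]
      rcases hu with h | ⟨e, h, h' | ⟨h', hh⟩⟩
      · simp [Env.label, h]
      · simp [Env.label, h, h']
      · simp at hh
  | c4 F x t E =>
    simp only [MaxMAM.stateLabel, argsLabel, frameLabel, backLabel_seq]
    rfl
  | c5 F t u π E =>
    simp only [MaxMAM.stateLabel, argsLabel, frameLabel, backLabel_seq]
    rfl
  | c6 F t u π E =>
    simp only [MaxMAM.stateLabel, argsLabel, frameLabel, Stack.plug, backLabel_seq]
    cases chk E.label u.toTerm false <;> simp [Label.seq, frameLabel_red, argsLabel_red]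
  | c7 F x t u π E hx =>
    simp only [MaxMAM.stateLabel, frameLabel, Stack.plug]
    rw [chk_plug_app, toTerm_app, toTerm_lam, chk_erasing (occurs_body.not.2 hx)]
    cases chk E.label u.toTerm false <;> simp [Label.seq, frameLabel_red, argsLabel_red]

theorem CheckOutput.stateLabel {s : State} {l : Label} (h : CheckOutput s l) :
    stateLabel s = l := by
  cases h with
  | o1 F x t u π E hx =>
    simp only [MaxMAM.stateLabel, Stack.plug]
    rw [chk_plug_app, toTerm_app, toTerm_lam, chk_redex (occurs_body.2 hx), argsLabel_red,
      frameLabel_red]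
  | o2 F x π E e n h h' =>
    have hl : E.label x = some (.red n) := Env.label_eq.2 ⟨e, h, h'⟩
    simp only [MaxMAM.stateLabel]
    cases π with
    | nil => simp [Stack.plug, chk, hl, frameLabel_red]
    | cons u π =>
      rw [chk_plug _ _ (by simp [notLam_var])]
      simp [chk, hl, argsLabel_red, frameLabel_red]
  | o3 F x u π E e h h' =>
    have hl : E.label x = some .abs := Env.label_eq.2 ⟨e, h, h'⟩
    simp only [MaxMAM.stateLabel]
    rw [chk_plug _ _ (by simp [notLam_var])]
    simp [chk, hl, argsLabel_red, frameLabel_red]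
  | o4 => rfl
  | o5 => rfl
  | o6 F x t u π E =>
    simp only [MaxMAM.stateLabel, argsLabel, frameLabel, backLabel_seq]

/-- The output of the Checking AM. -/
theorem Checks.label_eq {u : Code} {E : Env} {l : Label} (h : Checks u E l)
    (hb : ∀ y, y ∈ u.binders ∨ Env.Bound E y → E.lookup y = none) :
    l = chk E.label u.toTerm false := by
  obtain ⟨s, hs, ho⟩ := h
  have key : MaxMAM.stateLabel ⟨.eval, [], u, [], E⟩ = MaxMAM.stateLabel s ∧
      ∀ y, s.Bound y → s.env.lookup y = none := by
    clear ho
    induction hs with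
    | refl => exact ⟨rfl, fun y hy => hb y (by simpa [State.Bound, Stack.bs] using hy)⟩
    | tail _ h ih =>
      obtain ⟨τ, h⟩ := h
      refine ⟨ih.1.trans (h.stateLabel ih.2), fun y hy => ?_⟩
      have := ih.2 y (h.bound hy)
      cases h <;> exact this
  rw [← ho.stateLabel, ← key.1]
  rfl

/-! ## Soundness of labels -/

/-- A label describes a term correctly. -/
def Label.Sound : Option Label → Term → Prop
  | none, t => NF t ∧ NotLam t
  | some .neu, t => NF t ∧ NotLam t
  | some .abs, t => NF t ∧ ¬ NotLam t
  | some (.red _), t => ¬ NF t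

theorem Label.Sound.rename {l : Option Label} {t : Term} (h : Label.Sound l t) (f : ℕ → ℕ) :
    Label.Sound l (t.rename f) := by
  rcases l with _ | _ | _ | _ <;> simpa [Label.Sound, nf_rename, notLam_rename] using h

/-- For an applied variable labelled `abs` the value is normal but its application is not, so heads
of applications need the second half of the statement: there `red` means that applying the value to
any argument yields a reducible term. -/
theorem chk_sound {L : ℕ → Option Label} {f : ℕ → Term} (hL : ∀ n, Label.Sound (L n) (f n))
    (t : Term) : Label.Sound (some (chk L t false)) (t.inst f) ∧
      (NotLam t → ((∀ k, chk L t true ≠ .red k) ∧ NF (t.inst f) ∧ NotLam (t.inst f)) ∨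
        ((∃ k, chk L t true = .red k) ∧ ∀ v, ¬ NF (.app (t.inst f) v))) := by
  induction t generalizing L f with
  | var n =>
    have := hL n
    simp only [chk, inst]
    rcases h : L n with _ | _ | _ | _ <;> simp only [h] at this <;>
      simp_all [Label.Sound, NF]
  | lam t ih =>
    refine ⟨?_, fun h => absurd rfl (h t)⟩
    have := (ih (L := upL L) (f := ups f) ?_).1
    · simp only [chk, inst]
      rcases h : chk (upL L) t false with _ | _ | _ <;> rw [h] at this <;>
        simp_all [Label.Sound, Label.seq, NF, NotLam]
    · rintro (_ | n)
      · exact ⟨trivial, notLam_var _⟩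
      · exact (hL n).rename _
  | app t u iht ihu =>
    have ht := iht hL
    have hu := (ihu hL).1
    suffices h : (∀ a, chk L (.app t u) a = .neu) ∧ NF ((Term.app t u).inst f) ∨
        (∃ k, ∀ a, chk L (.app t u) a = .red k) ∧ ¬ NF ((Term.app t u).inst f) by
      rcases h with ⟨h1, h2⟩ | ⟨⟨k, h1⟩, h2⟩
      · exact ⟨by rw [h1]; exact ⟨h2, notLam_app _ _⟩,
          fun _ => .inl ⟨by simp [h1], h2, notLam_app _ _⟩⟩
      · exact ⟨by rw [h1]; exact h2, fun _ => .inr ⟨⟨k, h1 _⟩, fun v hv => h2 hv.1⟩⟩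
    by_cases hl : NotLam t
    · simp only [chk_app hl]
      rcases ht.2 hl with ⟨h1, h2, h3⟩ | ⟨⟨k, h1⟩, h2⟩
      · have : ∀ l, (chk L t true).seq l = l := by
          intro l
          cases h : chk L t true <;> first | rfl | exact absurd h (h1 _)
        simp only [this]
        rcases h : chk L u false with _ | _ | _ <;> rw [h] at hu <;>
          simp_all [Label.Sound, Label.seq, NF, inst]
      · exact .inr ⟨⟨k, by simp [h1, Label.seq]⟩, h2 _⟩
    · cases t with
      | var n => exact absurd (notLam_var n) hl
      | app => exact absurd (notLam_app _ _) hl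
      | lam t =>
        refine .inr ⟨?_, fun h => h.2.2 _ rfl⟩
        by_cases ho : t.Occurs 0
        · exact ⟨1, fun a => chk_redex ho⟩
        · simp only [chk_erasing ho]
          cases chk L u false <;> simp [Label.seq]

/-! ## Decoding -/

/-- The term that a code decodes to in an environment. -/
def dec (E : Env) (t : Code) : Term := (Env.unfold E t).toTerm

/-- The substitution defined by an environment. -/
def sg (E : Env) (x : ℕ) : Term := dec E (.var x)

theorem unfold_app (E : Env) (t u : Code) :
    Env.unfold E (.app t u) = .app (Env.unfold E t) (Env.unfold E u) := by
  induction E generalizing t u with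
  | nil => rfl
  | cons e E ih => simp [Env.unfold, graft, ih]

theorem unfold_lam (E : Env) (x : ℕ) (t : Code) :
    Env.unfold E (.lam x t) = .lam x (Env.unfold E t) := by
  induction E generalizing t with
  | nil => rfl
  | cons e E ih => simp [Env.unfold, graft, ih]

theorem dec_app (E : Env) (t u : Code) : dec E (.app t u) = .app (dec E t) (dec E u) := by
  simp [dec, unfold_app]

theorem dec_lam (E : Env) (x : ℕ) (t : Code) :
    dec E (.lam x t) = .lam ((dec E t).rename (cl x)) := by
  simp [dec, unfold_lam, toTerm_lam]

theorem sg_cons (e : Entry) (E : Env) (x : ℕ) :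
    sg (e :: E) x = if x = e.name then dec E e.code else sg E x := by
  simp only [sg, dec, Env.unfold, graft]
  split <;> rfl

theorem graft_of_not_mem {t : Code} {x : ℕ} (h : x ∉ t.names) (u : Code) : t.graft x u = t := by
  induction t with
  | var z => simp only [names, Finset.mem_singleton] at h; simp [graft, Ne.symm h]
  | lam z t ih => simp only [names, Finset.mem_insert, not_or] at h; simp [graft, ih h.2]
  | app t s iht ihs =>
    simp only [names, Finset.mem_union, not_or] at h; simp [graft, iht h.1, ihs h.2]

theorem dec_cons {e : Entry} {t : Code} (h : e.name ∉ t.names) (E : Env) :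
    dec (e :: E) t = dec E t := by simp [dec, Env.unfold, graft_of_not_mem h]

theorem occurs_dec {E : Env} {t : Code} {y : ℕ} (h : (dec E t).Occurs y) :
    y ∈ t.fv ∨ Env.Live E y := by
  induction E generalizing t y with
  | nil => exact .inl (mem_fv.2 h)
  | cons e E ihE =>
    induction t generalizing y with
    | var x =>
      change (sg _ _).Occurs y at h
      rw [sg_cons] at h
      rw [Env.live_cons]
      split at h
      · rcases ihE h with h | h <;> simp [h]
      · rcases ihE (t := .var x) h with h | h <;> simp [h]
    | lam x t ih =>
      rw [dec_lam, Occurs, occurs_rename] at h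
      obtain ⟨n, hn, e⟩ := h
      have hx : n ≠ x := by rintro rfl; simp at e
      obtain rfl : n = y := by simpa [cl_ne hx] using e
      simpa [fv, hx] using ih hn
    | app t u iht ihu =>
      rw [dec_app] at h
      rcases h with h | h
      · rcases iht h with h | h <;> simp [fv, h]
      · rcases ihu h with h | h <;> simp [fv, h]

theorem sg_of_not_live {E : Env} {x : ℕ} (h : E.lookup x = none) : sg E x = .var x := by
  induction E with
  | nil => simp [sg, dec, Env.unfold]
  | cons e E ih =>
    rw [Env.lookup_eq_none] at h ih
    rw [sg_cons, if_neg (fun hx => h e (by simp) hx.symm), ih fun e he => h e (by simp [he])]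

theorem lookup_of_not_live {E : Env} {x : ℕ} (h : ¬ Env.Live E x) : E.lookup x = none :=
  Env.lookup_eq_none.2 fun e he hx => h ⟨e, he, .inl hx.symm⟩

/-- Grafting may capture, but only names live in the environment are ever grafted in. If none of
them is a binder of `t`, unfolding is parallel substitution. -/
theorem dec_eq_inst {E : Env} {t : Code} (h : ∀ y ∈ t.binders, ¬ Env.Live E y) :
    dec E t = t.toTerm.inst (sg E) := by
  induction t with
  | var x => simp [inst, sg]
  | lam x t ih =>
    simp only [Code.binders, List.mem_cons, forall_eq_or_imp] at h
    rw [dec_lam, ih h.2, toTerm_lam, inst, rename_inst, inst_rename]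
    congr 1
    apply inst_congr
    intro n _
    by_cases hn : n = x
    · subst hn
      simp [sg_of_not_live (lookup_of_not_live h.1), Term.rename]
    · simp only [Function.comp, cl_ne hn, ups_succ]
      apply rename_congr
      intro m hm
      rcases occurs_dec hm with hm | hm
      · simp only [fv, Finset.mem_singleton] at hm
        exact cl_ne (hm ▸ hn)
      · exact cl_ne (fun e => h.1 (e ▸ hm))
  | app t u iht ihu =>
    simp only [Code.binders, List.mem_append] at h
    rw [dec_app, iht fun y hy => h y (.inl hy), ihu fun y hy => h y (.inr hy)]
    rfl

theorem subst_rename_cl (t v : Term) (x : ℕ) :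
    (t.rename (cl x)).subst 0 v = t.inst (fun n => if n = x then v else .var n) := by
  rw [subst_zero, rename_inst]
  congr 1
  funext n
  by_cases h : n = x
  · subst h; simp
  · simp [cl_ne h, h]

end MaxMAM

namespace MaxMAM

open Term Code

/-! ## Invariants of the machine -/

/-- Environments whose entries are well-ordered and correctly labelled. -/
def Env.OK : Env → Prop
  | [] => True
  | e :: E => (∀ e' ∈ e :: E, e.name ∉ e'.code.names) ∧ (∀ e' ∈ E, e'.name ≠ e.name) ∧
      (∀ y, e.code ≠ .var y) ∧ Label.Sound (some e.label) (dec E e.code) ∧ Env.OK E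

/-- By definition an entry is unfolded in the older part of the environment only. No newer name
occurs in its code, so unfolding it in the whole environment gives the same term. -/
theorem Env.OK.lookup {E : Env} (h : E.OK) {x : ℕ} {e : Entry} (he : E.lookup x = some e) :
    sg E x = dec E e.code ∧ Label.Sound (some e.label) (dec E e.code) ∧
      ∀ y, e.code ≠ .var y := by
  induction E with
  | nil => simp [Env.lookup] at he
  | cons e' E ih =>
    obtain ⟨h1, h2, h3, h4, h5⟩ := h
    have hm := Env.lookup_eq_some he
    have hn := h1 e hm.1
    rw [sg_cons, dec_cons hn]
    by_cases hx : e'.name = x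
    · obtain rfl : e' = e := by simpa [Env.lookup, hx] using he
      rw [if_pos hx.symm]
      exact ⟨rfl, h4, h3⟩
    · rw [if_neg (Ne.symm hx)]
      exact ih h5 (by simpa [Env.lookup, hx] using he)

theorem Env.OK.sound {E : Env} (h : E.OK) (x : ℕ) : Label.Sound (E.label x) (sg E x) := by
  rcases he : E.lookup x with _ | e
  · rw [sg_of_not_live he, Env.label, he]
    exact ⟨trivial, notLam_var _⟩
  · obtain ⟨h1, h2, -⟩ := h.lookup he
    rw [h1, Env.label, he]
    exact h2

theorem Env.OK.isLam {E : Env} (h : E.OK) {x : ℕ} {e : Entry} (he : E.lookup x = some e)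
    (hl : e.label = .abs) : e.code.IsLam := by
  obtain ⟨-, h2, h3⟩ := h.lookup he
  rw [hl] at h2
  cases hc : e.code with
  | var y => exact absurd hc (h3 y)
  | lam => trivial
  | app => rw [hc, dec_app] at h2; exact absurd (notLam_app _ _) h2.2

/-- The invariant of the machine. -/
structure Good (s : State) : Prop where
  clean : Clean s
  erases : Frame.Erases s.frame
  env : s.env.OK
  head : ∀ h π, Item.head h π ∈ s.frame → NF (dec s.env h) ∧ NotLam (dec s.env h)
  back : s.phase = .back → NF (dec s.env s.code) ∧ (s.stack ≠ [] → NotLam (dec s.env s.code))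

theorem Good.initial {t : Code} (h : t.WellNamed) : Good (State.initial t) where
  clean := (Inv.initial (b := true) h).clean
  erases := by simp [Frame.Erases, State.initial]
  env := trivial
  head := by simp [State.initial]
  back := by simp [State.initial]

theorem Clean.dec_code {F : Frame} {t : Code} {π : Stack} {E : Env}
    (h : Clean ⟨.eval, F, t, π, E⟩) : dec E t = t.toTerm.inst (sg E) :=
  dec_eq_inst fun y hy hl => h y (.inl ⟨rfl, hy⟩) (.inr (.inr (.inr hl)))

theorem Clean.dec_entry {s : State} (h : Clean s) {e : Entry} (he : e ∈ s.env) :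
    dec s.env e.code = e.code.toTerm.inst (sg s.env) :=
  dec_eq_inst fun y hy hl => h y (.inr (.inr (.inr ⟨e, he, hy⟩))) (.inr (.inr (.inr hl)))

theorem dec_app_notLam (E : Env) (t u : Code) : NotLam (dec E (.app t u)) := by
  rw [dec_app]; exact notLam_app _ _

theorem plug_congr {E : Env} {t t' : Code} (h : dec E t = dec E t') (π : Stack) :
    dec E (Stack.plug π t) = dec E (Stack.plug π t') := by
  induction π generalizing t t' with
  | nil => exact h
  | cons u π ih => exact ih (by rw [dec_app, dec_app, h])

theorem frame_congr {E : Env} {t t' : Code} (h : dec E t = dec E t') (F : Frame) :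
    dec E (Frame.plug F t) = dec E (Frame.plug F t') := by
  induction F generalizing t t' with
  | nil => exact h
  | cons φ F ih =>
    cases φ with
    | var x => exact ih (by rw [dec_lam, dec_lam, h])
    | head u π => exact ih (plug_congr (by rw [dec_app, dec_app, h]) π)
    | erasing x u π => exact ih (plug_congr (by rw [dec_app, dec_app, h]) π)

theorem plug_ms {E E' : Env} {π : Stack} {t t' : Code} (hπ : ∀ u ∈ π, dec E' u = dec E u)
    (hl : NotLam (dec E t)) (h : MS (dec E t) (dec E' t')) :
    MS (dec E (Stack.plug π t)) (dec E' (Stack.plug π t')) := by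
  induction π generalizing t t' with
  | nil => exact h
  | cons u π ih =>
    refine ih (fun v hv => hπ v (by simp [hv])) (dec_app_notLam _ _ _) ?_
    rw [dec_app, dec_app, hπ u (by simp)]
    exact .appL hl h

/-- Two environments agree on a frame. -/
def FrameAgree (E E' : Env) : Item → Prop
  | .var _ => True
  | .head h π => dec E' h = dec E h ∧ ∀ u ∈ π, dec E' u = dec E u
  | .erasing x t π => dec E' (.lam x t) = dec E (.lam x t) ∧ ∀ u ∈ π, dec E' u = dec E u

/-- The hypotheses on heads and on erasing items are the side conditions of maximal contexts. A
second environment is needed because `m2` adds an entry, which must not change the decoding of the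
context. -/
theorem frame_ms {E E' : Env} {F : Frame} {t t' : Code} (hF : ∀ φ ∈ F, FrameAgree E E' φ)
    (hh : ∀ h π, Item.head h π ∈ F → NF (dec E h) ∧ NotLam (dec E h))
    (he : ∀ x t π, Item.erasing x t π ∈ F → x ∉ t.fv ∧ ¬ Env.Live E x)
    (h : MS (dec E t) (dec E' t')) :
    MS (dec E (Frame.plug F t)) (dec E' (Frame.plug F t')) := by
  induction F generalizing t t' with
  | nil => exact h
  | cons φ F ih =>
    have ih := fun {t t'} => ih (t := t) (t' := t') (fun φ hφ => hF φ (by simp [hφ]))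
      (fun h π hm => hh h π (by simp [hm])) (fun x t π hm => he x t π (by simp [hm]))
    have h1 := hF φ (by simp)
    cases φ with
    | var x => exact ih (by rw [dec_lam, dec_lam]; exact .lam (h.rename _))
    | head u π =>
      refine ih (plug_ms h1.2 (dec_app_notLam _ _ _) ?_)
      rw [dec_app, dec_app, h1.1]
      have := hh u π (by simp)
      exact .appR this.1 this.2 h
    | erasing x u π =>
      refine ih (plug_ms h1.2 (dec_app_notLam _ _ _) ?_)
      rw [dec_app, dec_app, h1.1, dec_lam]
      refine .gc (fun ho => ?_) h
      rw [occurs_rename] at ho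
      obtain ⟨n, hn, e⟩ := ho
      have := he x u π (by simp)
      obtain rfl : n = x := by by_contra hne; simp [cl_ne hne] at e
      exact (occurs_dec hn).elim this.1 this.2

theorem Good.erasing {s : State} (h : Good s) {x : ℕ} {t : Code} {π : Stack}
    (hm : Item.erasing x t π ∈ s.frame) : x ∉ t.fv ∧ ¬ Env.Live s.env x :=
  ⟨h.erases x t π hm, fun hl => h.clean x
    (.inr (.inr (.inl ⟨_, hm, .inl (by simp [Code.binders])⟩))) (.inr (.inr (.inr hl)))⟩

/-- The contraction of a redex that is not erasing, where the variable becomes `y`. -/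
theorem ms_redex {E E' : Env} {x y : ℕ} {t u v : Code} (hx : x ∈ t.fv) (hxE : ¬ Env.Live E x)
    (hu : u.toTerm = t.toTerm.rename (ren1 x y)) (ht : dec E t = t.toTerm.inst (sg E))
    (hd : dec E' u = u.toTerm.inst (sg E')) (hy : sg E' y = dec E v)
    (hsg : ∀ n ∈ t.fv, n ≠ x → sg E' n = sg E n) :
    MS (dec E (.app (.lam x t) v)) (dec E' u) := by
  have ho : ((dec E t).rename (cl x)).Occurs 0 := by
    rw [occurs_rename]
    refine ⟨x, ?_, cl_self x⟩
    rw [ht, occurs_inst]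
    exact ⟨x, mem_fv.1 hx, by rw [sg_of_not_live (lookup_of_not_live hxE)]; rfl⟩
  have : dec E' u = ((dec E t).rename (cl x)).subst 0 (dec E v) := by
    rw [hd, hu, subst_rename_cl, ht, rename_inst, inst_inst]
    apply inst_congr
    intro n hn
    by_cases h : n = x
    · subst h
      simp [ren1, hy, sg_of_not_live (lookup_of_not_live hxE), inst]
    · simp only [Function.comp, ren1, h, if_false]
      -- The values of the other names do not contain `x`, so the substitution for `x` leaves them
      -- alone.
      rw [hsg n (mem_fv.2 hn) h, inst_id]
      intro m hm
      rw [if_neg]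
      rintro rfl
      rcases occurs_dec hm with hm | hm
      · simp only [fv, Finset.mem_singleton] at hm; exact h hm.symm
      · exact hxE hm
  rw [dec_app, dec_lam, this]
  exact .root (.inl ho)

theorem CommStep.plug_eq {τ : Trans} {s s' : State} (h : CommStep τ s s') :
    Frame.plug s'.frame (Stack.plug s'.stack s'.code) =
      Frame.plug s.frame (Stack.plug s.stack s.code) := by
  cases h <;> rfl

theorem CommStep.env_eq {τ : Trans} {s s' : State} (h : CommStep τ s s') : s'.env = s.env := by
  cases h <;> rfl

/-- What is known on the new entry when a redex `(λx.t) v` is stored as `[x' ← v]`. -/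
theorem entry_agree {F : Frame} {x x' : ℕ} {t u v : Code} {π : Stack} {E : Env} {l : Label}
    (hc : Clean ⟨.eval, F, u, π, ⟨x', v, l⟩ :: E⟩)
    (hx : ¬ State.Live ⟨.eval, F, .lam x t, v :: π, E⟩ x') :
    (∀ w, w = v ∨ w ∈ π ∨ (∃ e ∈ E, e.code = w) → x' ∉ w.names) ∧
    (∀ φ ∈ F, FrameAgree E (⟨x', v, l⟩ :: E) φ) ∧
    (∀ h π, Item.head h π ∈ F → x' ∉ h.names) ∧ ∀ e ∈ E, e.name ≠ x' := by
  -- The new name is live after the transition, so cleanness excludes it as a binder; `hx` excludes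
  -- it as a live name of the old state. It therefore occurs in none of the codes at stake.
  have hl : State.Live ⟨.eval, F, u, π, ⟨x', v, l⟩ :: E⟩ x' :=
    .inr (.inr (.inr (Env.live_cons.2 (.inl (.inl rfl)))))
  have hb : ¬ State.Bound ⟨.eval, F, u, π, ⟨x', v, l⟩ :: E⟩ x' := fun h => hc _ h hl
  simp only [State.Live, Phase.Live, Stack.live_cons, not_or] at hx
  simp only [State.Bound, Env.bound_cons, not_or, not_exists, not_and, true_imp_iff] at hb
  obtain ⟨-, ⟨hv, hπ⟩, hF, hE⟩ := hx
  obtain ⟨-, bπ, bF, bv, bE⟩ := hb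
  have key : ∀ w : Code, w = v ∨ w ∈ π ∨ (∃ e ∈ E, e.code = w) → x' ∉ w.names := by
    intro w hw hn
    rw [mem_names] at hn
    rcases hw with rfl | hw | ⟨e, he, rfl⟩
    · exact hn.elim hv bv
    · exact hn.elim (fun h => hπ ⟨w, hw, h⟩) fun h => bπ (mem_stack_bs.2 ⟨w, hw, h⟩)
    · exact hn.elim (fun h => hE ⟨e, he, .inr h⟩) fun h => bE ⟨e, he, h⟩
  refine ⟨key, fun φ hφ => ?_, fun h π' hm hn => hF ⟨_, hm, .inl hn⟩,
    fun e he hn => hE ⟨e, he, .inl hn.symm⟩⟩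
  have h1 : ¬ φ.Live x' := fun h => hF ⟨φ, hφ, h⟩
  have h2 := bF φ hφ
  have hs : ∀ π' : Stack, ¬ Stack.Live π' x' → x' ∉ Stack.bs π' →
      ∀ w ∈ π', dec (⟨x', v, l⟩ :: E) w = dec E w := by
    intro π' h1 h2 w hw
    refine dec_cons (fun hn => ?_) E
    exact (mem_names.1 hn).elim (fun h => h1 ⟨w, hw, h⟩)
      fun h => h2 (mem_stack_bs.2 ⟨w, hw, h⟩)
  cases φ with
  | var => trivial
  | head h π' =>
    simp only [Item.Live, Item.Bound, not_or] at h1 h2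
    exact ⟨dec_cons h1.1 E, hs π' h1.2 h2⟩
  | erasing z w π' =>
    simp only [Item.Live, Item.Bound, not_or] at h1 h2
    exact ⟨dec_cons (fun hn => (mem_names.1 hn).elim h1.1 h2.1) E, hs π' h1.2 h2.2⟩

theorem Good.live_lam {F : Frame} {x : ℕ} {t : Code} {π : Stack} {E : Env}
    (h : Good ⟨.eval, F, .lam x t, π, E⟩) : ¬ Env.Live E x := fun hl =>
  h.clean x (.inl ⟨rfl, by simp [Code.binders]⟩) (.inr (.inr (.inr hl)))

theorem Good.dec_body {F : Frame} {x : ℕ} {t : Code} {π : Stack} {E : Env}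
    (h : Good ⟨.eval, F, .lam x t, π, E⟩) : dec E t = t.toTerm.inst (sg E) :=
  dec_eq_inst fun y hy hl =>
    h.clean y (.inl ⟨rfl, by simp [Code.binders, hy]⟩) (.inr (.inr (.inr hl)))

theorem FrameAgree.refl (E : Env) (φ : Item) : FrameAgree E E φ := by
  cases φ <;> simp [FrameAgree]

/-- The machine implements the maximal strategy. -/
theorem GStep.decode {m : Bool} {s s' : State} (h : GStep m s s') (hs : Good s)
    (hc : Clean s') : if m then MS s.decode s'.decode else s'.decode = s.decode := by
  cases h with
  | comm h => simp only [Bool.false_eq_true, if_false, State.decode, h.plug_eq, h.env_eq]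
  | m1 F x y t u π E hx hu =>
    refine frame_ms (fun _ _ => .refl _ _) hs.head (fun _ _ _ => hs.erasing) ?_
    refine plug_ms (fun _ _ => rfl) (dec_app_notLam _ _ _) ?_
    exact ms_redex hx hs.live_lam hu hs.dec_body hc.dec_code rfl fun _ _ _ => rfl
  | m2 F x x' t u v π E l hx hv hl hu hx' =>
    obtain ⟨h1, h2, h3, h4⟩ := entry_agree hc hx'
    refine frame_ms h2 hs.head (fun _ _ _ => hs.erasing) ?_
    refine plug_ms (fun w hw => dec_cons (h1 w (.inr (.inl hw))) E)
      (dec_app_notLam _ _ _) ?_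
    refine ms_redex hx hs.live_lam hu hs.dec_body hc.dec_code (by simp [sg_cons]) ?_
    intro n hn hnx
    rw [sg_cons, if_neg]
    rintro rfl
    exact hx' (.inl (by simp [Phase.Live, fv, hn, hnx]))
  | m3 F x t u v π E hu =>
    refine frame_ms (fun _ _ => .refl _ _) (fun h π hm => hs.head h π (List.mem_cons_of_mem _ hm))
      (fun _ _ _ hm => hs.erasing (List.mem_cons_of_mem _ hm)) ?_
    refine plug_ms (fun _ _ => rfl) (dec_app_notLam _ _ _) ?_
    have he := hs.erasing (x := x) (t := t) (π := π) (by simp)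
    have hb := dec_eq_inst (E := E) (t := t) fun y hy hl =>
      hs.clean y (.inr (.inr (.inl ⟨_, List.mem_cons_self, .inl (by simp [Code.binders, hy])⟩)))
        (.inr (.inr (.inr hl)))
    have : dec E u = ((dec E t).rename (cl x)).subst 0 (dec E v) := by
      rw [subst_rename_cl, inst_id, hc.dec_code, hu, hb]
      intro n hn
      rw [if_neg]
      rintro rfl
      exact (occurs_dec hn).elim he.1 he.2
    rw [dec_app, dec_lam, this]
    -- The erased argument has been evaluated: in the backtracking phase the code decodes to a
    -- normal term, as an erasing step requires.
    exact .root (.inr (hs.back rfl).1)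
  | exp F x u π E e he hl hu =>
    simp only [Bool.false_eq_true, if_false, State.decode]
    refine frame_congr (plug_congr ?_ π) F
    rw [hc.dec_code, hu, ← Clean.dec_entry hs.clean (Env.lookup_eq_some he).1]
    exact (hs.env.lookup he).1.symm

/-- Normality in the backtracking phase starts with `c3`: by soundness of labels, a variable that is
useless to replace decodes to a normal term, and not to an abstraction if arguments are waiting.
`c4` and `c5` rebuild normal terms from normal parts. The label of a new entry is sound because the
Checking AM outputs the value of `chk`. -/
theorem GStep.good {m : Bool} {s s' : State} (h : GStep m s s') (hs : Good s)
    (hc : Clean s') : Good s' := by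
  have her := h.erases hs.erases
  cases h with
  | comm h =>
    refine ⟨hc, her, h.env_eq ▸ hs.env, ?_, ?_⟩
    · have := hs.head
      have := hs.back
      cases h <;> simp only [List.mem_cons] at * <;> grind
    · have h1 := hs.head
      have h2 := hs.back
      cases h with
      | c3 F x π E hu =>
        intro _
        have h := hs.env.sound x
        change NF (sg E x) ∧ (_ → NotLam (sg E x))
        rcases hu with h' | ⟨e, h', h'' | ⟨h'', h3⟩⟩
        · rw [Env.label, h'] at h; exact ⟨h.1, fun _ => h.2⟩
        · rw [Env.label, h', Option.map_some, h''] at h; exact ⟨h.1, fun _ => h.2⟩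
        · rw [Env.label, h', Option.map_some, h''] at h; exact ⟨h.1, fun h => absurd h3 h⟩
      | c4 F x t E =>
        intro _
        simp only [dec_lam, NF, nf_rename]
        exact ⟨(h2 rfl).1, by simp⟩
      | c5 F t u π E =>
        intro _
        have := h1 t π (by simp)
        simp only [dec_app, NF]
        exact ⟨⟨this.1, (h2 rfl).1, this.2⟩, fun _ => notLam_app _ _⟩
      | _ => simp
  | m1 F x y t u π E hx hu => exact ⟨hc, her, hs.env, hs.head, by simp⟩
  | m2 F x x' t u v π E l hx hv hl hu hx' =>
    obtain ⟨h1, h2, h3, h4⟩ := entry_agree hc hx'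
    have hb : ∀ y ∈ v.binders, ¬ Env.Live E y := fun y hy hn =>
      hs.clean y (.inr (.inl (by simp [Stack.bs, hy]))) (.inr (.inr (.inr hn)))
    refine ⟨hc, her, ⟨?_, h4, hv, ?_, hs.env⟩, ?_, by simp⟩
    · rintro e he
      simp only [List.mem_cons] at he
      rcases he with rfl | he
      · exact h1 _ (.inl rfl)
      · exact h1 _ (.inr (.inr ⟨e, he, rfl⟩))
    · have := (chk_sound hs.env.sound v.toTerm).1
      rw [← dec_eq_inst hb, ← hl.label_eq] at this
      · exact this
      · intro y hy
        apply lookup_of_not_live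
        intro hn
        rcases hy with hy | hy
        · exact hb y hy hn
        · exact hs.clean y (.inr (.inr (.inr hy))) (.inr (.inr (.inr hn)))
    · intro h π' hm
      rw [dec_cons (h3 h π' hm)]
      exact hs.head h π' hm
  | m3 F x t u v π E hu =>
    exact ⟨hc, her, hs.env, fun h π hm => hs.head h π (by simp [hm]), by simp⟩
  | exp F x u π E e he hl hu => exact ⟨hc, her, hs.env, hs.head, by simp⟩

end MaxMAM

namespace MaxMAM

open Term Code

/-! ## Properties of all codes that are not evaluated -/

/-- The property `P` holds for the codes of a frame item that are not evaluated. -/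
def Item.All (P : Code → Prop) : Item → Prop
  | .var _ => True
  | .head _ π => ∀ u ∈ π, P u
  | .erasing x t π => P (.lam x t) ∧ ∀ u ∈ π, P u

/-- The property `P` holds for the codes of a state that are not evaluated. -/
structure State.All (P : Code → Prop) (s : State) : Prop where
  code : s.phase = .eval → P s.code
  stack : ∀ u ∈ s.stack, P u
  frame : ∀ φ ∈ s.frame, Item.All P φ
  env : ∀ e ∈ s.env, P e.code

/-- A property of codes that holds for the subcodes. -/
structure Hereditary (P : Code → Prop) : Prop where
  lam : ∀ x t, P (.lam x t) → P t
  left : ∀ t u, P (.app t u) → P t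
  right : ∀ t u, P (.app t u) → P u

theorem CommStep.all {P : Code → Prop} (hP : Hereditary P) {τ : Trans} {s s' : State}
    (h : CommStep τ s s') (hs : s.All P) : s'.All P := by
  obtain ⟨h1, h2, h3, h4⟩ := hs
  have p1 := hP.lam
  have p2 := hP.left
  have p3 := hP.right
  cases h <;> constructor <;> simp only [List.forall_mem_cons, Item.All, reduceCtorEq] at * <;> grind

theorem GStep.all {P : Code → Prop} (hP : Hereditary P) {m : Bool} {s s' : State}
    (h : GStep m s s') (hs : s.All P) (hn : s'.phase = .eval → P s'.code) : s'.All P := by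
  cases h with
  | comm h => exact h.all hP hs
  | m1 => exact ⟨hn, fun u hu => hs.stack u (by simp [hu]), hs.frame, hs.env⟩
  | m2 =>
    refine ⟨hn, fun u hu => hs.stack u (by simp [hu]), hs.frame, ?_⟩
    simp only [List.mem_cons, forall_eq_or_imp]
    exact ⟨hs.stack _ (by simp), hs.env⟩
  | m3 =>
    exact ⟨hn, (hs.frame _ (List.mem_cons_self)).2, fun φ hφ => hs.frame φ (by simp [hφ]), hs.env⟩
  | exp => exact ⟨hn, hs.stack, hs.frame, hs.env⟩

theorem hereditary_size (N : ℕ) : Hereditary (fun t => t.size ≤ N) := by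
  constructor <;> intros <;> simp only [size_lam, size_app] at * <;> omega

theorem size_eq_of_rename {t u : Code} {f : ℕ → ℕ} (h : u.toTerm = t.toTerm.rename f) :
    u.size = t.size := by simp [Code.size, h]

/-- Subterm property: a copied code has the size of a stored one, and stored codes arise by taking
subcodes and renaming. Evaluated codes may grow, but they are neither copied nor stored as entries.
-/
theorem GStep.sizes {N : ℕ} {m : Bool} {s s' : State} (h : GStep m s s')
    (hs : s.All (fun t => t.size ≤ N)) : s'.All (fun t => t.size ≤ N) := by
  have hP := hereditary_size N
  refine h.all hP hs fun hp => ?_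
  cases h with
  | comm h => exact (h.all hP hs).code hp
  | m1 F x y t u π E hx hu => exact size_eq_of_rename hu ▸ hP.lam _ _ (hs.code rfl)
  | m2 F x x' t u v π E l hx hv hl hu => exact size_eq_of_rename hu ▸ hP.lam _ _ (hs.code rfl)
  | m3 F x t u v π E hu =>
    have := hP.lam _ _ (hs.frame _ (List.mem_cons_self)).1
    simpa [Code.size, hu] using this
  | exp F x u π E e he hl hu =>
    have := hs.env e (Env.lookup_eq_some he).1
    simpa [Code.size, hu] using this

/-! ## The potential of a state -/

/-- The weight of a stack. -/
def Stack.weight : Stack → ℕ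
  | [] => 0
  | u :: π => 3 * u.size + 2 + Stack.weight π

/-- The weight of a frame. -/
def Frame.weight : Frame → ℕ
  | [] => 0
  | .var _ :: F => 1 + Frame.weight F
  | .head _ π :: F => 1 + Stack.weight π + Frame.weight F
  | .erasing _ _ π :: F => 1 + Stack.weight π + Frame.weight F

/-- The weight of the code. -/
def codeWeight : Phase → Code → Stack → ℕ
  | .eval, t, π => if Redex t π then 0 else 3 * t.size
  | .back, _, _ => 0

/-- The weight of a state decreases with commutative transitions. -/
def State.weight (s : State) : ℕ :=
  codeWeight s.phase s.code s.stack + Stack.weight s.stack + Frame.weight s.frame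

theorem codeWeight_le (φ : Phase) (t : Code) (π : Stack) : codeWeight φ t π ≤ 3 * t.size := by
  cases φ <;> simp only [codeWeight]
  · split <;> omega
  · exact Nat.zero_le _

/-- The weight 3 per constructor leaves one unit for each visit: on the way down, when passing to an
argument, and on backtracking, the last one being held by the frame item. An abstraction in front of
an argument weighs nothing, because its body is not visited before the redex is fired. -/
theorem CommStep.weight {τ : Trans} {s s' : State} (h : CommStep τ s s') :
    s'.weight < s.weight := by
  cases h <;> simp only [State.weight, Stack.weight, Frame.weight]
  · next F t u π E =>
    have := codeWeight_le .eval t (u :: π)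
    simp only [codeWeight, Redex, Code.IsLam, false_and, if_false, size_app] at *
    omega
  · next F x t E =>
    have := codeWeight_le .eval t []
    simp only [codeWeight, Redex, ne_eq, not_true, and_false, if_false, size_lam] at *
    omega
  · simp [codeWeight, Redex, Code.IsLam]
  · simp [codeWeight]
  · simp [codeWeight]
  · simp [codeWeight, Redex]; omega
  · simp [codeWeight, Redex, Code.IsLam]; omega

theorem not_redex_var (x : ℕ) (π : Stack) : ¬ Redex (.var x) π := fun h => h.1

/-! ### Enclosing codes and the age of entries. -/

/-- Helper for `Outer`. -/
def outerStack (Z : Code) (k : Code → Prop) : Stack → Code → Prop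
  | [], t => k t
  | u :: π, t => Z = .app t u ∨ outerStack Z k π (.app t u)

/-- Helper for `Outer`. -/
def outerFrame (Z : Code) : Frame → Code → Prop
  | [], _ => False
  | .var x :: F, t => Z = .lam x t ∨ outerFrame Z F (.lam x t)
  | .head h π :: F, t => Z = .app h t ∨ outerStack Z (outerFrame Z F) π (.app h t)
  | .erasing x b π :: F, t =>
    Z = .app (.lam x b) t ∨ outerStack Z (outerFrame Z F) π (.app (.lam x b) t)

/-- The code `Z` strictly encloses `t` in the context given by `π` and `F`. -/
def Outer (Z t : Code) (π : Stack) (F : Frame) : Prop := outerStack Z (outerFrame Z F) π t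

/-- The evaluation is inside of the code `Z`. -/
def Inside (Z : Code) : Phase → Code → Stack → Frame → Prop
  | .eval, t, π, F => Outer Z t π F ∨ Z = t ∧ ¬ Redex t π ∧ ∀ y, t ≠ .var y
  | .back, t, π, F => Outer Z t π F ∨ Z = t

theorem outerStack_names {Z : Code} {k : Code → Prop} (hk : ∀ t, k t → t.names ⊆ Z.names)
    {π : Stack} {t : Code} (h : outerStack Z k π t) : t.names ⊆ Z.names := by
  induction π generalizing t with
  | nil => exact hk t h
  | cons u π ih =>
    rcases h with rfl | h
    · exact Finset.subset_union_left
    · exact Finset.subset_union_left.trans (ih h)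

theorem outerFrame_names {Z : Code} {F : Frame} {t : Code} (h : outerFrame Z F t) :
    t.names ⊆ Z.names := by
  induction F generalizing t with
  | nil => exact h.elim
  | cons φ F ih =>
    cases φ with
    | var x =>
      rcases h with rfl | h
      · exact Finset.subset_insert _ _
      · exact (Finset.subset_insert _ _).trans (ih h)
    | _ =>
      rcases h with rfl | h
      · exact Finset.subset_union_right
      · exact Finset.subset_union_right.trans (outerStack_names (fun _ => ih) h)

theorem Outer.names {Z t : Code} {π : Stack} {F : Frame} (h : Outer Z t π F) :
    t.names ⊆ Z.names := outerStack_names (fun _ => outerFrame_names) h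

/-- Replacing the innermost code by one with the same decoding changes the enclosing code `Z`
syntactically but not its decoding, so its being reducible survives; the set `S` bounds the names
that may appear. -/
theorem outerStack_replace {E : Env} {Z t t' : Code} {k : Code → Code → Prop} {S : Finset ℕ}
    (hk : ∀ t t', k Z t → dec E t = dec E t' → t'.names ⊆ t.names ∪ S →
      ∃ Z', k Z' t' ∧ dec E Z' = dec E Z ∧ Z'.names ⊆ Z.names ∪ S)
    {π : Stack} (h : outerStack Z (k Z) π t) (hd : dec E t = dec E t')
    (hn : t'.names ⊆ t.names ∪ S) :
    ∃ Z', outerStack Z' (k Z') π t' ∧ dec E Z' = dec E Z ∧ Z'.names ⊆ Z.names ∪ S := by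
  induction π generalizing t t' with
  | nil => exact hk t t' h hd hn
  | cons u π ih =>
    have hd' : dec E (.app t u) = dec E (.app t' u) := by rw [dec_app, dec_app, hd]
    have hn' : (Code.app t' u).names ⊆ (Code.app t u).names ∪ S := by
      simp only [Code.names]; grind
    rcases h with rfl | h
    · exact ⟨_, .inl rfl, hd'.symm, hn'⟩
    · obtain ⟨Z', h1, h2, h3⟩ := ih h hd' hn'
      exact ⟨Z', .inr h1, h2, h3⟩

theorem outerFrame_replace {E : Env} {Z t t' : Code} {S : Finset ℕ} {F : Frame}
    (h : outerFrame Z F t) (hd : dec E t = dec E t') (hn : t'.names ⊆ t.names ∪ S) :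
    ∃ Z', outerFrame Z' F t' ∧ dec E Z' = dec E Z ∧ Z'.names ⊆ Z.names ∪ S := by
  induction F generalizing t t' with
  | nil => exact h.elim
  | cons φ F ih =>
    cases φ with
    | var x =>
      have hd' : dec E (.lam x t) = dec E (.lam x t') := by rw [dec_lam, dec_lam, hd]
      have hn' : (Code.lam x t').names ⊆ (Code.lam x t).names ∪ S := by
        simp only [Code.names]; grind
      rcases h with rfl | h
      · exact ⟨_, .inl rfl, hd'.symm, hn'⟩
      · obtain ⟨Z', h1, h2, h3⟩ := ih h hd' hn'
        exact ⟨Z', .inr h1, h2, h3⟩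
    | head u π =>
      have hd' : dec E (.app u t) = dec E (.app u t') := by rw [dec_app, dec_app, hd]
      have hn' : (Code.app u t').names ⊆ (Code.app u t).names ∪ S := by
        simp only [Code.names]; grind
      rcases h with rfl | h
      · exact ⟨_, .inl rfl, hd'.symm, hn'⟩
      · obtain ⟨Z', h1, h2, h3⟩ :=
          outerStack_replace (k := fun Z => outerFrame Z F) (fun _ _ => ih) h hd' hn'
        exact ⟨Z', .inr h1, h2, h3⟩
    | erasing x b π =>
      have hd' : dec E (.app (.lam x b) t) = dec E (.app (.lam x b) t') := by
        rw [dec_app, dec_app, hd]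
      have hn' : (Code.app (.lam x b) t').names ⊆ (Code.app (.lam x b) t).names ∪ S := by
        simp only [Code.names]; grind
      rcases h with rfl | h
      · exact ⟨_, .inl rfl, hd'.symm, hn'⟩
      · obtain ⟨Z', h1, h2, h3⟩ :=
          outerStack_replace (k := fun Z => outerFrame Z F) (fun _ _ => ih) h hd' hn'
        exact ⟨Z', .inr h1, h2, h3⟩

theorem Outer.replace {E : Env} {Z t t' : Code} {π : Stack} {F : Frame} (h : Outer Z t π F)
    (hd : dec E t = dec E t') :
    ∃ Z', Outer Z' t' π F ∧ dec E Z' = dec E Z ∧ Z'.names ⊆ Z.names ∪ t'.names :=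
  outerStack_replace (k := fun Z => outerFrame Z F) (fun _ _ => outerFrame_replace) h hd
    Finset.subset_union_right

/-- Evaluation leaves `Z` only by backtracking on `Z` itself, which is impossible for a `Z` with
reducible decoding. In the evaluation phase `Inside` excludes an applied abstraction equal to `Z`,
since `c7` moves to its argument, outside of it. -/
theorem CommStep.inside {τ : Trans} {s s' : State} (h : CommStep τ s s') {Z : Code}
    (hZ : Inside Z s.phase s.code s.stack s.frame) (hb : s.phase = .back → Z ≠ s.code) :
    Inside Z s'.phase s'.code s'.stack s'.frame := by
  cases h <;> simp only [Inside, Outer, outerStack, outerFrame, Redex, Code.IsLam] at * <;> grind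

/-- The number of entries that are older than the entry for `x`. -/
def Env.pos : Env → ℕ → ℕ
  | [], _ => 0
  | e :: E, x => if e.name = x then E.length else Env.pos E x

theorem Env.pos_lt {E : Env} {x : ℕ} (h : E.lookup x ≠ none) : E.pos x < E.length := by
  induction E with
  | nil => simp [Env.lookup] at h
  | cons e E ih =>
    rw [Env.pos]
    split
    · simp
    · next hx =>
      have := ih (by simpa [Env.lookup, hx] using h)
      simp; omega

/-- The name of an entry occurs neither in its own code nor in that of an older one, so the defined
names in a code belong to strictly older entries. -/
theorem Env.OK.pos_lt {E : Env} (hE : E.OK) {x y : ℕ} {e : Entry} (h : E.lookup x = some e)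
    (hy : y ∈ e.code.names) (hy' : E.lookup y ≠ none) : E.pos y < E.pos x := by
  induction E with
  | nil => simp [Env.lookup] at h
  | cons e' E ih =>
    obtain ⟨h1, -, -, -, h5⟩ := hE
    have hey : e'.name ≠ y := fun hh => h1 e (Env.lookup_eq_some h).1 (hh ▸ hy)
    have hy2 : Env.lookup E y ≠ none := by simpa [Env.lookup, hey] using hy'
    simp only [Env.pos, hey, if_false]
    by_cases hx : e'.name = x
    · rw [if_pos hx]
      exact Env.pos_lt hy2
    · rw [if_neg hx]
      exact ih h5 (by simpa [Env.lookup, hx] using h) hy2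

/-- Before the next multiplicative transition, only the `k` oldest entries may be copied. -/
def Zone (s : State) (k : ℕ) : Prop :=
  k = s.env.length ∨ ∃ Z, Inside Z s.phase s.code s.stack s.frame ∧ ¬ NF (dec s.env Z) ∧
    ∀ y ∈ Z.names, s.env.lookup y ≠ none → s.env.pos y < k

/-- The potential of a state; the codes have size at most `N`. -/
def Pot (N : ℕ) (s : State) (p : ℕ) : Prop := ∃ k, Zone s k ∧ p = s.weight + 4 * N * k

/-- This is the core of the length bound. Copying the entry at age `E.pos x` adds less than 3N to
the weight, but the copy becomes the new enclosing code and lowers the zone from `k` to `E.pos x`,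
which frees at least 4N. The surplus of N in the last clause later pays for the RAM's copying work.
-/
theorem GStep.pot_false {N : ℕ} {s s' : State} (h : GStep false s s') (hs : Good s)
    (hc : Clean s') (hN : s.All (fun t => t.size ≤ N)) (hN0 : 0 < N) {p : ℕ} (hp : Pot N s p) :
    ∃ p', Pot N s' p' ∧ p' < p ∧
      (s.phase = .eval → (∃ x, s.code = .var x) → s'.phase = .eval → ¬ Redex s'.code s'.stack → p' + N ≤ p) := by
  obtain ⟨k, hk, rfl⟩ := hp
  cases h with
  | comm h =>
    refine ⟨_, ⟨k, ?_, rfl⟩, Nat.add_lt_add_right h.weight _, ?_⟩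
    · rw [Zone, h.env_eq]
      refine hk.imp_right fun ⟨Z, h1, h2, h3⟩ => ⟨Z, h.inside h1 ?_, h2, h3⟩
      rintro hb rfl
      exact h2 (hs.back hb).1
    · rintro hp' ⟨x, hx⟩ hp
      cases h <;> simp at hp hx hp'
  | exp F x u π E e he hl hu =>
    have hx : E.lookup x ≠ none := by simp [he]
    have hd : dec E (.var x) = dec E u := by
      rw [hc.dec_code, hu, ← Clean.dec_entry hs.clean (Env.lookup_eq_some he).1]
      exact (hs.env.lookup he).1
    have hun : ∀ y ∈ u.names, E.lookup y ≠ none → E.pos y < E.pos x := by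
      intro y hy hy'
      rcases mem_names.1 hy with hy | hy
      · exact hs.env.pos_lt he (fv_subset_names _ (fv_eq_of_toTerm hu ▸ hy)) hy'
      · exact absurd (lookup_of_not_live fun hl =>
          hc y (.inl ⟨rfl, hy⟩) (.inr (.inr (.inr hl)))) hy'
    -- The variable being evaluated lies inside `Z`, so the zone bounds the age of its entry.
    have hk' : E.pos x < k := by
      rcases hk with rfl | ⟨Z, h1, h2, h3⟩
      · exact Env.pos_lt hx
      · refine h3 x ?_ hx
        rcases h1 with h1 | ⟨-, -, h1⟩
        · exact h1.names (by simp [Code.names])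
        · exact absurd rfl (h1 x)
    -- In front of an argument the abstraction weighs 0, less than the variable it replaces, so the
    -- zone may stay. Its names refer to entries older than `x`, hence still within the zone.
    by_cases hr : Redex u π
    · refine ⟨_, ⟨k, ?_, rfl⟩, Nat.add_lt_add_right ?_ _, fun _ _ _ h => absurd hr h⟩
      · rcases hk with rfl | ⟨Z, h1, h2, h3⟩
        · exact .inl rfl
        · rcases h1 with h1 | ⟨-, -, h1⟩
          · obtain ⟨Z', h4, h5, h6⟩ := h1.replace hd
            refine .inr ⟨Z', .inl h4, by rw [h5]; exact h2, fun y hy hy' => ?_⟩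
            rcases Finset.mem_union.1 (h6 hy) with hy | hy
            · exact h3 y hy hy'
            · exact (hun y hy hy').trans hk'
          · exact absurd rfl (h1 x)
      · simp [State.weight, codeWeight, hr, not_redex_var]
    · have hus : u.size ≤ N := by
        have := hN.env e (Env.lookup_eq_some he).1
        simpa [Code.size, hu] using this
      have hw : State.weight ⟨.eval, F, u, π, E⟩ + 3 ≤
          State.weight ⟨.eval, F, .var x, π, E⟩ + 3 * N := by
        simp [State.weight, codeWeight, hr, not_redex_var]
        omega
      have hm : 4 * N * E.pos x + 4 * N ≤ 4 * N * k := by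
        rw [← Nat.mul_succ]; exact Nat.mul_le_mul_left _ hk'
      refine ⟨_, ⟨E.pos x, .inr ⟨u, .inr ⟨rfl, hr, ?_⟩, ?_, hun⟩, rfl⟩, by omega,
        fun _ _ _ _ => by omega⟩
      · rintro y rfl
        refine (hs.env.lookup he).2.2 y ?_
        cases hc : e.code with
        | var z => rw [hc] at hu; simpa using hu.symm
        | lam => rw [hc, toTerm_lam] at hu; simp at hu
        | app => rw [hc] at hu; simp at hu
      · have hl' := (hs.env.lookup he).2.1
        change ¬ NF (dec E u)
        rw [← hd]
        change ¬ NF (sg E x)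
        rw [(hs.env.lookup he).1]
        rcases hl with ⟨n, hl⟩ | ⟨hl, hπ⟩
        · rw [hl] at hl'; exact hl'
        -- An entry labelled `abs` is an abstraction and the stack is nonempty, so this case was the
        -- previous one.
        · refine absurd ⟨?_, hπ⟩ hr
          rw [isLam_iff, hu, ← isLam_iff]
          exact hs.env.isLam he hl

/-- After a multiplicative transition the whole environment may be copied again: the zone is reset
to its length, and a body of size at most N enters with weight at most 3N. -/
theorem GStep.pot_true {N : ℕ} {s s' : State} (h : GStep true s s')
    (hN : s'.All (fun t => t.size ≤ N)) {p : ℕ} (hp : Pot N s p) :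
    ∃ p', Pot N s' p' ∧ p' ≤ p + 3 * N + 4 * N * s'.env.length := by
  obtain ⟨k, -, rfl⟩ := hp
  refine ⟨_, ⟨_, .inl rfl, rfl⟩, ?_⟩
  have := hN.code
  have hw := codeWeight_le s'.phase s'.code s'.stack
  have : s'.weight ≤ s.weight + 3 * N := by
    cases h <;> simp only [State.weight, Stack.weight, Frame.weight, true_imp_iff] at * <;> omega
  omega

theorem GStep.env_length {m : Bool} {s s' : State} (h : GStep m s s') :
    s'.env.length ≤ s.env.length + if m then 1 else 0 := by
  cases h with
  | comm h => rw [h.env_eq]; simp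
  | _ => simp

theorem Pot.initial (t : Code) : Pot t.size (State.initial t) (3 * t.size) :=
  ⟨0, .inl rfl, by
    simp [State.initial, State.weight, codeWeight, Redex, Stack.weight, Frame.weight]⟩

end MaxMAM

namespace MaxMAM

open Term Code

/-! ## Progress -/

theorem comm_progress (s : State) :
    (∃ τ s', CommStep τ s s') ∨ (∃ l, CheckOutput s l) ∨
      ∃ x E, s = ⟨.back, [], .var x, [], E⟩ := by
  obtain ⟨φ, F, t, π, E⟩ := s
  cases φ with
  | eval =>
    cases t with
    | var x =>
      rcases h : E.lookup x with _ | e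
      · exact .inl ⟨_, _, .c3 F x π E (.inl h)⟩
      · rcases hl : e.label with _ | n | _
        · cases π with
          | nil => exact .inl ⟨_, _, .c3 F x [] E (.inr ⟨e, h, .inr ⟨hl, rfl⟩⟩)⟩
          | cons u π => exact .inr (.inl ⟨_, .o3 F x u π E e h hl⟩)
        · exact .inr (.inl ⟨_, .o2 F x π E e n h hl⟩)
        · exact .inl ⟨_, _, .c3 F x π E (.inr ⟨e, h, .inl hl⟩)⟩
    | lam x t =>
      cases π with
      | nil => exact .inl ⟨_, _, .c2 F x t E⟩
      | cons u π =>
        by_cases h : x ∈ t.fv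
        · exact .inr (.inl ⟨_, .o1 F x t u π E h⟩)
        · exact .inl ⟨_, _, .c7 F x t u π E h⟩
    | app t u => exact .inl ⟨_, _, .c1 F t u π E⟩
  | back =>
    cases π with
    | cons u π => exact .inl ⟨_, _, .c6 F t u π E⟩
    | nil =>
      rcases F with _ | ⟨_ | _ | _, F⟩
      · cases t with
        | var x => exact .inr (.inr ⟨x, E, rfl⟩)
        | lam x t => exact .inr (.inl ⟨_, .o5 x t E⟩)
        | app t u => exact .inr (.inl ⟨_, .o4 t u E⟩)
      · exact .inl ⟨_, _, .c4 F _ t E⟩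
      · exact .inl ⟨_, _, .c5 F _ t _ E⟩
      · exact .inr (.inl ⟨_, .o6 F _ _ t _ E⟩)

/-- The weight decreases, so the Checking AM terminates. It is stuck without output only when
backtracking at the root on a variable, and plugging the state always gives back `u`. -/
theorem exists_checks {u : Code} (E : Env) (hu : ∀ y, u ≠ .var y) : ∃ l, Checks u E l := by
  have key : ∀ n (s : State), s.weight = n →
      Relation.ReflTransGen (fun s₁ s₂ => ∃ τ, CommStep τ s₁ s₂) ⟨.eval, [], u, [], E⟩ s →
      Frame.plug s.frame (Stack.plug s.stack s.code) = u → ∃ l, Checks u E l := by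
    intro n
    induction n using Nat.strong_induction_on with
    | _ n ih =>
      intro s hn hs hp
      rcases comm_progress s with ⟨τ, s', h⟩ | ⟨l, h⟩ | ⟨x, E', rfl⟩
      · exact ih _ (hn ▸ h.weight) s' rfl (hs.tail ⟨τ, h⟩) (h.plug_eq.trans hp)
      · exact ⟨l, s, hs, h⟩
      · exact absurd hp.symm (hu x)
  exact key _ _ rfl .refl rfl

theorem exists_bound {α : Type*} {P : α → ℕ → Prop} (l : List α)
    (h : ∀ a ∈ l, ∃ n, ∀ y, P a y → y < n) : ∃ n, ∀ a ∈ l, ∀ y, P a y → y < n := by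
  induction l with
  | nil => exact ⟨0, by simp⟩
  | cons a l ih =>
    obtain ⟨n, hn⟩ := ih fun a ha => h a (by simp [ha])
    obtain ⟨m, hm⟩ := h a (by simp)
    refine ⟨max n m, fun b hb y hy => ?_⟩
    simp only [List.mem_cons] at hb
    rcases hb with rfl | hb
    · exact lt_max_of_lt_right (hm y hy)
    · exact lt_max_of_lt_left (hn b hb y hy)

theorem Code.exists_bound (t : Code) : ∃ n, ∀ y ∈ t.names, y < n := by
  obtain ⟨n, hn⟩ := t.names.exists_nat_subset_range
  exact ⟨n, fun y hy => Finset.mem_range.1 (hn hy)⟩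

theorem Stack.exists_bound (π : Stack) : ∃ n, ∀ y, Stack.Mentions π y → y < n := by
  obtain ⟨n, hn⟩ := MaxMAM.exists_bound (P := fun t y => y ∈ Code.names t) π
    fun t _ => t.exists_bound
  exact ⟨n, fun y ⟨t, ht, hy⟩ => hn t ht y hy⟩

theorem Item.exists_bound (φ : Item) : ∃ n, ∀ y, φ.Mentions y → y < n := by
  cases φ with
  | var x => exact ⟨x + 1, by simp [Item.Mentions]⟩
  | head t π =>
    obtain ⟨n, hn⟩ := t.exists_bound
    obtain ⟨m, hm⟩ := Stack.exists_bound π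
    exact ⟨max n m, fun y hy => hy.elim (fun h => lt_max_of_lt_left (hn y h))
      fun h => lt_max_of_lt_right (hm y h)⟩
  | erasing x t π =>
    obtain ⟨n, hn⟩ := (Code.lam x t).exists_bound
    obtain ⟨m, hm⟩ := Stack.exists_bound π
    refine ⟨max n m, fun y hy => ?_⟩
    rcases hy with hy | hy | hy
    · exact lt_max_of_lt_left (hn y (by simp [Code.names, hy]))
    · exact lt_max_of_lt_left (hn y (by simp [Code.names, hy]))
    · exact lt_max_of_lt_right (hm y hy)

theorem Env.exists_bound (E : Env) : ∃ n, ∀ y, Env.Mentions E y → y < n := by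
  obtain ⟨n, hn⟩ := MaxMAM.exists_bound (P := fun e y => y ∈ (Code.lam e.name e.code).names) E
    fun e _ => Code.exists_bound _
  exact ⟨n, fun y ⟨e, he, hy⟩ => hn e he y (by simpa [Code.names] using hy)⟩

theorem exists_renaming (F : Frame) (π : Stack) (E : Env) (t : Code) :
    ∃ u, IsRenaming F π E t u := by
  obtain ⟨a, ha⟩ := MaxMAM.exists_bound (P := Item.Mentions) F fun φ _ => φ.exists_bound
  obtain ⟨b, hb⟩ := Stack.exists_bound π
  obtain ⟨c, hc⟩ := Env.exists_bound E
  obtain ⟨d, hd⟩ := t.exists_bound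
  have hf : ∀ x ∈ t.fv, id x < a + b + c + d := fun x hx => by
    have := hd x (fv_subset_names t hx); simp only [id]; omega
  refine ⟨(Code.fresh id t (a + b + c + d)).1, ?_, wellNamed_fresh hf, fun x hx => ?_⟩
  · rw [toTerm_fresh hf]; exact rename_id _ fun _ _ => rfl
  · have := (mem_binders_fresh hx).1
    refine ⟨fun φ hφ h => ?_, fun h => ?_, fun h => ?_⟩
    · have := ha φ hφ x h; omega
    · have := hb x h; omega
    · have := hc x h; omega

/-- The states where the machine stops. -/
def Stopped (s : State) : Prop := s.phase = .back ∧ s.stack = [] ∧ s.frame = []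

/-- Where the commutative transitions end with an output, the Max MAM has a multiplicative or
exponential transition instead, except at the root. -/
theorem progress (s : State) : (∃ τ s', Step τ s s') ∨ Stopped s := by
  rcases comm_progress s with ⟨τ, s', h⟩ | ⟨l, h⟩ | ⟨x, E, rfl⟩
  · exact .inl ⟨τ, s', .comm h⟩
  · cases h with
    | o1 F x t u π E hx =>
      refine .inl ?_
      by_cases hu : ∃ y, u = .var y
      · obtain ⟨y, rfl⟩ := hu
        exact ⟨_, _, .m1 F x y t π E hx⟩
      · have hu : ∀ y, u ≠ .var y := fun y h => hu ⟨y, h⟩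
        obtain ⟨l, hl⟩ := exists_checks E hu
        exact ⟨_, _, .m2 F x t u π E l hx hu hl⟩
    | o2 F x π E e n h h' =>
      obtain ⟨u, hu⟩ := exists_renaming F π E e.code
      exact .inl ⟨_, _, .ered F x u π E e n h h' hu⟩
    | o3 F x v π E e h h' =>
      obtain ⟨u, hu⟩ := exists_renaming F (v :: π) E e.code
      exact .inl ⟨_, _, .eabs F x v u π E e h h' hu⟩
    | o4 => exact .inr ⟨rfl, rfl, rfl⟩
    | o5 => exact .inr ⟨rfl, rfl, rfl⟩
    | o6 F x t u π E => exact .inl ⟨_, _, .m3 F x t u π E⟩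
  · exact .inr ⟨rfl, rfl, rfl⟩

theorem Stopped.final {s : State} (h : Stopped s) : s.Final := by
  obtain ⟨φ, F, t, π, E⟩ := s
  obtain ⟨rfl, rfl, rfl⟩ := h
  intro τ s' h
  cases h with
  | comm h => cases h

theorem final_iff {s : State} : s.Final ↔ Stopped s :=
  ⟨fun h => (progress s).resolve_left fun ⟨τ, s', h'⟩ => h τ s' h', Stopped.final⟩

theorem Stopped.nf {s : State} (h : Stopped s) (hs : Good s) : NF s.decode := by
  obtain ⟨φ, F, t, π, E⟩ := s
  obtain ⟨rfl, rfl, rfl⟩ := h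
  exact (hs.back rfl).1

/-! ## Executions of the Max MAM -/

/-- The bound on potentials after `m` multiplicative transitions. -/
def potBound (N m : ℕ) : ℕ := 4 * N * (m + 2) ^ 2

theorem potBound_succ (N m : ℕ) : potBound N (m + 1) = potBound N m + 4 * N * (2 * m + 5) := by
  unfold potBound; ring

/-- What is known on a state that is reached with `m` multiplicative and `n` transitions. -/
structure Reached (N m n : ℕ) (s : State) : Prop where
  inv : Inv true s
  good : Good s
  sizes : s.All (fun t => t.size ≤ N)
  env : s.env.length ≤ m
  pot : ∃ p, Pot N s p ∧ n + p ≤ potBound N m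

theorem Reached.initial {c : Code} (h : c.WellNamed) : Reached c.size 0 0 (State.initial c) where
  inv := Inv.initial h
  good := Good.initial h
  sizes := ⟨fun _ => le_rfl, by simp [State.initial], by simp [State.initial],
    by simp [State.initial]⟩
  env := le_rfl
  pot := ⟨_, Pot.initial c, by unfold potBound; omega⟩

theorem Reached.step {N m n : ℕ} {s s' : State} {τ : Trans} (hs : Reached N m n s) (hN : 0 < N)
    (h : Step τ s s') : Reached N (m + if τ.IsMul then 1 else 0) (n + 1) s' := by
  obtain ⟨hg, hi⟩ := h.gstep hs.inv hs.good.erases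
  have hz := hg.sizes hs.sizes
  refine ⟨hi, hg.good hs.good hi.clean, hz, hg.env_length.trans (Nat.add_le_add_right hs.env _), ?_⟩
  obtain ⟨p, hp, hpn⟩ := hs.pot
  cases hτ : τ.IsMul with
  | false =>
    rw [hτ] at hg
    obtain ⟨p', hp', hlt, -⟩ := hg.pot_false hs.good hi.clean hs.sizes hN hp
    exact ⟨p', hp', by simp; omega⟩
  | true =>
    have hl := hg.env_length
    rw [hτ] at hg hl
    obtain ⟨p', hp', hle⟩ := hg.pot_true hz hp
    refine ⟨p', hp', ?_⟩
    have h1 := hs.env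
    simp only [if_true] at hl ⊢
    rw [potBound_succ]
    have : 4 * N * s'.env.length ≤ 4 * N * (m + 1) := Nat.mul_le_mul_left _ (by omega)
    -- The bound grows by 4N(2m+5). The first summand covers the reset of the zone to at most m+1
    -- entries; the second covers the 3N of weight and the transition itself.
    have h2 : 4 * N * (2 * m + 5) = 4 * N * (m + 1) + 4 * N * (m + 4) := by ring
    have h3 : 4 * N * 4 ≤ 4 * N * (m + 4) := Nat.mul_le_mul_left _ (by omega)
    omega

theorem Exec.reached {c : Code} (hc : c.WellNamed) {q : State} (ρ : Exec (State.initial c) q) :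
    Reached c.size ρ.numMul ρ.length q := by
  generalize hs : State.initial c = s at ρ
  induction ρ with
  | nil => subst hs; exact Reached.initial hc
  | snoc ρ τ h ih => exact ih.step c.size_pos h

theorem Step.decode {τ : Trans} {s s' : State} (h : Step τ s s') (hi : Inv true s)
    (hs : Good s) : if τ.IsMul then MS s.decode s'.decode else s'.decode = s.decode := by
  obtain ⟨hg, hi'⟩ := h.gstep hi hs.erases
  exact hg.decode hs hi'.clean

/-- An execution can be continued without multiplicative transitions up to a multiplicative
transition or to a final state. -/
theorem Exec.continue {c : Code} (hc : c.WellNamed) {q : State} (ρ : Exec (State.initial c) q) :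
    ∃ (q' : State) (ρ' : Exec (State.initial c) q'), ρ'.numMul = ρ.numMul ∧
      q'.decode = q.decode ∧ (Stopped q' ∨ ∃ τ q'', Step τ q' q'' ∧ τ.IsMul = true) := by
  obtain ⟨p, hp, -⟩ := (ρ.reached hc).pot
  induction p using Nat.strong_induction_on generalizing q with
  | _ p ih =>
    rcases progress q with ⟨τ, q', h⟩ | h
    · cases hτ : τ.IsMul with
      | true => exact ⟨q, ρ, rfl, rfl, .inr ⟨τ, q', h, hτ⟩⟩
      | false =>
        have hr := ρ.reached hc
        obtain ⟨hg, hi⟩ := h.gstep hr.inv hr.good.erases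
        have hd := h.decode hr.inv hr.good
        rw [hτ] at hg hd
        obtain ⟨p', hp', hlt, -⟩ := hg.pot_false hr.good hi.clean hr.sizes c.size_pos hp
        obtain ⟨q2, ρ2, h1, h2, h3⟩ := ih p' hlt (ρ.snoc τ h) hp'
        exact ⟨q2, ρ2, by simpa [Exec.numMul, hτ] using h1, h2.trans hd, h3⟩
    · exact ⟨q, ρ, rfl, rfl, .inl h⟩

/-! ### Existence of simulating executions, and their length. -/

theorem exists_simulation {t s : Term} (d : Derivation MaxStep t s) {c : Code} (hc : c.WellNamed)
    (ht : c.toTerm = t) : ∃ (q : State) (ρ : Exec (State.initial c) q), Simulates ρ d := by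
  induction d with
  | nil => exact ⟨_, .nil _, rfl, ht⟩
  | snoc d h ih =>
    obtain ⟨q, ρ, h1, h2⟩ := ih
    obtain ⟨q', ρ', h3, h4, h5⟩ := ρ.continue hc
    have hr := ρ'.reached hc
    rw [maxStep_iff_ms, ← h2, ← h4] at h
    rcases h5 with h5 | ⟨τ, q'', h5, hτ⟩
    -- The decoding still has a step of the derivation ahead, so the machine has not stopped; by
    -- determinism its next multiplicative transition is that very step.
    · exact absurd (h5.nf hr.good) h.not_nf
    · have hd := h5.decode hr.inv hr.good
      rw [hτ] at hd
      exact ⟨q'', ρ'.snoc τ h5, by simp [Exec.numMul, hτ, h3, h1, Derivation.length],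
        hd.deterministic h⟩

theorem exists_simulation_stopped {t s : Term} (d : Derivation MaxStep t s) {c : Code}
    (hc : c.WellNamed) (ht : c.toTerm = t) (hs : ∀ u, ¬ MaxStep s u) :
    ∃ (q : State) (ρ : Exec (State.initial c) q), Simulates ρ d ∧ Stopped q := by
  obtain ⟨q, ρ, h1, h2⟩ := exists_simulation d hc ht
  obtain ⟨q', ρ', h3, h4, h5⟩ := ρ.continue hc
  refine ⟨q', ρ', ⟨h3.trans h1, h4.trans h2⟩, h5.resolve_right ?_⟩
  rintro ⟨τ, q'', h5, hτ⟩
  have hr := ρ'.reached hc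
  have hd := h5.decode hr.inv hr.good
  rw [hτ, h4, h2] at hd
  exact hs _ (maxStep_iff_ms.2 hd)

theorem potBound_le (N m : ℕ) : potBound N m ≤ 32 * ((1 + m ^ 2) * N) := by
  unfold potBound
  have : (m + 2) ^ 2 ≤ 8 * (1 + m ^ 2) := by nlinarith [sq_nonneg ((m : ℤ) - 2), sq_nonneg m]
  calc 4 * N * (m + 2) ^ 2 ≤ 4 * N * (8 * (1 + m ^ 2)) := Nat.mul_le_mul_left _ this
    _ = 32 * ((1 + m ^ 2) * N) := by ring

theorem Exec.length_le {c : Code} (hc : c.WellNamed) {q : State} (ρ : Exec (State.initial c) q) :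
    ρ.length ≤ 32 * ((1 + ρ.numMul ^ 2) * c.size) := by
  obtain ⟨p, -, hp⟩ := (ρ.reached hc).pot
  have := potBound_le c.size ρ.numMul
  omega

end MaxMAM

namespace MaxMAM

open Term Code

/-! ## Determinism up to renaming -/

theorem equiv_iff {σ : Equiv.Perm ℕ} {t u : Code} :
    t.Equiv σ u ↔ t.toTerm.rename σ = u.toTerm := by rw [Code.Equiv, toTerm_map σ.injective]

theorem Code.Equiv.mem_fv {σ : Equiv.Perm ℕ} {t u : Code} (h : t.Equiv σ u) {y : ℕ} :
    σ y ∈ u.fv ↔ y ∈ t.fv := by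
  rw [equiv_iff] at h
  rw [Code.mem_fv, Code.mem_fv, ← h, occurs_rename]
  exact ⟨fun ⟨n, hn, e⟩ => σ.injective e ▸ hn, fun h => ⟨y, h, rfl⟩⟩

theorem equiv_var {σ : Equiv.Perm ℕ} {x : ℕ} {c : Code} (h : (Code.var x).Equiv σ c) :
    c = .var (σ x) := by
  rw [equiv_iff] at h
  cases c with
  | var y => simpa [Term.rename, eq_comm] using h
  | lam => simp [Term.rename, toTerm_lam] at h
  | app => simp [Term.rename] at h

theorem equiv_app {σ : Equiv.Perm ℕ} {t u c : Code} (h : (Code.app t u).Equiv σ c) :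
    ∃ t' u', c = .app t' u' ∧ t.Equiv σ t' ∧ u.Equiv σ u' := by
  simp only [equiv_iff] at h ⊢
  cases c with
  | var y => simp [Term.rename] at h
  | lam => simp [Term.rename, toTerm_lam] at h
  | app t' u' => simp only [Term.rename, toTerm_app, Term.app.injEq] at h; exact ⟨t', u', rfl, h⟩

theorem equiv_lam {σ : Equiv.Perm ℕ} {x : ℕ} {t c : Code} (h : (Code.lam x t).Equiv σ c) :
    ∃ x' t', c = .lam x' t' := by
  rw [equiv_iff] at h
  cases c with
  | var y => simp [Term.rename, toTerm_lam] at h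
  | lam x' t' => exact ⟨x', t', rfl⟩
  | app => simp [Term.rename, toTerm_lam] at h

theorem Code.Equiv.mem_body {σ : Equiv.Perm ℕ} {x x' : ℕ} {t t' : Code}
    (h : (Code.lam x t).Equiv σ (.lam x' t')) : x' ∈ t'.fv ↔ x ∈ t.fv := by
  rw [equiv_iff, toTerm_lam, toTerm_lam, Term.rename, Term.lam.injEq] at h
  rw [← occurs_body, ← occurs_body, ← h, occurs_rename_upr]

/-- Name the index `0`, undoing `cl`. -/
def opn (x : ℕ) : ℕ → ℕ
  | 0 => x
  | n + 1 => n

/-- Equivalent abstractions may be opened with arbitrary names `y` and `y'`, provided that the new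
permutation relates them and agrees with `σ` on the free names of the abstraction. -/
theorem Code.Equiv.body {σ : Equiv.Perm ℕ} {x x' y y' : ℕ} {t t' u u' : Code}
    (h : (Code.lam x t).Equiv σ (.lam x' t')) (hu : u.toTerm = t.toTerm.rename (ren1 x y))
    (hu' : u'.toTerm = t'.toTerm.rename (ren1 x' y')) {τ : Equiv.Perm ℕ}
    (hy : x ∈ t.fv → τ y = y') (hτ : ∀ n ∈ (Code.lam x t).fv, τ n = σ n) : u.Equiv τ u' := by
  have hm := @h.mem_fv
  rw [equiv_iff, toTerm_lam, toTerm_lam, Term.rename, Term.lam.injEq, rename_rename] at h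
  have ht' : t'.toTerm = t.toTerm.rename (fun n => if n = x then x' else σ n) := by
    have := congrArg (fun s => s.rename (opn x')) h
    simp only [rename_rename] at this
    rw [rename_id t'.toTerm] at this
    · rw [← this]
      congr 1
      funext n
      by_cases hn : n = x
      · subst hn; simp [opn, upr]
      · simp [cl_ne hn, hn, opn, upr]
    · intro n _
      by_cases hn : n = x'
      · subst hn; simp [opn]
      · simp [cl_ne hn, opn]
  rw [equiv_iff, hu, hu', ht', rename_rename, rename_rename]
  apply rename_congr
  intro n hn
  rw [← Code.mem_fv] at hn
  by_cases hx : n = x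
  · subst hx; simp [ren1, hy hn]
  · have h1 : n ∈ (Code.lam x t).fv := by simp [fv, hn, hx]
    have h2 : σ n ≠ x' := by
      have := hm.2 h1
      simp only [fv, Finset.mem_erase] at this
      exact this.1
    simp [ren1, hx, h2, hτ n h1]

/-- Equality of environments up to renaming. -/
def EnvEq (σ : Equiv.Perm ℕ) (E E' : Env) : Prop :=
  List.Forall₂ (fun e e' => σ e.name = e'.name ∧ e.code.Equiv σ e'.code ∧ e.label = e'.label) E E'

/-- Equality of states up to renaming. -/
structure SEq (σ : Equiv.Perm ℕ) (s s' : State) : Prop where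
  phase : s.phase = s'.phase
  code : s.code.Equiv σ s'.code
  stack : List.Forall₂ (Code.Equiv σ) s.stack s'.stack
  frame : List.Forall₂ (Item.Equiv σ) s.frame s'.frame
  env : EnvEq σ s.env s'.env

theorem EnvEq.lookup {σ : Equiv.Perm ℕ} {E E' : Env} (h : EnvEq σ E E') (x : ℕ) :
    (E.lookup x = none ∧ E'.lookup (σ x) = none) ∨
      ∃ e e', E.lookup x = some e ∧ E'.lookup (σ x) = some e' ∧ e.label = e'.label ∧
        e.code.Equiv σ e'.code := by
  induction h with
  | nil => exact .inl ⟨rfl, rfl⟩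
  | @cons e e' E E' h _ ih =>
    by_cases hx : e.name = x
    · exact .inr ⟨e, e', by simp [Env.lookup, hx], by simp [Env.lookup, ← h.1, hx], h.2.2, h.2.1⟩
    · have : e'.name ≠ σ x := by rw [← h.1]; exact fun h => hx (σ.injective h)
      simpa [Env.lookup, hx, this] using ih

/-- The permutation `σ`, modified so as to map `x` to `x'`. -/
def retarget (σ : Equiv.Perm ℕ) (x x' : ℕ) : Equiv.Perm ℕ := σ.trans (Equiv.swap (σ x) x')

theorem retarget_self (σ : Equiv.Perm ℕ) (x x' : ℕ) : retarget σ x x' x = x' := by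
  simp [retarget]

theorem retarget_of_ne {σ : Equiv.Perm ℕ} {x x' n : ℕ} (h : n ≠ x) (h' : σ n ≠ x') :
    retarget σ x x' n = σ n := by
  simp only [retarget, Equiv.trans_apply]
  exact Equiv.swap_apply_of_ne_of_ne (fun e => h (σ.injective e)) h'

/-! ### Changing one value of the permutation of names. -/

section retarget

variable {σ : Equiv.Perm ℕ} {x x' : ℕ}

theorem Code.Equiv.retarget_eq {t t' : Code} (h : t.Equiv σ t') (hx : x ∉ t.fv) (hx' : x' ∉ t'.fv)
    {n : ℕ} (hn : n ∈ t.fv) : retarget σ x x' n = σ n :=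
  retarget_of_ne (fun e => hx (e ▸ hn)) (fun e => hx' (e ▸ h.mem_fv.2 hn))

/-- A pair of newly introduced names can be matched without disturbing what is already related,
because neither name is in use on its side. -/
theorem Code.Equiv.retarget {t t' : Code} (h : t.Equiv σ t') (hx : x ∉ t.fv) (hx' : x' ∉ t'.fv) :
    t.Equiv (retarget σ x x') t' := by
  have := fun n => h.retarget_eq hx hx' (n := n)
  rw [equiv_iff] at h ⊢
  rw [← h]
  exact rename_congr fun n hn => this n (Code.mem_fv.2 hn)

theorem stack_retarget {π π' : Stack} (h : List.Forall₂ (Code.Equiv σ) π π')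
    (hx : ¬ Stack.Live π x) (hx' : ¬ Stack.Live π' x') :
    List.Forall₂ (Code.Equiv (retarget σ x x')) π π' := by
  induction h with
  | nil => exact .nil
  | cons h _ ih =>
    rw [Stack.live_cons, not_or] at hx hx'
    exact .cons (h.retarget hx.1 hx'.1) (ih hx.2 hx'.2)

theorem Item.Equiv.retarget {φ φ' : Item} (h : Item.Equiv σ φ φ') (hx : ¬ φ.Live x)
    (hx' : ¬ φ'.Live x') : Item.Equiv (retarget σ x x') φ φ' := by
  cases h with
  | var y =>
    simp only [Item.Live] at hx hx'
    have := retarget_of_ne (σ := σ) (x := x) (x' := x') (n := y) (Ne.symm hx) (Ne.symm hx')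
    rw [← this]
    exact .var y
  | head h1 h2 =>
    simp only [Item.Live, not_or] at hx hx'
    exact .head (h1.retarget (fun h => hx.1 (fv_subset_names _ h))
      fun h => hx'.1 (fv_subset_names _ h)) (stack_retarget h2 hx.2 hx'.2)
  | erasing h1 h2 =>
    simp only [Item.Live, not_or] at hx hx'
    exact .erasing (h1.retarget hx.1 hx'.1) (stack_retarget h2 hx.2 hx'.2)

theorem frame_retarget {F F' : Frame} (h : List.Forall₂ (Item.Equiv σ) F F')
    (hx : ¬ Frame.Live F x) (hx' : ¬ Frame.Live F' x') :
    List.Forall₂ (Item.Equiv (retarget σ x x')) F F' := by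
  induction h with
  | nil => exact .nil
  | cons h _ ih =>
    rw [Frame.live_cons, not_or] at hx hx'
    exact .cons (h.retarget hx.1 hx'.1) (ih hx.2 hx'.2)

theorem EnvEq.retarget {E E' : Env} (h : EnvEq σ E E')
    (hx : ¬ Env.Live E x) (hx' : ¬ Env.Live E' x') : EnvEq (retarget σ x x') E E' := by
  induction h with
  | nil => exact .nil
  | cons h _ ih =>
    rw [Env.live_cons, not_or, not_or] at hx hx'
    refine .cons ⟨?_, h.2.1.retarget hx.1.2 hx'.1.2, h.2.2⟩ (ih hx.2 hx'.2)
    rw [retarget_of_ne (Ne.symm hx.1.1) (h.1 ▸ Ne.symm hx'.1.1)]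
    exact h.1

end retarget

theorem EnvEq.label_comp {σ : Equiv.Perm ℕ} {E E' : Env} (h : EnvEq σ E E') :
    E'.label ∘ σ = E.label := by
  funext x
  rcases h.lookup x with ⟨h1, h2⟩ | ⟨e, e', h1, h2, h3, -⟩ <;>
    simp_all [Env.label]

/-- Both outputs are values of `chk`, which is invariant under renaming; the two runs of the
Checking AM need not be compared transition by transition. -/
theorem Checks.label_eq_of_equiv {σ : Equiv.Perm ℕ} {u u' : Code} {E E' : Env} {l l' : Label}
    (h : Checks u E l) (h' : Checks u' E' l') (hu : u.Equiv σ u') (hE : EnvEq σ E E')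
    (hb : ∀ y, y ∈ u.binders ∨ Env.Bound E y → ¬ Env.Live E y)
    (hb' : ∀ y, y ∈ u'.binders ∨ Env.Bound E' y → ¬ Env.Live E' y) : l = l' := by
  rw [h.label_eq fun y hy => lookup_of_not_live (hb y hy),
    h'.label_eq fun y hy => lookup_of_not_live (hb' y hy), ← equiv_iff.1 hu, chk_rename,
    hE.label_comp]

theorem Clean.stack_head {φ : Phase} {F : Frame} {t u : Code} {π : Stack} {E : Env}
    (h : Clean ⟨φ, F, t, u :: π, E⟩) : ∀ y, y ∈ u.binders ∨ Env.Bound E y → ¬ Env.Live E y :=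
  fun y hy hl => h y (hy.elim (fun hy => .inr (.inl (by simp [Stack.bs, hy])))
    fun hy => .inr (.inr (.inr hy))) (.inr (.inr (.inr hl)))

theorem Clean.lam {F : Frame} {x : ℕ} {t : Code} {π : Stack} {E : Env}
    (h : Clean ⟨.eval, F, .lam x t, π, E⟩) : ¬ State.Live ⟨.eval, F, .lam x t, π, E⟩ x :=
  h x (.inl ⟨rfl, by simp [Code.binders]⟩)

theorem not_useless {E : Env} {x : ℕ} {π : Stack} {e : Entry} (h : E.lookup x = some e)
    (hl : (∃ n, e.label = .red n) ∨ e.label = .abs ∧ π ≠ []) : ¬ Useless E x π := by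
  rintro (h' | ⟨e', h', hl'⟩)
  · simp [h] at h'
  · obtain rfl : e = e' := by simpa [h] using h'
    rcases hl with ⟨n, hl⟩ | hl <;> simp_all

theorem rename_ren1_of_not_mem {x y : ℕ} {t : Code} (h : x ∉ t.fv) :
    t.toTerm = t.toTerm.rename (ren1 x y) :=
  (rename_id _ fun n hn => if_neg fun (e : n = x) => h (e ▸ Code.mem_fv.2 hn)).symm

/-- The machine is deterministic up to the choice of names. -/
theorem GStep.deterministic {m₁ m₂ : Bool} {s₁ s₁' s₂ s₂' : State} {σ : Equiv.Perm ℕ}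
    (h₁ : GStep m₁ s₁ s₁') (h₂ : GStep m₂ s₂ s₂') (hσ : SEq σ s₁ s₂) (c₁ : Clean s₁)
    (c₂ : Clean s₂) (e₁ : Frame.Erases s₁.frame) (e₂ : Frame.Erases s₂.frame) :
    m₁ = m₂ ∧ ∃ τ, SEq τ s₁' s₂' := by
  obtain ⟨φ₂, F₂, t₂, π₂, E₂⟩ := s₂
  obtain ⟨hp, hc, hπ, hF, hE⟩ := hσ
  cases h₁ with
  | comm h =>
    cases h with
    | c1 F t u π E =>
      obtain ⟨t', u', rfl, ht, hu⟩ := equiv_app hc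
      obtain rfl : Phase.eval = φ₂ := hp
      cases h₂ with
      | comm h =>
        cases h
        exact ⟨rfl, σ, rfl, ht, .cons hu hπ, hF, hE⟩
    | c2 F x t E =>
      obtain ⟨x', t', rfl⟩ := equiv_lam hc
      obtain rfl : Phase.eval = φ₂ := hp
      cases hπ
      cases h₂ with
      | comm h =>
        cases h
        -- The opened binders become names of the frame and must correspond; cleanness makes each of
        -- them unused elsewhere, so `σ` can be redirected.
        have l₁ := c₁.lam
        have l₂ := c₂.lam
        have hb := Code.Equiv.body hc (rename_ren1_self t.toTerm x).symm
          (rename_ren1_self t'.toTerm x').symm (τ := retarget σ x x')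
          (fun _ => retarget_self _ _ _)
          (fun n hn => hc.retarget_eq (fun h => l₁ (.inl h)) (fun h => l₂ (.inl h)) hn)
        simp only [State.Live, not_or] at l₁ l₂
        refine ⟨rfl, _, rfl, hb, .nil, .cons ?_ (frame_retarget hF l₁.2.2.1 l₂.2.2.1),
          hE.retarget l₁.2.2.2 l₂.2.2.2⟩
        have := Item.Equiv.var (σ := retarget σ x x') x
        rwa [retarget_self] at this
    | c3 F x π E hu =>
      obtain rfl := equiv_var hc
      obtain rfl : Phase.eval = φ₂ := hp
      cases h₂ with
      | comm h => cases h; exact ⟨rfl, σ, rfl, hc, hπ, hF, hE⟩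
      | exp F₂ x₂ u π₂ E₂ e h hl _ =>
        refine absurd ?_ (not_useless h hl)
        rcases hE.lookup x with ⟨h1, h2⟩ | ⟨e, e', h1, h2, h3, -⟩
        · exact .inl h2
        · rcases hu with hu | ⟨e'', h4, h5⟩
          · simp [h1] at hu
          · obtain rfl : e = e'' := Option.some.inj (h1.symm.trans h4)
            rw [h3] at h5
            refine .inr ⟨e', h2, h5.imp_right fun h => ⟨h.1, ?_⟩⟩
            have : π = [] := h.2
            subst this
            cases hπ; rfl
    | c4 F x t E =>
      obtain rfl : Phase.back = φ₂ := hp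
      cases hπ
      rcases hF with _ | ⟨hi, hF⟩
      cases hi
      cases h₂ with
      | comm h =>
        cases h
        refine ⟨rfl, σ, rfl, ?_, .nil, hF, hE⟩
        rw [equiv_iff] at hc ⊢
        simp only at hc
        rw [toTerm_lam, toTerm_lam, Term.rename, ← hc, rename_rename, rename_rename]
        congr 2
        funext n
        by_cases hn : n = x
        · subst hn; simp
        · have : σ n ≠ σ x := fun e => hn (σ.injective e)
          simp [cl_ne hn, cl_ne this]
    | c5 F t u π E =>
      obtain rfl : Phase.back = φ₂ := hp
      cases hπ
      rcases hF with _ | ⟨hi, hF⟩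
      cases hi with
      | head h1 h2 =>
      cases h₂ with
      | comm h =>
        cases h
        refine ⟨rfl, σ, rfl, ?_, h2, hF, hE⟩
        rw [equiv_iff] at hc h1 ⊢
        simp only at hc
        rw [toTerm_app, toTerm_app, Term.rename, h1, hc]
    | c6 F t u π E =>
      obtain rfl : Phase.back = φ₂ := hp
      rcases hπ with _ | ⟨hu, hπ⟩
      cases h₂ with
      | comm h =>
        cases h
        exact ⟨rfl, σ, rfl, hu, .nil, .cons (.head hc hπ) hF, hE⟩
    | c7 F x t u π E hx =>
      obtain ⟨x', t', rfl⟩ := equiv_lam hc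
      obtain rfl : Phase.eval = φ₂ := hp
      rcases hπ with _ | ⟨hu, hπ⟩
      have hm := hc.mem_body
      cases h₂ with
      | comm h =>
        cases h
        exact ⟨rfl, σ, rfl, hu, .nil, .cons (.erasing hc hπ) hF, hE⟩
      | m1 _ _ _ _ _ _ _ h => exact absurd (hm.1 h) hx
      | m2 _ _ _ _ _ _ _ _ _ h => exact absurd (hm.1 h) hx
  | m1 F x y t u π E hx hu =>
    obtain ⟨x', t', rfl⟩ := equiv_lam hc
    obtain rfl : Phase.eval = φ₂ := hp
    rcases hπ with _ | ⟨hy, hπ⟩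
    obtain rfl := equiv_var hy
    have hm := hc.mem_body
    cases h₂ with
    | comm h => cases h; exact absurd (hm.2 hx) ‹_›
    | m1 _ _ _ _ u' _ _ hx' hu' =>
      exact ⟨rfl, σ, rfl, hc.body hu hu' (fun _ => rfl) (fun _ _ => rfl), hπ, hF, hE⟩
    | m2 _ _ _ _ _ _ _ _ _ _ h => exact absurd rfl (h _)
  | m2 F x z t u v π E l hx hv hl hu hz =>
    obtain ⟨x', t', rfl⟩ := equiv_lam hc
    obtain rfl : Phase.eval = φ₂ := hp
    rcases hπ with _ | @⟨_, v', _, π', hvv, hπ⟩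
    have hm := hc.mem_body
    cases h₂ with
    | comm h => cases h; exact absurd (hm.2 hx) ‹_›
    | m1 _ _ y _ _ _ _ h =>
      refine absurd ?_ (hv (σ.symm y))
      rw [equiv_iff] at hvv
      cases v with
      | var w => rw [toTerm_var, toTerm_var, Term.rename, Term.var.injEq] at hvv; simp [← hvv]
      | lam => simp [toTerm_lam, Term.rename] at hvv
      | app => simp [Term.rename] at hvv
    | m2 _ _ z' _ u' _ _ _ l' hx' hv' hl' hu' hz' =>
      obtain rfl := hl.label_eq_of_equiv hl' hvv hE c₁.stack_head c₂.stack_head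
      have hb := Code.Equiv.body hc hu hu' (τ := retarget σ z z')
          (fun _ => retarget_self _ _ _)
          (fun n hn => hc.retarget_eq (fun h => hz (.inl h)) (fun h => hz' (.inl h)) hn)
      simp only [State.Live, not_or, Stack.live_cons] at hz hz'
      exact ⟨rfl, _, rfl, hb, stack_retarget hπ hz.2.1.2 hz'.2.1.2,
        frame_retarget hF hz.2.2.1 hz'.2.2.1,
        .cons ⟨retarget_self _ _ _, hvv.retarget hz.2.1.1 hz'.2.1.1, rfl⟩
          (hE.retarget hz.2.2.2 hz'.2.2.2)⟩
  | m3 F x t u v π E hu =>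
    obtain rfl : Phase.back = φ₂ := hp
    cases hπ
    rcases hF with _ | ⟨hi, hF⟩
    cases hi with
    | @erasing _ x' _ t' _ π' h1 h2 =>
    cases h₂ with
    | comm h => cases h
    | m3 _ _ _ u' _ _ _ hu' =>
      have k₁ := e₁ x t π (by simp)
      have k₂ := e₂ x' t' π' (by simp)
      -- The erased variable does not occur, so any target name will do; `0` and `σ 0` make the two
      -- sides correspond under `σ`.
      exact ⟨rfl, σ, rfl, h1.body (hu.trans (rename_ren1_of_not_mem (y := 0) k₁))
        (hu'.trans (rename_ren1_of_not_mem (y := σ 0) k₂)) (fun _ => rfl) (fun _ _ => rfl),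
        h2, hF, hE⟩
  | exp F x u π E e he hl hu =>
    obtain rfl := equiv_var hc
    obtain rfl : Phase.eval = φ₂ := hp
    rcases hE.lookup x with ⟨h1, h2⟩ | ⟨d, d', h1, h2, h3, h4⟩
    · simp [he] at h1
    · obtain rfl : e = d := Option.some.inj (he.symm.trans h1)
      cases h₂ with
      | comm h =>
        cases h with
        | c3 _ _ _ _ hus =>
        refine absurd hus (not_useless h2 ?_)
        rw [← h3]
        refine hl.imp_right fun h => ⟨h.1, ?_⟩
        rintro rfl
        cases hπ
        exact h.2 rfl
      | exp _ _ u' _ _ e' he' _ hu' =>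
        obtain rfl : d' = e' := Option.some.inj (h2.symm.trans he')
        refine ⟨rfl, σ, rfl, ?_, hπ, hF, hE⟩
        rw [equiv_iff] at h4 ⊢
        rw [hu, hu', h4]

end MaxMAM

namespace MaxMAM

open Term Code

/-! ## A structured language for RAM programs -/

/-- Memories of structured programs: registers, a heap, and tables indexed by names. -/
structure Mem : Type where
  reg : ℕ → ℕ
  heap : ℕ → ℕ
  tab : ℕ → ℕ → ℕ

/-- Assign a register. -/
def Mem.set (m : Mem) (i v : ℕ) : Mem := { m with reg := Function.update m.reg i v }

@[simp] theorem Mem.reg_set (m : Mem) (i v j : ℕ) :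
    (m.set i v).reg j = if j = i then v else m.reg j := Function.update_apply ..

@[simp] theorem Mem.heap_set (m : Mem) (i v : ℕ) : (m.set i v).heap = m.heap := rfl

@[simp] theorem Mem.tab_set (m : Mem) (i v : ℕ) : (m.set i v).tab = m.tab := rfl

/-- Assign an entry of a table. -/
def Mem.setTab (m : Mem) (k x v : ℕ) : Mem :=
  ⟨m.reg, m.heap, fun k' x' => if k' = k ∧ x' = x then v else m.tab k' x'⟩

@[simp] theorem Mem.reg_setTab (m : Mem) (k x v : ℕ) : (m.setTab k x v).reg = m.reg := rfl

@[simp] theorem Mem.heap_setTab (m : Mem) (k x v : ℕ) : (m.setTab k x v).heap = m.heap := rfl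

@[simp] theorem Mem.tab_setTab (m : Mem) (k x v k' x' : ℕ) :
    (m.setTab k x v).tab k' x' = if k' = k ∧ x' = x then v else m.tab k' x' := rfl

/-- Basic operations. Register 5 holds the address of the first free block of the heap, and
register 6 the end of the input. -/
inductive Op : Type
  | set (i c : ℕ)
  | mov (i j : ℕ)
  | addc (i j c : ℕ)
  | dec (i j : ℕ)
  | add (i j k : ℕ)
  /-- read the input cell of address register `j` -/
  | inp (i j : ℕ)
  /-- read field `c` of the heap block of address register `j` -/
  | get (i j c : ℕ)
  /-- allocate a heap block with the given fields -/
  | alloc (i a b c d e : ℕ)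
  /-- read the entry of table `k` for the name in register `j` -/
  | getT (k i j : ℕ)
  /-- write register `j` in table `k`, for the name in register `i` -/
  | setT (k i j : ℕ)

/-- Loop-free commands. -/
inductive Cmd : Type
  | ops (l : List Op)
  | seq (c d : Cmd)
  /-- `c` if register `r` holds `k`, and `d` otherwise -/
  | ifEq (r k : ℕ) (c d : Cmd)

section semantics

variable (B : ℕ) (inp : ℕ → ℕ)

/-- The weakest precondition of a basic operation. -/
def Op.wp (Q : Mem → Prop) (m : Mem) : Op → Prop
  | set i c => Q (m.set i c)
  | mov i j => Q (m.set i (m.reg j))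
  | addc i j c => Q (m.set i (m.reg j + c))
  | dec i j => Q (m.set i (m.reg j - 1))
  | add i j k => Q (m.set i (m.reg j + m.reg k))
  | .inp i j => (32 ≤ m.reg j ∧ m.reg j < B) ∧ Q (m.set i (inp (m.reg j)))
  | get i j c => (m.reg j % 16 = 8 ∧ 16 * B ≤ m.reg j) ∧ Q (m.set i (m.heap (m.reg j + c)))
  -- The new heap is quantified over and described by the old cells and the five fields only, so
  -- that verification conditions contain no nested updates. The free pointer moves by 16 because
  -- the other half of each 16 cells belongs to the tables.
  | alloc i a b c d e => (m.reg 5 % 16 = 8 ∧ 16 * B ≤ m.reg 5) ∧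
      ∀ h : ℕ → ℕ, (∀ x < m.reg 5, h x = m.heap x) → h (m.reg 5) = m.reg a →
        h (m.reg 5 + 1) = m.reg b → h (m.reg 5 + 2) = m.reg c → h (m.reg 5 + 3) = m.reg d →
        h (m.reg 5 + 4) = m.reg e →
        Q ⟨((m.set i (m.reg 5)).set 5 (m.reg 5 + 16)).reg, h, m.tab⟩
  | getT k i j => m.reg 6 = B ∧ Q (m.set i (m.tab k (m.reg j)))
  | setT k i j => m.reg 6 = B ∧
      Q (m.setTab k (m.reg i) (m.reg j))

/-- The weakest precondition of a sequence of operations. -/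
def Op.wps (Q : Mem → Prop) : List Op → Mem → Prop
  | [], m => Q m
  | o :: l, m => Op.wp B inp (Op.wps Q l) m o

/-- The weakest precondition of a command. -/
def Cmd.wp : Cmd → (Mem → Prop) → Mem → Prop
  | ops l, Q, m => Op.wps B inp Q l m
  | seq c d, Q, m => c.wp (d.wp Q) m
  | ifEq r k c d, Q, m => if m.reg r = k then c.wp Q m else d.wp Q m

/-- The RAM memory `X` represents `m`: the blocks of the heap are at the addresses congruent
to `8` modulo `16`, and the tables at the other addresses, after the input. -/
structure Rep (X : ℕ → ℕ) (m : Mem) : Prop where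
  reg : ∀ a < 30, X a = m.reg a
  inp : ∀ a, 32 ≤ a → a < B → X a = inp a
  heap : ∀ a, 16 * B ≤ a → 8 ≤ a % 16 → X a = m.heap a
  tab : ∀ k < 8, ∀ x, X (16 * (B + x) + k) = m.tab k x

end semantics

/-- The operation only uses registers below `30`, fields and tables below `8`. -/
def Op.WF : Op → Prop
  | set i _ => i < 30
  | mov i j => i < 30 ∧ j < 30
  | addc i j _ => i < 30 ∧ j < 30
  | dec i j => i < 30 ∧ j < 30
  | add i j k => i < 30 ∧ j < 30 ∧ k < 30
  | inp i j => i < 30 ∧ j < 30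
  | get i j c => i < 30 ∧ j < 30 ∧ c < 8
  | alloc i a b c d e => (i < 30 ∧ i ≠ 5) ∧ a < 30 ∧ b < 30 ∧ c < 30 ∧ d < 30 ∧ e < 30
  | getT k i j => k < 8 ∧ i < 30 ∧ j < 30
  | setT k i j => k < 8 ∧ i < 30 ∧ j < 30

instance : DecidablePred Op.WF := fun o => by cases o <;> unfold Op.WF <;> infer_instance

/-- All operations of the command are well-formed. -/
def Cmd.WF : Cmd → Prop
  | ops l => ∀ o ∈ l, o.WF
  | seq c d => c.WF ∧ d.WF
  | ifEq r _ c d => r < 30 ∧ c.WF ∧ d.WF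

instance Cmd.decidableWF : DecidablePred Cmd.WF
  | ops l => inferInstanceAs (Decidable (∀ o ∈ l, o.WF))
  | seq c d => @instDecidableAnd _ _ (decidableWF c) (decidableWF d)
  | ifEq _ _ c d =>
    @instDecidableAnd _ _ _ (@instDecidableAnd _ _ (decidableWF c) (decidableWF d))

/-! ### Compilation -/

/-- The instructions of an operation. -/
def Op.compile : Op → List Instr
  | set i c => [.const i c]
  | mov i j => [.const 31 0, .add i j 31]
  | addc i j c => [.const 31 c, .add i j 31]
  | dec i j => [.const 31 1, .sub i j 31]
  | add i j k => [.add i j k]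
  | inp i j => [.load i j 0]
  | get i j c => [.load i j c]
  | alloc i a b c d e => [.store 5 0 a, .store 5 1 b, .store 5 2 c, .store 5 3 d, .store 5 4 e,
      .const 31 0, .add i 5 31, .const 31 16, .add 5 5 31]
  | getT k i j => [.add 31 6 j, .add 31 31 31, .add 31 31 31, .add 31 31 31, .add 31 31 31,
      .load i 31 k]
  | setT k i j => [.add 31 6 i, .add 31 31 31, .add 31 31 31, .add 31 31 31, .add 31 31 31,
      .store 31 k j]

/-- The number of instructions of a command. -/
def Cmd.len : Cmd → ℕ
  | ops l => (l.flatMap Op.compile).length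
  | seq c d => c.len + d.len
  | ifEq _ _ c d => 6 + c.len + d.len

/-- The instructions of a command, from address `o` on. -/
def Cmd.compile : Cmd → ℕ → List Instr
  | ops l, _ => l.flatMap Op.compile
  | seq c d, o => c.compile o ++ d.compile (o + c.len)
  | ifEq r k c d, o =>
    [.const 31 k, .sub 30 r 31, .sub 31 31 r, .add 30 30 31, .jz 30 (o + (6 + d.len))] ++
      (d.compile (o + 5) ++ (.jmp (o + (6 + c.len + d.len)) :: c.compile (o + (6 + d.len))))

theorem Cmd.length_compile (c : Cmd) (o : ℕ) : (c.compile o).length = c.len := by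
  induction c generalizing o with
  | ops l => rfl
  | seq c d hc hd => simp [compile, len, hc, hd]
  | ifEq r k c d hc hd => simp [compile, len, hc, hd]; omega

/-! ### Correctness of the compilation -/

theorem Program.run_add (P : Program) (a b : ℕ) (c : Config) :
    P.run (a + b) c = P.run b (P.run a c) := by
  induction b with
  | zero => rfl
  | succ b ih => rw [← Nat.add_assoc, Program.run, ih, Program.run]

/-- The program `P` contains the instructions `l` from address `o` on. -/
def At (P : Program) (o : ℕ) (l : List Instr) : Prop := ∀ i < l.length, P[o + i]? = l[i]?

theorem at_append {P : Program} {o : ℕ} {l l' : List Instr} :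
    At P o (l ++ l') ↔ At P o l ∧ At P (o + l.length) l' := by
  constructor
  · refine fun h => ⟨fun i hi => ?_, fun i hi => ?_⟩
    · rw [h i (by simp; omega), List.getElem?_append_left hi]
    · rw [Nat.add_assoc, h (l.length + i) (by simp; omega),
        List.getElem?_append_right (by omega), Nat.add_sub_cancel_left]
  · rintro ⟨h, h'⟩ i hi
    rcases lt_or_ge i l.length with hl | hl
    · rw [List.getElem?_append_left hl, h i hl]
    · rw [List.getElem?_append_right hl, ← h' _ (by simp at hi; omega)]
      congr 1
      omega

theorem at_cons {P : Program} {o : ℕ} {a : Instr} {l : List Instr} :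
    At P o (a :: l) ↔ P[o]? = some a ∧ At P (o + 1) l := by
  rw [← List.singleton_append, at_append]
  simp [At]

/-- The effect on the memory of the instructions that are not jumps. -/
def Instr.eff (X : ℕ → ℕ) : Instr → ℕ → ℕ
  | .const i a => Function.update X i a
  | .add i j k => Function.update X i (X j + X k)
  | .sub i j k => Function.update X i (X j - X k)
  | .load i j a => Function.update X i (X (X j + a))
  | .store i a j => Function.update X (X i + a) (X j)
  | _ => X

/-- The instruction is not a jump. -/
def Instr.Straight : Instr → Prop
  | .jz _ _ | .jmp _ | .halt => False
  | _ => True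

theorem Program.run_one {P : Program} {o : ℕ} {a : Instr} (h : P[o]? = some a) (X : ℕ → ℕ) :
    P.run 1 ⟨o, X⟩ = (a.exec ⟨o, X⟩).getD ⟨o, X⟩ := by
  simp [Program.run, Program.step, h]

theorem Program.run_straight {P : Program} {l : List Instr} (hl : ∀ a ∈ l, a.Straight) {o : ℕ}
    (h : At P o l) (X : ℕ → ℕ) :
    P.run l.length ⟨o, X⟩ = ⟨o + l.length, l.foldl Instr.eff X⟩ := by
  induction l generalizing o X with
  | nil => rfl
  | cons a l ih =>
    obtain ⟨h1, h2⟩ := at_cons.1 h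
    have ha := hl a (by simp)
    rw [List.length_cons, Nat.add_comm, Program.run_add, Program.run_one h1]
    have : (a.exec ⟨o, X⟩).getD ⟨o, X⟩ = ⟨o + 1, a.eff X⟩ := by cases a <;> first | rfl | cases ha
    rw [this, ih (fun b hb => hl b (by simp [hb])) h2, List.foldl_cons, Nat.add_assoc]

section

variable {B : ℕ} {inp : ℕ → ℕ} {X : ℕ → ℕ} {m : Mem}

theorem Rep.scratch (h : Rep B inp X m) (hB : 32 ≤ B) {a : ℕ} (ha : a = 30 ∨ a = 31) (v : ℕ) :
    Rep B inp (Function.update X a v) m := by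
  refine ⟨fun b hb => ?_, fun b h1 h2 => ?_, fun b h1 h2 => ?_, fun k hk x => ?_⟩
  · rw [Function.update_of_ne (by omega), h.reg b hb]
  · rw [Function.update_of_ne (by omega), h.inp b h1 h2]
  · rw [Function.update_of_ne (by omega), h.heap b h1 h2]
  · rw [Function.update_of_ne (by omega), h.tab k hk x]

theorem Rep.set (h : Rep B inp X m) (hB : 32 ≤ B) {i : ℕ} (hi : i < 30) (v : ℕ) :
    Rep B inp (Function.update X i v) (m.set i v) := by
  refine ⟨fun b hb => ?_, fun b h1 h2 => ?_, fun b h1 h2 => ?_, fun k hk x => ?_⟩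
  · rw [Function.update_apply, Mem.reg_set, h.reg b hb]
  · rw [Function.update_of_ne (by omega), h.inp b h1 h2]
  · rw [Function.update_of_ne (by omega), h.heap b h1 h2]; rfl
  · rw [Function.update_of_ne (by omega), h.tab k hk x]; rfl

theorem Rep.store (h : Rep B inp X m) (hB : 32 ≤ B) {a : ℕ} (ha : 16 * B ≤ a) (ha' : 8 ≤ a % 16)
    (v : ℕ) : Rep B inp (Function.update X a v) ⟨m.reg, Function.update m.heap a v, m.tab⟩ := by
  refine ⟨fun b hb => ?_, fun b h1 h2 => ?_, fun b h1 h2 => ?_, fun k hk x => ?_⟩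
  · rw [Function.update_of_ne (by omega), h.reg b hb]
  · rw [Function.update_of_ne (by omega), h.inp b h1 h2]
  · simp only [Function.update_apply, h.heap b h1 h2]
  · rw [Function.update_of_ne (by omega), h.tab k hk x]

theorem Rep.storeTab (h : Rep B inp X m) (hB : 32 ≤ B) {k : ℕ} (hk : k < 8) (x v : ℕ) :
    Rep B inp (Function.update X (16 * (B + x) + k) v) (m.setTab k x v) := by
  refine ⟨fun b hb => ?_, fun b h1 h2 => ?_, fun b h1 h2 => ?_, fun k' hk' x' => ?_⟩
  · rw [Function.update_of_ne (by omega), h.reg b hb]; rfl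
  · rw [Function.update_of_ne (by omega), h.inp b h1 h2]
  · rw [Function.update_of_ne (by omega), h.heap b h1 h2]; rfl
  · rw [Function.update_apply, Mem.tab_setTab, h.tab k' hk' x']
    refine if_congr ?_ rfl rfl
    omega

theorem Rep.add_scratch (h : Rep B inp X m) (hB : 32 ≤ B) {i j v : ℕ} (hv : X 31 = v)
    (hi : i < 30) (hj : j < 30) :
    Rep B inp ((Instr.add i j 31).eff X) (m.set i (m.reg j + v)) := by
  rw [Instr.eff, hv, h.reg j hj]
  exact h.set hB hi _

/-- There is no multiplication: four doublings of `B` plus the name give the address. Tables and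
heap interleave modulo 16, so both can grow without bound. -/
theorem Rep.tabAddr (h : Rep B inp X m) (hB : 32 ≤ B) (h6 : m.reg 6 = B) {j : ℕ} (hj : j < 30) :
    Rep B inp ([Instr.add 31 6 j, .add 31 31 31, .add 31 31 31, .add 31 31 31,
      .add 31 31 31].foldl Instr.eff X) m ∧
    [Instr.add 31 6 j, .add 31 31 31, .add 31 31 31, .add 31 31 31,
      .add 31 31 31].foldl Instr.eff X 31 = 16 * (B + m.reg j) := by
  refine ⟨((((h.scratch hB (.inr rfl) _).scratch hB (.inr rfl) _).scratch hB (.inr rfl)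
    _).scratch hB (.inr rfl) _).scratch hB (.inr rfl) _, ?_⟩
  have h1 := h.reg 6 (by omega)
  have h2 := h.reg j hj
  simp [Instr.eff, h1, h2, h6]
  omega

theorem Op.straight (o : Op) : ∀ a ∈ o.compile, a.Straight := by
  cases o <;> simp [Op.compile, Instr.Straight]

theorem Op.correct {o : Op} (ho : o.WF) (hB : 32 ≤ B) (h : Rep B inp X m) {Q : Mem → Prop}
    (hQ : o.wp B inp Q m) : ∃ m', Rep B inp (o.compile.foldl Instr.eff X) m' ∧ Q m' := by
  cases o with
  | set i c => exact ⟨_, h.set hB ho c, hQ⟩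
  | mov i j =>
    refine ⟨_, (?_ : Rep B inp _ (m.set i (m.reg j))), hQ⟩
    have := (h.scratch hB (.inr rfl) 0).set hB ho.1 (m.reg j)
    simpa [Op.compile, Instr.eff, Function.update_apply, ho.2.ne, h.reg j ho.2,
      show j ≠ 31 by have := ho.2; omega] using this
  | addc i j c =>
    refine ⟨_, (?_ : Rep B inp _ (m.set i (m.reg j + c))), hQ⟩
    have := (h.scratch hB (.inr rfl) c).set hB ho.1 (m.reg j + c)
    simpa [Op.compile, Instr.eff, Function.update_apply, h.reg j ho.2,
      show j ≠ 31 by have := ho.2; omega] using this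
  | dec i j =>
    refine ⟨_, (?_ : Rep B inp _ (m.set i (m.reg j - 1))), hQ⟩
    have := (h.scratch hB (.inr rfl) 1).set hB ho.1 (m.reg j - 1)
    simpa [Op.compile, Instr.eff, Function.update_apply, h.reg j ho.2,
      show j ≠ 31 by have := ho.2; omega] using this
  | add i j k =>
    refine ⟨_, (?_ : Rep B inp _ (m.set i (m.reg j + m.reg k))), hQ⟩
    have := h.set hB ho.1 (m.reg j + m.reg k)
    simpa [Op.compile, Instr.eff, h.reg j ho.2.1, h.reg k ho.2.2] using this
  | inp i j =>
    refine ⟨_, (?_ : Rep B inp _ (m.set i (inp (m.reg j)))), hQ.2⟩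
    have := h.set hB ho.1 (inp (m.reg j))
    simpa [Op.compile, Instr.eff, h.reg j ho.2, h.inp _ hQ.1.1 hQ.1.2] using this
  | get i j c =>
    refine ⟨_, (?_ : Rep B inp _ (m.set i (m.heap (m.reg j + c)))), hQ.2⟩
    have := h.set hB ho.1 (m.heap (m.reg j + c))
    have hc := ho.2.2
    have h1 := hQ.1
    simpa [Op.compile, Instr.eff, h.reg j ho.2.1,
      h.heap (m.reg j + c) (by omega) (by omega)] using this
  | alloc i a b c d e =>
    obtain ⟨⟨h1, h2⟩, hQ⟩ := hQ
    obtain ⟨⟨hi, hi5⟩, ha, hb, hc, hd, he⟩ := ho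
    have st : ∀ {X : ℕ → ℕ} {g : ℕ → ℕ}, Rep B inp X ⟨m.reg, g, m.tab⟩ → ∀ f < 8, ∀ r < 30,
        Rep B inp ((Instr.store 5 f r).eff X)
          ⟨m.reg, Function.update g (m.reg 5 + f) (m.reg r), m.tab⟩ := by
      intro X g h f hf r hr
      have := h.store hB (a := m.reg 5 + f) (by omega) (by omega) (m.reg r)
      rwa [Instr.eff, h.reg 5 (by omega), h.reg r hr]
    have hf := st (st (st (st (st h 0 (by omega) a ha) 1 (by omega) b hb) 2 (by omega) c hc) 3
      (by omega) d hd) 4 (by omega) e he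
    have hi' := ((hf.scratch hB (.inr rfl) 0).add_scratch hB (v := 0) (by simp) hi
      (show 5 < 30 by omega)).scratch hB (.inr rfl) 16
    have hr := hi'.add_scratch hB (i := 5) (j := 5) (v := 16) (by simp) (by omega) (by omega)
    refine ⟨_, hr, ?_⟩
    have e5 : (5 = i) = False := by simp [hi5.symm]
    simp only [Mem.reg_set, e5, if_false, Nat.add_zero]
    refine hQ _ (fun x hx => ?_) ?_ ?_ ?_ ?_ ?_ <;>
      simp [Function.update_apply]
    iterate 5 rw [if_neg (by omega)]
  | getT k i j =>
    obtain ⟨hk, hi, hj⟩ := ho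
    refine ⟨_, (?_ : Rep B inp _ (m.set i (m.tab k (m.reg j)))), hQ.2⟩
    have h5 := h.tabAddr hB hQ.1 hj
    have key : ∀ Y : ℕ → ℕ, Rep B inp Y m → Y 31 = 16 * (B + m.reg j) →
        Rep B inp (Function.update Y i (Y (Y 31 + k))) (m.set i (m.tab k (m.reg j))) := by
      intro Y hY hY'
      rw [hY', hY.tab k hk]
      exact hY.set hB hi _
    exact key _ h5.1 h5.2
  | setT k i j =>
    obtain ⟨hk, hi, hj⟩ := ho
    refine ⟨_, (?_ : Rep B inp _ (m.setTab k (m.reg i) (m.reg j))), hQ.2⟩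
    have h5 := h.tabAddr hB hQ.1 hi
    have key : ∀ Y : ℕ → ℕ, Rep B inp Y m → Y 31 = 16 * (B + m.reg i) →
        Rep B inp (Function.update Y (Y 31 + k) (Y j)) (m.setTab k (m.reg i) (m.reg j)) := by
      intro Y hY hY'
      rw [hY', hY.reg j hj]
      exact hY.storeTab hB hk _ _
    exact key _ h5.1 h5.2

theorem Op.correct_list {l : List Op} (hl : ∀ o ∈ l, o.WF) (hB : 32 ≤ B) (h : Rep B inp X m)
    {Q : Mem → Prop} (hQ : Op.wps B inp Q l m) :
    ∃ m', Rep B inp ((l.flatMap Op.compile).foldl Instr.eff X) m' ∧ Q m' := by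
  induction l generalizing X m with
  | nil => exact ⟨m, h, hQ⟩
  | cons o l ih =>
    obtain ⟨m', h', hQ'⟩ := Op.correct (hl o (by simp)) hB h hQ
    rw [List.flatMap_cons, List.foldl_append]
    exact ih (fun o ho => hl o (by simp [ho])) h' hQ'

theorem Cmd.correct {c : Cmd} (hc : c.WF) (hB : 32 ≤ B) (h : Rep B inp X m) {Q : Mem → Prop}
    (hQ : c.wp B inp Q m) {P : Program} {o : ℕ} (hP : At P o (c.compile o)) :
    ∃ n ≤ c.len, ∃ X' m', P.run n ⟨o, X⟩ = ⟨o + c.len, X'⟩ ∧ Rep B inp X' m' ∧ Q m' := by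
  induction c generalizing o X m Q with
  | ops l =>
    obtain ⟨m', h1, h2⟩ := Op.correct_list hc hB h hQ
    refine ⟨_, le_rfl, _, m', Program.run_straight ?_ hP X, h1, h2⟩
    intro a ha
    obtain ⟨o, -, ho⟩ := List.mem_flatMap.1 ha
    exact o.straight a ho
  | seq c d hc' hd' =>
    obtain ⟨h1, h2⟩ := at_append.1 hP
    rw [Cmd.length_compile] at h2
    obtain ⟨n, hn, X', m', h3, h4, h5⟩ := hc' hc.1 h hQ h1
    obtain ⟨n', hn', X'', m'', h6, h7, h8⟩ := hd' hc.2 h4 h5 h2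
    refine ⟨n + n', by simp only [len]; omega, X'', m'', ?_, h7, h8⟩
    rw [Program.run_add, h3, h6, len, Nat.add_assoc]
  | ifEq r k c d hc' hd' =>
    obtain ⟨h1, h2⟩ := at_append.1 hP
    obtain ⟨h2, h3⟩ := at_append.1 h2
    obtain ⟨h3, h4⟩ := at_cons.1 h3
    rw [Cmd.length_compile] at h3 h4
    rw [← List.singleton_append (l := [Instr.sub _ _ _, _, _, _]),
      show [Instr.const 31 k] ++ [.sub 30 r 31, .sub 31 31 r, .add 30 30 31,
        .jz 30 (o + (6 + d.len))] = [.const 31 k, .sub 30 r 31, .sub 31 31 r, .add 30 30 31] ++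
        [.jz 30 (o + (6 + d.len))] from rfl, at_append] at h1
    obtain ⟨h1, h1'⟩ := h1
    have hr := Program.run_straight (by simp [Instr.Straight]) h1 X
    have hj := Program.run_one (at_cons.1 h1').1
    set Y := [Instr.const 31 k, .sub 30 r 31, .sub 31 31 r, .add 30 30 31].foldl Instr.eff X with hY
    have hYr : Rep B inp Y m := (((h.scratch hB (.inr rfl) _).scratch hB (.inl rfl) _).scratch hB
      (.inr rfl) _).scratch hB (.inl rfl) _
    -- The sum of the two truncated differences vanishes exactly when the register holds `k`.
    have hY0 : Y 30 = (m.reg r - k) + (k - m.reg r) := by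
      rw [← h.reg r hc.1]
      have : r ≠ 30 ∧ r ≠ 31 := by have := hc.1; omega
      simp [hY, Instr.eff, this]
    have key : P.run 5 ⟨o, X⟩ = ⟨if m.reg r = k then o + (6 + d.len) else o + 5, Y⟩ := by
      rw [show 5 = 4 + 1 from rfl, Program.run_add]
      erw [hr]
      erw [hj]
      simp only [Instr.exec, Option.getD_some, hY0]
      refine congrArg (Config.mk · Y) (if_congr ?_ rfl rfl)
      omega
    rw [Cmd.wp] at hQ
    split_ifs at hQ with hk
    · rw [if_pos hk] at key
      have h4' : At P (o + (6 + d.len)) (c.compile (o + (6 + d.len))) := by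
        convert h4 using 1; simp only [List.length_cons, List.length_nil]; omega
      obtain ⟨n, hn, X', m', h5, h6, h7⟩ := hc' hc.2.1 hYr hQ h4'
      refine ⟨5 + n, by simp only [len]; omega, X', m', ?_, h6, h7⟩
      rw [Program.run_add, key, h5, len]
      congr 1; omega
    · rw [if_neg hk] at key
      obtain ⟨n, hn, X', m', h5, h6, h7⟩ := hd' hc.2.2 hYr hQ h2
      refine ⟨5 + (n + 1), by simp only [len]; omega, X', m', ?_, h6, h7⟩
      have h5' : P.run n ⟨o + 5, Y⟩ = ⟨o + 5 + d.len, X'⟩ := h5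
      rw [Program.run_add, key, Program.run_add, h5']
      erw [Program.run_one h3]
      simp only [Instr.exec, Option.getD_some, len]

end

/-! ### Iterating a command -/

/-- The program that iterates a command as long as register 9 holds zero. -/
def Cmd.iterate (c : Cmd) : Program :=
  [.jz 9 2, .jmp (3 + c.len)] ++ (c.compile 2 ++ [.jmp 0])

/-- After `n` iterations of the command `c` from the memory `m`, the property `Q` holds. -/
def Cmd.Its (B : ℕ) (inp : ℕ → ℕ) (c : Cmd) : ℕ → (Mem → Prop) → Mem → Prop
  | 0, Q, m => Q m
  | n + 1, Q, m => m.reg 9 = 0 ∧ c.wp B inp (Its B inp c n Q) m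

/-- Each iteration costs at most the length of the command plus the test and the jump back. The
lower bound `n ≤ k` is what shows that the RAM diverges when iterations never end. -/
theorem Cmd.correct_iterate {c : Cmd} (hc : c.WF) {B : ℕ} (hB : 32 ≤ B) {inp : ℕ → ℕ} {n : ℕ}
    {Q : Mem → Prop} {X : ℕ → ℕ} {m : Mem} (h : Rep B inp X m) (hQ : c.Its B inp n Q m) :
    ∃ k, n ≤ k ∧ k ≤ (c.len + 2) * n ∧ ∃ X' m', c.iterate.run k ⟨0, X⟩ = ⟨0, X'⟩ ∧
      Rep B inp X' m' ∧ Q m' := by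
  induction n generalizing X m with
  | zero => exact ⟨0, le_rfl, le_rfl, X, m, rfl, h, hQ⟩
  | succ n ih =>
    have hP : At c.iterate 0 c.iterate := fun i _ => by rw [Nat.zero_add]
    obtain ⟨h1, h2⟩ := at_append.1 hP
    obtain ⟨h2, h3⟩ := at_append.1 h2
    rw [Cmd.length_compile] at h3
    have r1 := Program.run_one (at_cons.1 h1).1 X
    have h0 : X 9 = 0 := (h.reg 9 (by omega)).trans hQ.1
    simp only [Instr.exec, h0, if_true, Option.getD_some] at r1
    obtain ⟨k, hk, X', m', h4, h5, h6⟩ := Cmd.correct hc hB h hQ.2 h2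
    have r2 := Program.run_one (at_cons.1 h3).1 X'
    simp only [Instr.exec, Option.getD_some] at r2
    obtain ⟨j, hj, hj', X'', m'', h7, h8⟩ := ih h5 h6
    refine ⟨1 + (k + (1 + j)), by omega, by rw [Nat.mul_succ]; omega, X'', m'', ?_, h8⟩
    rw [Program.run_add, r1, Program.run_add]
    erw [h4]
    rw [Program.run_add]
    erw [r2]
    exact h7

theorem Cmd.iterate_halted {c : Cmd} {X : ℕ → ℕ} (h : X 9 ≠ 0) :
    c.iterate.Halted (c.iterate.run 2 ⟨0, X⟩) ∧ (c.iterate.run 2 ⟨0, X⟩).mem = X := by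
  have hP : At c.iterate 0 c.iterate := fun i _ => by rw [Nat.zero_add]
  obtain ⟨h1, -⟩ := at_append.1 hP
  have r1 := Program.run_one (at_cons.1 h1).1 X
  have r2 := Program.run_one (at_cons.1 (at_cons.1 h1).2).1 X
  simp only [Instr.exec, h, if_false, Option.getD_some] at r1 r2
  have hr : c.iterate.run 2 ⟨0, X⟩ = ⟨3 + c.len, X⟩ := by
    rw [show 2 = 1 + 1 from rfl, Program.run_add, r1]
    exact r2
  rw [hr]
  refine ⟨?_, rfl⟩
  -- The exit jump goes just past the last instruction: two tests, the command and the jump back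
  -- occupy `3 + c.len` cells.
  have : c.iterate[3 + c.len]? = none := by
    simp [Cmd.iterate, Cmd.length_compile]; omega
  simp [Program.Halted, Program.step, this]

theorem Cmd.iterate_not_halted {c : Cmd} {X : ℕ → ℕ} : ¬ c.iterate.Halted ⟨0, X⟩ := by
  simp [Program.Halted, Program.step, Cmd.iterate, Instr.exec]

section mono

variable {B : ℕ} {inp : ℕ → ℕ} {Q Q' : Mem → Prop}

theorem Op.wp_mono (hQ : ∀ m, Q m → Q' m) {o : Op} {m : Mem} (h : o.wp B inp Q m) :
    o.wp B inp Q' m := by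
  cases o with
  | inp | get | getT | setT => exact ⟨h.1, hQ _ h.2⟩
  | alloc =>
    exact ⟨h.1, fun g h1 h2 h3 h4 h5 h6 => hQ _ (h.2 g h1 h2 h3 h4 h5 h6)⟩
  | _ => exact hQ _ h

theorem Op.wps_mono (hQ : ∀ m, Q m → Q' m) {l : List Op} {m : Mem} (h : Op.wps B inp Q l m) :
    Op.wps B inp Q' l m := by
  induction l generalizing m with
  | nil => exact hQ m h
  | cons o l ih => exact Op.wp_mono (fun _ => ih) h

theorem Cmd.wp_mono (hQ : ∀ m, Q m → Q' m) {c : Cmd} {m : Mem} (h : c.wp B inp Q m) :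
    c.wp B inp Q' m := by
  induction c generalizing m Q Q' with
  | ops l => exact Op.wps_mono hQ h
  | seq c d hc hd => exact hc (fun _ => hd hQ) h
  | ifEq r k c d hc hd =>
    rw [wp] at h ⊢
    split_ifs at h ⊢
    · exact hc hQ h
    · exact hd hQ h

theorem Cmd.Its.mono {c : Cmd} {n : ℕ} {m : Mem} (h : c.Its B inp n Q m)
    (hQ : ∀ m', Q m' → Q' m') : c.Its B inp n Q' m := by
  induction n generalizing m with
  | zero => exact hQ m h
  | succ n ih => exact ⟨h.1, Cmd.wp_mono (fun _ => ih) h.2⟩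

end mono

theorem Cmd.its_add {B : ℕ} {inp : ℕ → ℕ} {c : Cmd} {n k : ℕ} {Q : Mem → Prop} {m : Mem} :
    c.Its B inp (n + k) Q m ↔ c.Its B inp n (c.Its B inp k Q) m := by
  induction n generalizing m with
  | zero => simp [Its]
  | succ n ih =>
    have : c.Its B inp (n + k) Q = c.Its B inp n (c.Its B inp k Q) := funext fun _ => propext ih
    rw [Nat.succ_add, Its, Its, this]

end MaxMAM

namespace MaxMAM

open Term Code

/-! ## The RAM program

Registers: 0 phase, 1 code, 2 stack, 3 frame, 4 environment, 5 first free block, 6 end of the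
input, 7 first unused name, 8 mode, 9 stop flag, 10 checking flag, 11 input address or code to
copy, 12 code just built, 13 list of the codes under construction, 18 output of the Checking AM,
19-21 code, stack and frame saved by the Checking AM, 22 name renamed by the copy, 23 number of
codes still to scan; the others are temporary. Tables: 0 environment entry, 1 occurrence flag,
2 renaming (0 for the identity, and `y + 1` for the name `y`).

Besides its name and its body, the block of an abstraction holds a flag telling whether the name
occurs free in the body. -/

namespace Ram

/-- Scan the input: find its end, and a bound on its names. -/
def scan : Cmd :=
  .ifEq 23 0
    -- The first free block is at `16 * B + 8`, where `B` is the end of the input.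
    (.ops [.mov 6 11, .add 5 6 6, .add 5 5 5, .add 5 5 5, .add 5 5 5, .addc 5 5 8, .set 11 32,
      .set 13 0, .set 8 2])
    (.seq (.ops [.inp 14 11])
      (.ifEq 14 2
        (.ops [.addc 11 11 1, .addc 23 23 1])
        -- Register 7 sums up `x + 1` over all names read, hence exceeds each of them.
        (.seq (.ops [.addc 15 11 1, .inp 15 15, .add 7 7 15, .addc 7 7 1, .addc 11 11 2])
          (.ifEq 14 0 (.ops [.dec 23 23]) (.ops [])))))

/-- Start parsing a code. -/
def parseDown : Cmd :=
  .seq (.ops [.inp 14 11, .addc 15 11 1])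
    (.ifEq 14 2
      (.ops [.mov 11 15, .set 14 1, .alloc 13 14 14 14 14 13])
      (.seq (.ops [.inp 15 15, .addc 11 11 2])
        (.ifEq 14 0
          (.ops [.set 16 1, .setT 1 15 16, .alloc 12 14 15 14 14 14, .set 8 3])
          (.ops [.set 14 0, .alloc 13 14 15 14 14 13]))))

/-- Return a parsed code. -/
def parseUp : Cmd :=
  .ifEq 13 0
    (.ops [.mov 1 12, .set 8 4])
    (.seq (.ops [.get 14 13 0, .get 15 13 1])
      (.ifEq 14 0
        (.ops [.getT 1 16 15, .set 14 1, .alloc 12 14 15 12 16 14, .get 13 13 4])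
        (.ifEq 14 1
          (.ops [.get 13 13 4, .set 14 2, .alloc 13 14 12 14 14 13, .set 8 2])
          (.ops [.alloc 12 14 15 12 14 14, .get 13 13 4]))))

/-- Start copying a code. -/
def copyDown : Cmd :=
  .seq (.ops [.get 14 11 0, .get 15 11 1])
    (.ifEq 14 0
      (.seq (.ops [.getT 2 16 15])
        (.ifEq 16 0
          (.ops [.alloc 12 14 15 14 14 14, .set 8 6])
          (.ops [.dec 15 16, .alloc 12 14 15 14 14 14, .set 8 6])))
      (.ifEq 14 1
        -- Once incremented, register 7 is already the table encoding `y + 1` of the new name `y`.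
        -- The previous renaming is saved in the list, to be restored after the body.
        (.ops [.getT 2 16 15, .mov 17 7, .addc 7 7 1, .set 14 0, .alloc 13 14 17 11 16 13,
          .setT 2 15 7, .get 11 11 2])
        (.ops [.get 16 11 2, .set 14 1, .alloc 13 14 16 14 14 13, .mov 11 15])))

/-- Return a copied code. -/
def copyUp : Cmd :=
  .ifEq 13 0
    (.ops [.mov 1 12, .set 0 0, .set 14 0, .setT 2 22 14, .set 8 4])
    (.seq (.ops [.get 14 13 0, .get 15 13 1])
      (.ifEq 14 0
        (.ops [.get 16 13 2, .get 17 16 1, .get 26 13 3, .setT 2 17 26, .get 26 16 3, .set 14 1,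
          .alloc 12 14 15 12 26 14, .get 13 13 4])
        (.ifEq 14 1
          (.ops [.mov 11 15, .get 13 13 4, .set 14 2, .alloc 13 14 12 14 14 13, .set 8 5])
          (.ops [.alloc 12 14 15 12 14 14, .get 13 13 4]))))

/-- Output a label of the Checking AM. -/
def output (l : ℕ) : Cmd := .ops [.set 18 l, .set 8 7]

/-- Add an entry to the environment, with the label output by the Checking AM. -/
def bind : Cmd :=
  .ops [.mov 17 7, .addc 7 7 1, .get 22 19 1, .setT 2 22 7, .get 14 20 0, .alloc 4 17 14 18 4 14,
    .setT 0 17 4, .get 2 20 1, .mov 3 21, .get 11 19 2, .set 13 0, .set 10 0, .set 8 5]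

/-- Evaluate an abstraction. -/
def evalLam : Cmd :=
  .ifEq 2 0
    (.ops [.get 15 1 1, .set 14 0, .alloc 3 14 15 14 3 14, .get 1 1 2])
    (.seq (.ops [.get 16 1 3, .get 15 2 0, .get 26 2 1])
      (.ifEq 16 0
        (.ops [.set 14 2, .alloc 3 14 1 26 3 14, .mov 1 15, .set 2 0])
        (.ifEq 10 1
          (output 3)
          (.seq (.ops [.get 14 15 0])
            (.ifEq 14 0
              (.ops [.get 14 15 1, .addc 14 14 1, .get 22 1 1, .setT 2 22 14, .get 11 1 2,
                .mov 2 26, .set 13 0, .set 8 5])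
              (.ops [.mov 19 1, .mov 20 2, .mov 21 3, .mov 1 15, .set 2 0, .set 3 0,
                .set 10 1]))))))

/-- Replace a variable by a code. -/
def replace : Cmd := .ops [.mov 11 15, .set 13 0, .set 8 5]

/-- Evaluate a variable. -/
def evalVar : Cmd :=
  .seq (.ops [.get 15 1 1, .getT 0 16 15])
    (.ifEq 16 0
      (.ops [.set 0 1])
      (.seq (.ops [.get 17 16 2, .get 15 16 1])
        (.ifEq 17 1
          (.ops [.set 0 1])
          (.ifEq 17 0
            (.ifEq 2 0 (.ops [.set 0 1]) (.ifEq 10 1 (output 4) (.ops [.mov 1 15])))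
            (.ifEq 10 1
              (.ops [.addc 18 17 1, .set 8 7])
              (.ifEq 2 0
                replace
                -- An abstraction in front of an argument is shared instead of copied; its body is
                -- copied only when the redex is fired.
                (.seq (.ops [.get 14 15 0]) (.ifEq 14 1 (.ops [.mov 1 15]) replace))))))))

/-- Evaluate. -/
def eval : Cmd :=
  .seq (.ops [.get 14 1 0])
    (.ifEq 14 0
      evalVar
      (.ifEq 14 1
        evalLam
        (.ops [.get 15 1 2, .alloc 2 15 2 15 15 15, .get 1 1 1])))

/-- Backtrack. -/
def back : Cmd :=
  .ifEq 2 0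
    (.ifEq 3 0
      (.ifEq 10 1
        (.seq (.ops [.get 14 1 0]) (.ifEq 14 2 (output 1) (output 0)))
        (.ops [.set 9 1]))
      (.seq (.ops [.get 14 3 0, .get 15 3 1, .get 16 3 2])
        (.ifEq 14 0
          (.ops [.get 3 3 3, .set 14 1, .alloc 1 14 15 1 14 14])
          (.ifEq 14 1
            (.ops [.get 3 3 3, .mov 2 16, .set 14 2, .alloc 1 14 15 1 14 14])
            (.ifEq 10 1
              (output 3)
              (.ops [.get 3 3 3, .mov 2 16, .get 11 15 2, .set 13 0, .set 8 5]))))))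
    (.ops [.get 15 2 0, .get 26 2 1, .set 14 1, .alloc 3 14 1 26 3 14, .mov 1 15, .set 2 0,
      .set 0 0])

/-- The program, to be iterated. -/
def main : Cmd :=
  .ifEq 8 0 (.ops [.set 11 32, .set 23 1, .set 8 1])
    (.ifEq 8 1 scan
      (.ifEq 8 2 parseDown
        (.ifEq 8 3 parseUp
          (.ifEq 8 4 (.ifEq 0 0 eval back)
            (.ifEq 8 5 copyDown
              (.ifEq 8 6 copyUp bind))))))

theorem main_wf : main.WF := by decide

end Ram

/-! ### Linked data structures -/

section

variable (B n : ℕ) (h : ℕ → ℕ)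

/-- `p` is the address of an allocated block, where `n` is the first free block. -/
def Valid (p : ℕ) : Prop := p % 16 = 8 ∧ 16 * B ≤ p ∧ p + 16 ≤ n

/-- The pointer `p` points to the code `t`, with correct occurrence flags if `fl` holds. -/
inductive HoldsCode (fl : Prop) : ℕ → Code → Prop
  | var {p x : ℕ} : Valid B n p → h p = 0 → h (p + 1) = x → HoldsCode fl p (.var x)
  | lam {p q x : ℕ} {t : Code} : Valid B n p → h p = 1 → h (p + 1) = x → h (p + 2) = q →
      (fl → h (p + 3) = if x ∈ t.fv then 1 else 0) → HoldsCode fl q t →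
      HoldsCode fl p (.lam x t)
  | app {p q r : ℕ} {t u : Code} : Valid B n p → h p = 2 → h (p + 1) = q → h (p + 2) = r →
      HoldsCode fl q t → HoldsCode fl r u → HoldsCode fl p (.app t u)

/-- The pointer `p` points to the stack `π`. -/
inductive HoldsStack : ℕ → Stack → Prop
  | nil : HoldsStack 0 []
  | cons {p q r : ℕ} {t : Code} {π : Stack} : Valid B n p → h p = q → h (p + 1) = r →
      HoldsCode B n h True q t → HoldsStack r π → HoldsStack p (t :: π)

/-- The pointer `p` points to the frame `F`. -/
inductive HoldsFrame : ℕ → Frame → Prop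
  | nil : HoldsFrame 0 []
  | var {p x r : ℕ} {F : Frame} : Valid B n p → h p = 0 → h (p + 1) = x → h (p + 3) = r →
      HoldsFrame r F → HoldsFrame p (.var x :: F)
  | head {p q s r : ℕ} {t : Code} {π : Stack} {F : Frame} : Valid B n p → h p = 1 →
      h (p + 1) = q → h (p + 2) = s → h (p + 3) = r → HoldsCode B n h False q t →
      HoldsStack B n h s π → HoldsFrame r F → HoldsFrame p (.head t π :: F)
  | erasing {p q s r x : ℕ} {t : Code} {π : Stack} {F : Frame} : Valid B n p → h p = 2 →
      h (p + 1) = q → h (p + 2) = s → h (p + 3) = r → HoldsCode B n h True q (.lam x t) →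
      HoldsStack B n h s π → HoldsFrame r F → HoldsFrame p (.erasing x t π :: F)

/-- The pointer `p` points to the entry `e`. -/
structure HoldsEntry (p : ℕ) (e : Entry) : Prop where
  valid : Valid B n p
  name : h p = e.name
  code : HoldsCode B n h True (h (p + 1)) e.code
  label : h (p + 2) = e.label.encode

/-- The pointer `p` points to the environment `E`. -/
inductive HoldsEnv : ℕ → Env → Prop
  | nil : HoldsEnv 0 []
  | cons {p r : ℕ} {e : Entry} {E : Env} : HoldsEntry B n h p e → h (p + 3) = r →
      HoldsEnv r E → HoldsEnv p (e :: E)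

end

/-! ### Linked structures in a heap that only grows. -/

section ext

variable {B n n' : ℕ} {h h' : ℕ → ℕ}

/-- The heap `h'` extends `h`. -/
structure Ext (n : ℕ) (h : ℕ → ℕ) (n' : ℕ) (h' : ℕ → ℕ) : Prop where
  le : n ≤ n'
  eq : ∀ a < n, h' a = h a

theorem Ext.refl (n : ℕ) (h : ℕ → ℕ) : Ext n h n h := ⟨le_rfl, fun _ _ => rfl⟩

theorem Ext.trans {n'' : ℕ} {h'' : ℕ → ℕ} (e : Ext n h n' h') (e' : Ext n' h' n'' h'') :
    Ext n h n'' h'' :=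
  ⟨e.le.trans e'.le, fun a ha => (e'.eq a (ha.trans_le e.le)).trans (e.eq a ha)⟩

theorem Valid.ext (e : Ext n h n' h') {p : ℕ} (hp : Valid B n p) : Valid B n' p :=
  ⟨hp.1, hp.2.1, hp.2.2.trans e.le⟩

theorem Valid.eq (e : Ext n h n' h') {p : ℕ} (hp : Valid B n p) {c : ℕ} (hc : c < 16) :
    h' (p + c) = h (p + c) := e.eq _ (by have := hp.2.2; omega)

theorem HoldsCode.ext (e : Ext n h n' h') {fl : Prop} {p : ℕ} {t : Code}
    (ht : HoldsCode B n h fl p t) : HoldsCode B n' h' fl p t := by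
  induction ht with
  | var h1 h2 h3 =>
    exact .var (h1.ext e) ((h1.eq e (c := 0) (by omega)).trans h2)
      ((h1.eq e (by omega)).trans h3)
  | lam h1 h2 h3 h4 h5 _ ih =>
    exact .lam (h1.ext e) ((h1.eq e (c := 0) (by omega)).trans h2)
      ((h1.eq e (by omega)).trans h3) ((h1.eq e (by omega)).trans h4)
      (fun hf => (h1.eq e (by omega)).trans (h5 hf)) ih
  | app h1 h2 h3 h4 _ _ ih ih' =>
    exact .app (h1.ext e) ((h1.eq e (c := 0) (by omega)).trans h2)
      ((h1.eq e (by omega)).trans h3) ((h1.eq e (by omega)).trans h4) ih ih'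

theorem HoldsCode.mono {fl fl' : Prop} (hf : fl' → fl) {p : ℕ} {t : Code}
    (ht : HoldsCode B n h fl p t) : HoldsCode B n h fl' p t := by
  induction ht with
  | var h1 h2 h3 => exact .var h1 h2 h3
  | lam h1 h2 h3 h4 h5 _ ih => exact .lam h1 h2 h3 h4 (fun h => h5 (hf h)) ih
  | app h1 h2 h3 h4 _ _ ih ih' => exact .app h1 h2 h3 h4 ih ih'

theorem HoldsStack.ext (e : Ext n h n' h') {p : ℕ} {π : Stack} (hπ : HoldsStack B n h p π) :
    HoldsStack B n' h' p π := by
  induction hπ with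
  | nil => exact .nil
  | cons h1 h2 h3 h4 _ ih =>
    exact .cons (h1.ext e) ((h1.eq e (c := 0) (by omega)).trans h2)
      ((h1.eq e (by omega)).trans h3) (h4.ext e) ih

theorem HoldsFrame.ext (e : Ext n h n' h') {p : ℕ} {F : Frame} (hF : HoldsFrame B n h p F) :
    HoldsFrame B n' h' p F := by
  induction hF with
  | nil => exact .nil
  | var h1 h2 h3 h4 _ ih =>
    exact .var (h1.ext e) ((h1.eq e (c := 0) (by omega)).trans h2)
      ((h1.eq e (by omega)).trans h3) ((h1.eq e (by omega)).trans h4) ih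
  | head h1 h2 h3 h4 h5 h6 h7 _ ih =>
    exact .head (h1.ext e) ((h1.eq e (c := 0) (by omega)).trans h2)
      ((h1.eq e (by omega)).trans h3) ((h1.eq e (by omega)).trans h4)
      ((h1.eq e (by omega)).trans h5) (h6.ext e) (h7.ext e) ih
  | erasing h1 h2 h3 h4 h5 h6 h7 _ ih =>
    exact .erasing (h1.ext e) ((h1.eq e (c := 0) (by omega)).trans h2)
      ((h1.eq e (by omega)).trans h3) ((h1.eq e (by omega)).trans h4)
      ((h1.eq e (by omega)).trans h5) (h6.ext e) (h7.ext e) ih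

theorem HoldsEntry.ext (e : Ext n h n' h') {p : ℕ} {d : Entry} (hd : HoldsEntry B n h p d) :
    HoldsEntry B n' h' p d :=
  ⟨hd.1.ext e, (hd.1.eq e (c := 0) (by omega)).trans hd.2,
    hd.1.eq e (c := 1) (by omega) ▸ hd.3.ext e, (hd.1.eq e (by omega)).trans hd.4⟩

theorem HoldsEnv.ext (e : Ext n h n' h') {p : ℕ} {E : Env} (hE : HoldsEnv B n h p E) :
    HoldsEnv B n' h' p E := by
  induction hE with
  | nil => exact .nil
  | cons h1 h2 _ ih => exact .cons (h1.ext e) ((h1.1.eq e (by omega)).trans h2) ih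

end ext

end MaxMAM

namespace MaxMAM

open Term Code Ram

/-! ### Copying codes -/

/-- The renaming in table 2. -/
def Mem.ren (m : Mem) (x : ℕ) : ℕ := if m.tab 2 x = 0 then x else m.tab 2 x - 1

/-- The heap of the machine is ready for allocations. -/
structure Ready (B : ℕ) (m : Mem) : Prop where
  align : m.reg 5 % 16 = 8
  le : 16 * B ≤ m.reg 5
  fin : m.reg 6 = B
  run : m.reg 9 = 0

/-- The copy of `t` is complete. -/
structure Copied (B : ℕ) (m : Mem) (t : Code) (m' : Mem) : Prop where
  ready : Ready B m'
  mode : m'.reg 8 = 6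
  code : HoldsCode B (m'.reg 5) m'.heap True (m'.reg 12) (fresh m.ren t (m.reg 7)).1
  next : m'.reg 7 = (fresh m.ren t (m.reg 7)).2
  list : m'.reg 13 = m.reg 13
  ext : Ext (m.reg 5) m.heap (m'.reg 5) m'.heap
  tab : m'.tab = m.tab
  keep : ∀ r ∈ [0, 1, 2, 3, 4, 10, 22], m'.reg r = m.reg r

/-- The number of iterations needed to copy a code. -/
def copyTime : Code → ℕ
  | .var _ => 1
  | .lam _ t => copyTime t + 1 + 1
  | .app t u => copyTime t + (copyTime u + 1 + 1) + 1

theorem copyTime_le (t : Code) : copyTime t ≤ 3 * t.size := by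
  induction t with
  | var => simp [copyTime, Code.size, Term.size]
  | lam x t ih => simp only [copyTime, Code.size_lam]; omega
  | app t u ih ih' => simp only [copyTime, Code.size_app]; omega

variable {B : ℕ} {inp : ℕ → ℕ}

theorem main_wp_copyDown {m : Mem} {Q : Mem → Prop} (h : m.reg 8 = 5) :
    main.wp B inp Q m ↔ copyDown.wp B inp Q m := by
  simp [main, Cmd.wp, h]

theorem main_wp_copyUp {m : Mem} {Q : Mem → Prop} (h : m.reg 8 = 6) :
    main.wp B inp Q m ↔ copyUp.wp B inp Q m := by
  simp [main, Cmd.wp, h]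

/-- The conditions for using the first free block. -/
theorem Ready.alloc {m : Mem} (h : Ready B m) : m.reg 5 % 16 = 8 ∧ 16 * B ≤ m.reg 5 := ⟨h.1, h.2⟩

theorem Valid.get {n p : ℕ} (h : Valid B n p) : p % 16 = 8 ∧ 16 * B ≤ p := ⟨h.1, h.2.1⟩

theorem Valid.ne {n p : ℕ} (h : Valid B n p) : p ≠ 0 := by have := h.1; omega

theorem Ready.valid {m : Mem} (h : Ready B m) : Valid B (m.reg 5 + 16) (m.reg 5) :=
  ⟨h.1, h.2, le_rfl⟩

theorem Ready.ext {m : Mem} {h : ℕ → ℕ} (e : ∀ x < m.reg 5, h x = m.heap x) :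
    Ext (m.reg 5) m.heap (m.reg 5 + 16) h := ⟨by omega, e⟩

/-- The recursion of `fresh` is unrolled with the explicit list in register 13. When a subcode is
done, mode 6 finds that list and the renaming table as they were, which is what the induction on the
code needs. -/
theorem copy_code (t : Code) : ∀ m : Mem, Ready B m → m.reg 8 = 5 →
    HoldsCode B (m.reg 5) m.heap True (m.reg 11) t → (∀ y ∈ t.fv, m.ren y < m.reg 7) →
    main.Its B inp (copyTime t) (Copied B m t) m := by
  induction t with
  | var x =>
    rintro m hm h8 (⟨hv, h0, h1⟩ | _ | _) hx
    refine ⟨hm.run, (main_wp_copyDown h8).2 ?_⟩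
    simp [copyDown, Cmd.wp, Op.wps, Op.wp, hv.get, h0, h1, hm.fin, hm.alloc]
    split_ifs with hr
    all_goals
      intro h e e0 e1 _ _ _
      refine ⟨⟨?_, ?_, ?_, ?_⟩, ?_, .var ?_ ?_ ?_, ?_, ?_, ?_, ?_, ?_⟩ <;>
        simp [fresh, hm.fin, hm.run, hm.align, e0, e1, Mem.ren, hr, hm.valid, Ready.ext e]
      have := hm.le
      omega
  | lam x t ih =>
    rintro m hm h8 (_ | @⟨p, q, _, _, hv, h0, h1, h2, h3, ht⟩ | _) hx
    refine ⟨hm.run, (main_wp_copyDown h8).2 ?_⟩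
    simp [copyDown, Cmd.wp, Op.wps, Op.wp, hv.get, h0, h1, hm.fin, hm.alloc]
    intro h e e0 e1 e2 e3 e4
    have e' := Ready.ext e
    rw [hv.eq e' (by omega), h2]
    have hle := hm.le
    have hren : ∀ m1 : Mem, (∀ y, m1.tab 2 y = if y = x then m.reg 7 + 1 else m.tab 2 y) →
        m1.ren = Function.update m.ren x (m.reg 7) := by
      intro m1 h1
      funext y
      simp only [Mem.ren, h1, Function.update_apply]
      split_ifs <;> simp_all
    have hlt : ∀ y ∈ t.fv, Function.update m.ren x (m.reg 7) y < m.reg 7 + 1 := by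
      intro y hy
      by_cases hyx : y = x
      · simp [hyx]
      · rw [Function.update_of_ne hyx]
        exact (hx y (by simp [Code.fv, hy, hyx])).trans (Nat.lt_succ_self _)
    rw [Cmd.its_add]
    refine (ih _ ⟨?_, ?_, ?_, ?_⟩ ?_ ?_ ?_).mono fun m2 C => ⟨C.ready.run, ?_⟩
    · simp [hm.align]
    · simp; omega
    · simp [hm.fin]
    · simp [hm.run]
    · simp [h8]
    · simpa using ht.ext e'
    · rw [hren _ (by simp)]
      simpa using hlt
    obtain ⟨hm2, h82, hc, hn, hl, hext, htab, hkeep⟩ := C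
    rw [hren _ (by simp)] at hc hn
    simp at hc hn hl hext htab hkeep
    rw [main_wp_copyUp h82]
    have hp : Valid B (m2.reg 5) (m.reg 5) := (hm.valid).ext hext
    have hv2 : Valid B (m2.reg 5) (m.reg 11) := (hv.ext e').ext hext
    have g0 := (hm.valid.eq hext (c := 0) (by omega)).trans e0
    have g1 := (hm.valid.eq hext (c := 1) (by omega)).trans e1
    have g2 := (hm.valid.eq hext (c := 2) (by omega)).trans e2
    have g3 := (hm.valid.eq hext (c := 3) (by omega)).trans e3
    have g4 := (hm.valid.eq hext (c := 4) (by omega)).trans e4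
    have k1 := ((hv.ext e').eq hext (c := 1) (by omega)).trans ((hv.eq e' (by omega)).trans h1)
    have k3 := ((hv.ext e').eq hext (c := 3) (by omega)).trans
      ((hv.eq e' (by omega)).trans (h3 trivial))
    rw [Nat.add_zero] at g0
    have hp0 : m.reg 5 ≠ 0 := hm.valid.ne
    simp [copyUp, Cmd.wp, Op.wps, Op.wp, hl, hp0, hp.get, hv2.get, g0, g1, g2, g3, k1, k3, hm2.fin,
      hm2.alloc]
    intro h' d d0 d1 d2 d3 d4
    have d' := Ready.ext d
    have k4 := (hp.eq d' (by omega)).trans g4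
    have hle2 := hm2.le
    -- The occurrence flag is copied from the original abstraction. This is correct because the new
    -- name lies above the images of all other free names, so only `x` is mapped to it.
    have hfl : m.reg 7 ∈ (fresh (Function.update m.ren x (m.reg 7)) t (m.reg 7 + 1)).1.fv ↔
        x ∈ t.fv := by
      rw [Code.mem_fv, Code.mem_fv, toTerm_fresh hlt, occurs_rename]
      constructor
      · rintro ⟨y, hy, hy'⟩
        by_cases hyx : y = x
        · exact hyx ▸ hy
        · rw [Function.update_of_ne hyx] at hy'
          have := hx y (by simp [Code.fv, hyx, Code.mem_fv, hy])
          omega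
      · exact fun h => ⟨x, h, by simp⟩
    refine ⟨⟨?_, ?_, ?_, ?_⟩, ?_, .lam (q := m2.reg 12) ?_ ?_ ?_ ?_ (fun _ => ?_) ?_,
      ?_, ?_, ?_, ?_, ?_⟩
    · simp [hm2.align]
    · simp; omega
    · simp [hm2.fin]
    · simp [hm2.run]
    · simp [h82]
    · simpa using hm2.valid
    · simp [d0]
    · simp [d1]
    · simp [d2]
    · simp [d3, hfl]
    · simpa using hc.ext d'
    · simp [hn, fresh]
    · simp [k4]
    · simpa using (e'.trans hext).trans d'
    · funext k y
      simp only [htab, Mem.tab_setTab, Mem.tab_set]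
      split_ifs <;> simp_all
    · simp [hkeep]
  | app t u ih ih' =>
    rintro m hm h8 (_ | _ | @⟨p, q, r, _, _, hv, h0, h1, h2, ht, hu⟩) hx
    refine ⟨hm.run, (main_wp_copyDown h8).2 ?_⟩
    have hren : ∀ m1 : Mem, m1.tab = m.tab → m1.ren = m.ren := fun m1 h => by
      funext y; simp only [Mem.ren, h]
    simp [copyDown, Cmd.wp, Op.wps, Op.wp, hv.get, h0, h1, h2, hm.alloc]
    intro h e e0 e1 e2 e3 e4
    have e' := Ready.ext e
    have hle := hm.le
    rw [Cmd.its_add]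
    refine (ih _ ⟨?_, ?_, ?_, ?_⟩ ?_ ?_ ?_).mono fun m2 C => ⟨C.ready.run, ?_⟩
    · simp [hm.align]
    · simp; omega
    · simp [hm.fin]
    · simp [hm.run]
    · simp [h8]
    · simpa using ht.ext e'
    · intro y hy
      rw [hren _ (by simp)]
      simpa using hx y (by simp [Code.fv, hy])
    obtain ⟨hm2, h82, hc, hn, hl, hext, htab, hkeep⟩ := C
    rw [hren _ (by rfl)] at hc hn
    simp at hc hn hl hext htab hkeep
    rw [main_wp_copyUp h82]
    have hp : Valid B (m2.reg 5) (m.reg 5) := (hm.valid).ext hext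
    have g0 := (hm.valid.eq hext (c := 0) (by omega)).trans e0
    have g1 := (hm.valid.eq hext (c := 1) (by omega)).trans e1
    have g4 := (hm.valid.eq hext (c := 4) (by omega)).trans e4
    rw [Nat.add_zero] at g0
    have hp0 : m.reg 5 ≠ 0 := hm.valid.ne
    simp [copyUp, Cmd.wp, Op.wps, Op.wp, hl, hp0, hp.get, g0, g1, g4, hm2.alloc]
    intro h' d d0 d1 d2 d3 d4
    have d' := Ready.ext d
    have hle2 := hm2.le
    rw [Cmd.its_add]
    refine (ih' _ ⟨?_, ?_, ?_, ?_⟩ ?_ ?_ ?_).mono fun m3 C => ⟨C.ready.run, ?_⟩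
    · simp [hm2.align]
    · simp; omega
    · simp [hm2.fin]
    · simp [hm2.run]
    · simp
    · simpa using ((hu.ext e').ext hext).ext d'
    · intro y hy
      rw [hren _ (by simp [htab])]
      simp only [Mem.reg_set]
      simp [hn]
      exact (hx y (by simp [Code.fv, hy])).trans_le (le_fresh _ _ _)
    obtain ⟨hm3, h83, hc3, hn3, hl3, hext3, htab3, hkeep3⟩ := C
    rw [hren _ (by simp [htab])] at hc3 hn3
    simp at hc3 hn3 hl3 hext3 htab3 hkeep3
    rw [main_wp_copyUp h83]
    have hp3 : Valid B (m3.reg 5) (m2.reg 5) := (hm2.valid).ext hext3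
    have f0 := (hm2.valid.eq hext3 (c := 0) (by omega)).trans d0
    have f1 := (hm2.valid.eq hext3 (c := 1) (by omega)).trans d1
    have f4 := (hm2.valid.eq hext3 (c := 4) (by omega)).trans d4
    rw [Nat.add_zero] at f0
    have hp30 : m2.reg 5 ≠ 0 := hm2.valid.ne
    simp [copyUp, Cmd.wp, Op.wps, Op.wp, hl3, hp30, hp3.get, f0, f1, hm3.alloc]
    intro h3 c c0 c1 c2 c3 c4
    have c' := Ready.ext c
    have k4 := (hp3.eq c' (by omega)).trans f4
    have hle3 := hm3.le
    refine ⟨⟨?_, ?_, ?_, ?_⟩, ?_, .app (q := m2.reg 12) (r := m3.reg 12) ?_ ?_ ?_ ?_ ?_ ?_,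
      ?_, ?_, ?_, ?_, ?_⟩
    · simp [hm3.align]
    · simp; omega
    · simp [hm3.fin]
    · simp [hm3.run]
    · simp [h83]
    · simpa using hm3.valid
    · simp [c0]
    · simp [c1]
    · simp [c2]
    · simpa using ((hc.ext d').ext hext3).ext c'
    · rw [← hn]
      simpa using hc3.ext c'
    · simp [hn3, hn, fresh]
    · simp [k4]
    · simpa using (((e'.trans hext).trans d').trans hext3).trans c'
    · simp [htab3, htab]
    · simp [hkeep3, hkeep]

end MaxMAM

namespace MaxMAM

open Term Code Ram

/-! ### Representation of states -/

/-- The names in a state. -/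
def State.Mentions (q : State) (y : ℕ) : Prop :=
  y ∈ q.code.names ∨ Stack.Mentions q.stack y ∨ (∃ φ ∈ q.frame, φ.Mentions y) ∨
    Env.Mentions q.env y

theorem Stack.mentions_nil (y : ℕ) : ¬ Stack.Mentions [] y := by simp [Stack.Mentions]

theorem Stack.mentions_cons {u : Code} {π : Stack} {y : ℕ} :
    Stack.Mentions (u :: π) y ↔ y ∈ u.names ∨ Stack.Mentions π y := by simp [Stack.Mentions]

theorem Item.mentions_var {x y : ℕ} : (Item.var x).Mentions y ↔ y = x := Iff.rfl

theorem Item.mentions_head {t : Code} {π : Stack} {y : ℕ} :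
    (Item.head t π).Mentions y ↔ y ∈ t.names ∨ Stack.Mentions π y := Iff.rfl

theorem Item.mentions_erasing {x y : ℕ} {t : Code} {π : Stack} :
    (Item.erasing x t π).Mentions y ↔ y = x ∨ y ∈ t.names ∨ Stack.Mentions π y := Iff.rfl

theorem CommStep.mentions {τ : Trans} {q q' : State} (h : CommStep τ q q') {y : ℕ}
    (hy : q'.Mentions y) : q.Mentions y := by
  cases h <;>
    simp only [State.Mentions, Stack.mentions_cons, Stack.mentions_nil, List.mem_cons,
      exists_eq_or_imp, Item.mentions_var, Item.mentions_head, Item.mentions_erasing,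
      Code.names, Finset.mem_union, Finset.mem_insert] at hy ⊢ <;>
    grind

section inversion

variable {B n p x : ℕ} {h : ℕ → ℕ} {fl : Prop} {t u : Code} {π : Stack} {F : Frame}

theorem holdsCode_var : HoldsCode B n h fl p (.var x) ↔
    Valid B n p ∧ h p = 0 ∧ h (p + 1) = x :=
  ⟨fun | .var h1 h2 h3 => ⟨h1, h2, h3⟩, fun ⟨h1, h2, h3⟩ => .var h1 h2 h3⟩

theorem holdsCode_lam : HoldsCode B n h fl p (.lam x t) ↔
    Valid B n p ∧ h p = 1 ∧ h (p + 1) = x ∧ (fl → h (p + 3) = if x ∈ t.fv then 1 else 0) ∧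
      HoldsCode B n h fl (h (p + 2)) t :=
  ⟨fun | .lam h1 h2 h3 h4 h5 h6 => ⟨h1, h2, h3, h5, h4 ▸ h6⟩,
    fun ⟨h1, h2, h3, h4, h5⟩ => .lam h1 h2 h3 rfl h4 h5⟩

theorem holdsCode_app : HoldsCode B n h fl p (.app t u) ↔
    Valid B n p ∧ h p = 2 ∧ HoldsCode B n h fl (h (p + 1)) t ∧ HoldsCode B n h fl (h (p + 2)) u :=
  ⟨fun | .app h1 h2 h3 h4 h5 h6 => ⟨h1, h2, h3 ▸ h5, h4 ▸ h6⟩,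
    fun ⟨h1, h2, h3, h4⟩ => .app h1 h2 rfl rfl h3 h4⟩

theorem HoldsCode.valid (ht : HoldsCode B n h fl p t) : Valid B n p := by cases ht <;> assumption

theorem holdsStack_nil : HoldsStack B n h p [] ↔ p = 0 :=
  ⟨fun | .nil => rfl, fun h => h ▸ .nil⟩

theorem holdsStack_cons : HoldsStack B n h p (t :: π) ↔
    Valid B n p ∧ HoldsCode B n h True (h p) t ∧ HoldsStack B n h (h (p + 1)) π :=
  ⟨fun | .cons h1 h2 h3 h4 h5 => ⟨h1, h2 ▸ h4, h3 ▸ h5⟩,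
    fun ⟨h1, h2, h3⟩ => .cons h1 rfl rfl h2 h3⟩

theorem HoldsStack.eq_zero_iff (hπ : HoldsStack B n h p π) : p = 0 ↔ π = [] := by
  cases hπ with
  | nil => simp
  | cons h => simp [h.ne]

theorem holdsFrame_nil : HoldsFrame B n h p [] ↔ p = 0 :=
  ⟨fun | .nil => rfl, fun h => h ▸ .nil⟩

theorem holdsFrame_var : HoldsFrame B n h p (.var x :: F) ↔
    Valid B n p ∧ h p = 0 ∧ h (p + 1) = x ∧ HoldsFrame B n h (h (p + 3)) F :=
  ⟨fun | .var h1 h2 h3 h4 h5 => ⟨h1, h2, h3, h4 ▸ h5⟩,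
    fun ⟨h1, h2, h3, h4⟩ => .var h1 h2 h3 rfl h4⟩

theorem holdsFrame_head : HoldsFrame B n h p (.head t π :: F) ↔
    Valid B n p ∧ h p = 1 ∧ HoldsCode B n h False (h (p + 1)) t ∧
      HoldsStack B n h (h (p + 2)) π ∧ HoldsFrame B n h (h (p + 3)) F :=
  ⟨fun | .head h1 h2 h3 h4 h5 h6 h7 h8 => ⟨h1, h2, h3 ▸ h6, h4 ▸ h7, h5 ▸ h8⟩,
    fun ⟨h1, h2, h3, h4, h5⟩ => .head h1 h2 rfl rfl rfl h3 h4 h5⟩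

theorem holdsFrame_erasing : HoldsFrame B n h p (.erasing x t π :: F) ↔
    Valid B n p ∧ h p = 2 ∧ HoldsCode B n h True (h (p + 1)) (.lam x t) ∧
      HoldsStack B n h (h (p + 2)) π ∧ HoldsFrame B n h (h (p + 3)) F :=
  ⟨fun | .erasing h1 h2 h3 h4 h5 h6 h7 h8 => ⟨h1, h2, h3 ▸ h6, h4 ▸ h7, h5 ▸ h8⟩,
    fun ⟨h1, h2, h3, h4, h5⟩ => .erasing h1 h2 rfl rfl rfl h3 h4 h5⟩

end inversion

/-- The environment `E` and its table are in the memory. -/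
structure HoldsGlobal (B : ℕ) (m : Mem) (E : Env) : Prop where
  env : HoldsEnv B (m.reg 5) m.heap (m.reg 4) E
  table : ∀ x, (E.lookup x = none ∧ m.tab 0 x = 0) ∨
    ∃ e, E.lookup x = some e ∧ HoldsEntry B (m.reg 5) m.heap (m.tab 0 x) e

/-- The memory holds the state `q`. -/
structure Holds (B : ℕ) (m : Mem) (q : State) : Prop where
  ready : Ready B m
  mode : m.reg 8 = 4
  phase : m.reg 0 = q.phase.encode
  code : HoldsCode B (m.reg 5) m.heap (q.phase = .eval) (m.reg 1) q.code
  stack : HoldsStack B (m.reg 5) m.heap (m.reg 2) q.stack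
  frame : HoldsFrame B (m.reg 5) m.heap (m.reg 3) q.frame
  global : HoldsGlobal B m q.env
  ren : ∀ x, m.tab 2 x = 0
  names : ∀ y, q.Mentions y → y < m.reg 7

/-- The part of the memory that commutative transitions preserve. -/
structure Keep (m m' : Mem) : Prop where
  ext : Ext (m.reg 5) m.heap (m'.reg 5) m'.heap
  align : m'.reg 5 % 16 = m.reg 5 % 16
  tab : m'.tab = m.tab
  reg : ∀ r ∈ [4, 6, 7, 9, 10, 19, 20, 21], m'.reg r = m.reg r

variable {B : ℕ} {inp : ℕ → ℕ} {m m' m'' : Mem} {q q' : State}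

theorem Keep.refl (m : Mem) : Keep m m := ⟨.refl _ _, rfl, rfl, fun _ _ => rfl⟩

theorem Keep.trans (h : Keep m m') (h' : Keep m' m'') : Keep m m'' :=
  ⟨h.ext.trans h'.ext, h'.align.trans h.align, h'.tab.trans h.tab,
    fun r hr => (h'.reg r hr).trans (h.reg r hr)⟩

theorem Ready.keep (h : Ready B m) (k : Keep m m') : Ready B m' :=
  ⟨k.align.trans h.align, h.le.trans k.ext.le, (k.reg 6 (by simp)).trans h.fin,
    (k.reg 9 (by simp)).trans h.run⟩

theorem HoldsGlobal.ext {E : Env} (h : HoldsGlobal B m E)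
    (e : Ext (m.reg 5) m.heap (m'.reg 5) m'.heap) (ht : m'.tab 0 = m.tab 0)
    (h4 : m'.reg 4 = m.reg 4) : HoldsGlobal B m' E := by
  refine ⟨h4 ▸ h.env.ext e, fun x => ?_⟩
  rw [ht]
  exact (h.table x).imp_right fun ⟨d, h1, h2⟩ => ⟨d, h1, h2.ext e⟩

theorem Holds.next (h : Holds B m q) (k : Keep m m') (hE : q'.env = q.env)
    (h8 : m'.reg 8 = 4) (hp : m'.reg 0 = q'.phase.encode)
    (hc : HoldsCode B (m'.reg 5) m'.heap (q'.phase = .eval) (m'.reg 1) q'.code)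
    (hπ : HoldsStack B (m'.reg 5) m'.heap (m'.reg 2) q'.stack)
    (hF : HoldsFrame B (m'.reg 5) m'.heap (m'.reg 3) q'.frame)
    (hm : ∀ y, q'.Mentions y → q.Mentions y) : Holds B m' q' ∧ Keep m m' :=
  ⟨⟨h.ready.keep k, h8, hp, hc, hπ, hF,
    hE ▸ h.global.ext k.ext (congrFun k.tab 0) (k.reg 4 (by simp)), fun x => k.tab ▸ h.ren x,
    fun y hy => (k.reg 7 (by simp)).symm ▸ h.names y (hm y hy)⟩, k⟩

theorem Holds.wp_eval {Q : Mem → Prop} (h : Holds B m q) (hq : q.phase = .eval)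
    (hQ : eval.wp B inp Q m) : main.wp B inp Q m := by
  simpa [main, Cmd.wp, h.mode, h.phase, hq, Phase.encode] using hQ

theorem Holds.wp_back {Q : Mem → Prop} (h : Holds B m q) (hq : q.phase = .back)
    (hQ : back.wp B inp Q m) : main.wp B inp Q m := by
  simpa [main, Cmd.wp, h.mode, h.phase, hq, Phase.encode] using hQ

theorem CommStep.wp {τ : Trans} (hs : CommStep τ q q') (H : Holds B m q) :
    main.wp B inp (fun m' => Holds B m' q' ∧ Keep m m') m := by
  have hmen := fun y => hs.mentions (y := y)
  have hal := H.ready.alloc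
  have hnv := H.ready.valid
  have h8 := H.mode
  cases hs with
  | c1 F t u π E =>
    refine H.wp_eval rfl ?_
    obtain ⟨hv, h0, h1, h2⟩ := holdsCode_app.1 H.code
    simp [eval, Cmd.wp, Op.wps, Op.wp, hv.get, h0, hal]
    intro h e e0 e1 _ _ _
    have e' := Ready.ext e
    have k := hv.eq e' (c := 1) (by omega)
    refine H.next ⟨by simpa using e', by simp, by simp, by simp⟩ rfl ?_ ?_ ?_ ?_ ?_ hmen
    · simp [h8]
    · simp [H.phase]
    · simpa [k] using h1.ext e'
    · exact .cons (by simpa using hnv) rfl rfl (by simpa [e0] using (h2.mono (by simp)).ext e')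
        (by simpa [e1] using H.stack.ext e')
    · simpa using H.frame.ext e'
  | c2 F x t E =>
    refine H.wp_eval rfl ?_
    obtain ⟨hv, h0, h1, hf, h2⟩ := holdsCode_lam.1 H.code
    have hz := holdsStack_nil.1 H.stack
    simp [eval, evalLam, Cmd.wp, Op.wps, Op.wp, hv.get, h0, hal, hz, h1]
    intro h e e0 e1 _ e3 _
    have e' := Ready.ext e
    have k := hv.eq e' (c := 2) (by omega)
    refine H.next ⟨by simpa using e', by simp, by simp, by simp⟩ rfl ?_ ?_ ?_ ?_ ?_ hmen
    · simp [h8]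
    · simp [H.phase]
    · simpa [k] using h2.ext e'
    · simp [hz, holdsStack_nil]
    · exact .var (by simpa using hnv) (by simp [e0]) (by simp [e1]) rfl
        (by simpa [e3] using H.frame.ext e')
  | c3 F x π E hu =>
    refine H.wp_eval rfl ?_
    obtain ⟨hv, h0, h1⟩ := holdsCode_var.1 H.code
    have fin : ∀ m' : Mem, (∀ r, r ≠ 0 → r < 14 ∨ 17 < r → m'.reg r = m.reg r) →
        m'.reg 0 = 1 → m'.heap = m.heap → m'.tab = m.tab →
        Holds B m' ⟨.back, F, .var x, π, E⟩ ∧ Keep m m' := by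
      intro m' h1 h2 h3 h4
      have h5 := h1 5 (by omega) (by omega)
      have K : Keep m m' := ⟨by rw [h5, h3]; exact .refl _ _, by rw [h5], h4, by simp [h1]⟩
      refine H.next K rfl ?_ h2 ?_ ?_ ?_ hmen
      · simp [h1, h8]
      · rw [h5, h3, h1 1 (by omega) (by omega)]
        exact H.code.mono (by simp)
      · rw [h5, h3, h1 2 (by omega) (by omega)]
        exact H.stack
      · rw [h5, h3, h1 3 (by omega) (by omega)]
        exact H.frame
    simp [eval, evalVar, Cmd.wp, Op.wps, Op.wp, hv.get, h0, H.ready.fin, h1]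
    rcases hu with hu | ⟨e, he, hl⟩
    · rcases H.global.table x with ⟨-, ht⟩ | ⟨d, hd, -⟩
      · rw [if_pos ht]
        refine fin _ ?_ ?_ ?_ ?_ <;> simp <;>
            (intro r; intros; repeat rw [if_neg (by omega)])
      · simp only at hd; simp [hu] at hd
    · rcases H.global.table x with ⟨hd, ht⟩ | ⟨d, hd, ht⟩
      · simp only at hd; simp [he] at hd
      · simp only at hd
        obtain rfl : e = d := Option.some.inj (he.symm.trans hd)
        rw [if_neg ht.valid.ne, ht.label]
        refine ⟨ht.valid.get, ?_⟩
        rcases hl with hl | ⟨hl, rfl⟩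
        · simp [hl, Label.encode]
          refine fin _ ?_ ?_ ?_ ?_ <;> simp <;>
            (intro r; intros; repeat rw [if_neg (by omega)])
        · have hz := holdsStack_nil.1 H.stack
          simp [hl, Label.encode, hz]
          refine fin _ ?_ ?_ ?_ ?_ <;> simp <;>
            (intro r; intros; repeat rw [if_neg (by omega)])
  | c4 F x t E =>
    refine H.wp_back rfl ?_
    obtain ⟨hv, h0, h1, h3⟩ := holdsFrame_var.1 H.frame
    have hz := holdsStack_nil.1 H.stack
    simp [back, Cmd.wp, Op.wps, Op.wp, hv.get, h0, hal, hz, h1, hv.ne]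
    intro h e e0 e1 e2 _ _
    have e' := Ready.ext e
    refine H.next ⟨by simpa using e', by simp, by simp, by simp⟩ rfl ?_ ?_ ?_ ?_ ?_ hmen
    · simp [h8]
    · simp [H.phase]
    · exact .lam (by simpa using hnv) (by simp [e0]) (by simp [e1]) rfl (by simp)
        (by simpa [e2] using H.code.ext e')
    · simp [hz, holdsStack_nil]
    · simpa using h3.ext e'
  | c5 F t u π E =>
    refine H.wp_back rfl ?_
    obtain ⟨hv, h0, h1, h2, h3⟩ := holdsFrame_head.1 H.frame
    have hz := holdsStack_nil.1 H.stack
    simp [back, Cmd.wp, Op.wps, Op.wp, hv.get, h0, hal, hz, hv.ne]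
    intro h e e0 e1 e2 _ _
    have e' := Ready.ext e
    refine H.next ⟨by simpa using e', by simp, by simp, by simp⟩ rfl ?_ ?_ ?_ ?_ ?_ hmen
    · simp [h8]
    · simp [H.phase]
    · exact .app (by simpa using hnv) (by simp [e0]) rfl rfl
        (by simpa [e1] using (h1.mono (by simp)).ext e') (by simpa [e2] using H.code.ext e')
    · simpa using h2.ext e'
    · simpa using h3.ext e'
  | c6 F t u π E =>
    refine H.wp_back rfl ?_
    obtain ⟨hv, h1, h2⟩ := holdsStack_cons.1 H.stack
    simp [back, Cmd.wp, Op.wps, Op.wp, hv.get, hal, hv.ne]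
    intro h e e0 e1 e2 e3 _
    have e' := Ready.ext e
    refine H.next ⟨by simpa using e', by simp, by simp, by simp⟩ rfl ?_ ?_ ?_ ?_ ?_ hmen
    · simp [h8]
    · simp [Phase.encode]
    · simpa using h1.ext e'
    · simp [holdsStack_nil]
    · exact .head (by simpa using hnv) (by simp [e0]) rfl rfl rfl
        (by simpa [e1] using (H.code.mono (by simp)).ext e') (by simpa [e2] using h2.ext e')
        (by simpa [e3] using H.frame.ext e')
  | c7 F x t u π E hx =>
    refine H.wp_eval rfl ?_
    obtain ⟨hv, h0, h1, hf, h2⟩ := holdsCode_lam.1 H.code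
    obtain ⟨hv', h1', h2'⟩ := holdsStack_cons.1 H.stack
    simp only [hx, if_false, true_implies] at hf
    simp [eval, evalLam, Cmd.wp, Op.wps, Op.wp, hv.get, h0, hal, hv'.get, hv'.ne, hf]
    intro h e e0 e1 e2 e3 _
    have e' := Ready.ext e
    refine H.next ⟨by simpa using e', by simp, by simp, by simp⟩ rfl ?_ ?_ ?_ ?_ ?_ hmen
    · simp [h8]
    · simp [H.phase]
    · simpa using h1'.ext e'
    · simp [holdsStack_nil]
    · exact .erasing (by simpa using hnv) (by simp [e0]) rfl rfl rfl
        (by simpa [e1] using (H.code.mono (by simp)).ext e') (by simpa [e2] using h2'.ext e')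
        (by simpa [e3] using H.frame.ext e')

end MaxMAM

namespace MaxMAM

open Term Code Ram

variable {B : ℕ} {inp : ℕ → ℕ} {m m' : Mem} {q q' : State}

/-! ### The Checking AM -/

theorem HoldsGlobal.lookup {E : Env} (h : HoldsGlobal B m E) {x : ℕ} {e : Entry}
    (he : E.lookup x = some e) : HoldsEntry B (m.reg 5) m.heap (m.tab 0 x) e := by
  rcases h.table x with ⟨h1, -⟩ | ⟨d, h1, h2⟩
  · simp [he] at h1
  · obtain rfl : e = d := Option.some.inj (he.symm.trans h1)
    exact h2

theorem Keep.of_reg (hr : ∀ r ∈ [4, 5, 6, 7, 9, 10, 19, 20, 21], m'.reg r = m.reg r)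
    (hh : m'.heap = m.heap) (ht : m'.tab = m.tab) : Keep m m' := by
  have h5 := hr 5 (by simp)
  exact ⟨by rw [h5, hh]; exact .refl _ _, by rw [h5], ht, fun r h => hr r (by simp at h ⊢; tauto)⟩

/-- The Checking AM runs on the code for commutative transitions, one iteration each, so its time is
bounded by the initial weight. `Keep` preserves the environment, the tables and the saved state of
the interrupted machine. -/
theorem comm_path {s : State}
    (h : Relation.ReflTransGen (fun s₁ s₂ => ∃ τ, CommStep τ s₁ s₂) q s) :
    ∃ n, n + s.weight ≤ q.weight ∧ ∀ m, Holds B m q →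
      main.Its B inp n (fun m' => Holds B m' s ∧ Keep m m') m := by
  induction h using Relation.ReflTransGen.head_induction_on with
  | refl => exact ⟨0, by simp, fun m hm => ⟨hm, .refl m⟩⟩
  | head h _ ih =>
    obtain ⟨τ, h⟩ := h
    obtain ⟨n, hn, ih⟩ := ih
    refine ⟨n + 1, by have := h.weight; omega, fun m hm => ⟨hm.ready.run, ?_⟩⟩
    exact Cmd.wp_mono (fun m' h' => (ih m' h'.1).mono fun m'' h'' => ⟨h''.1, h'.2.trans h''.2⟩)
      (h.wp hm)

theorem CheckOutput.wp {s : State} {l : Label} (h : CheckOutput s l) (H : Holds B m s)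
    (h10 : m.reg 10 = 1) :
    main.wp B inp (fun m' => m'.reg 18 = l.encode ∧ m'.reg 8 = 7 ∧ Keep m m') m := by
  cases h with
  | o1 F x t u π E hx =>
    refine H.wp_eval rfl ?_
    obtain ⟨hv, h0, h1, hf, h2⟩ := holdsCode_lam.1 H.code
    obtain ⟨hv', h1', h2'⟩ := holdsStack_cons.1 H.stack
    simp only [hx, if_true, true_implies] at hf
    simp [eval, evalLam, output, Cmd.wp, Op.wps, Op.wp, hv.get, h0, hv'.get, hv'.ne, hf, h10]
    exact ⟨by simp [Label.encode], .of_reg (by simp) rfl rfl⟩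
  | o2 F x π E e n he hl =>
    refine H.wp_eval rfl ?_
    obtain ⟨hv, h0, h1⟩ := holdsCode_var.1 H.code
    have ht := H.global.lookup he
    have hl' := ht.label
    rw [hl, Label.encode] at hl'
    simp [eval, evalVar, Cmd.wp, Op.wps, Op.wp, hv.get, h0, h1, H.ready.fin, ht.valid.ne,
      ht.valid.get, hl', h10]
    exact ⟨by simp [Label.encode], .of_reg (by simp) rfl rfl⟩
  | o3 F x u π E e he hl =>
    refine H.wp_eval rfl ?_
    obtain ⟨hv, h0, h1⟩ := holdsCode_var.1 H.code
    obtain ⟨hv', h1', h2'⟩ := holdsStack_cons.1 H.stack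
    have ht := H.global.lookup he
    have hl' := ht.label
    rw [hl, Label.encode] at hl'
    simp [eval, evalVar, output, Cmd.wp, Op.wps, Op.wp, hv.get, h0, h1, H.ready.fin, ht.valid.ne,
      ht.valid.get, hl', h10, hv'.ne]
    exact ⟨by simp [Label.encode], .of_reg (by simp) rfl rfl⟩
  | o4 t u E =>
    refine H.wp_back rfl ?_
    obtain ⟨hv, h0, -⟩ := holdsCode_app.1 H.code
    have hz := holdsStack_nil.1 H.stack
    have hz' := holdsFrame_nil.1 H.frame
    simp [back, output, Cmd.wp, Op.wps, Op.wp, hz, hz', h10, hv.get, h0]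
    exact ⟨by simp [Label.encode], .of_reg (by simp) rfl rfl⟩
  | o5 x t E =>
    refine H.wp_back rfl ?_
    obtain ⟨hv, h0, -⟩ := holdsCode_lam.1 H.code
    have hz := holdsStack_nil.1 H.stack
    have hz' := holdsFrame_nil.1 H.frame
    simp [back, output, Cmd.wp, Op.wps, Op.wp, hz, hz', h10, hv.get, h0]
    exact ⟨by simp [Label.encode], .of_reg (by simp) rfl rfl⟩
  | o6 F x t u π E =>
    refine H.wp_back rfl ?_
    obtain ⟨hv, h0, -⟩ := holdsFrame_erasing.1 H.frame
    have hz := holdsStack_nil.1 H.stack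
    simp [back, output, Cmd.wp, Op.wps, Op.wp, hz, hv.ne, h10, hv.get, h0]
    exact ⟨by simp [Label.encode], .of_reg (by simp) rfl rfl⟩

/-! ### Transitions that copy a code -/

/-- The memory is ready to copy the code `t`, in order to reach a state with frame `F`, stack `π`
and environment `E`. -/
structure Copying (B : ℕ) (m : Mem) (F : Frame) (t : Code) (π : Stack) (E : Env) : Prop where
  ready : Ready B m
  mode : m.reg 8 = 5
  list : m.reg 13 = 0
  code : HoldsCode B (m.reg 5) m.heap True (m.reg 11) t
  stack : HoldsStack B (m.reg 5) m.heap (m.reg 2) π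
  frame : HoldsFrame B (m.reg 5) m.heap (m.reg 3) F
  global : HoldsGlobal B m E
  ren : ∀ x, x ≠ m.reg 22 → m.tab 2 x = 0
  names : ∀ y, Occupied F π E y → y < m.reg 7
  fv : ∀ y ∈ t.fv, m.ren y < m.reg 7

/-- The extra iteration finds the list empty, makes the copy the code to evaluate and clears the
renaming of the name in register 22. -/
theorem Copying.its {F : Frame} {t : Code} {π : Stack} {E : Env} (H : Copying B m F t π E) :
    main.Its B inp (copyTime t + 1)
      (fun m' => Holds B m' ⟨.eval, F, (fresh m.ren t (m.reg 7)).1, π, E⟩ ∧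
        m'.reg 10 = m.reg 10) m := by
  rw [Cmd.its_add]
  refine (copy_code t m H.ready H.mode H.code H.fv).mono fun m' C => ⟨C.ready.run, ?_⟩
  obtain ⟨hm, h8, hc, hn, hl, hext, htab, hkeep⟩ := C
  rw [main_wp_copyUp h8]
  simp at hkeep
  simp [copyUp, Cmd.wp, Op.wps, Op.wp, hl, H.list, hm.fin]
  refine ⟨⟨⟨?_, ?_, ?_, ?_⟩, ?_, ?_, ?_, ?_, ?_, ?_, ?_, ?_⟩, ?_⟩
  · simp [hm.align]
  · simpa using hm.le
  · simp [hm.fin]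
  · simp [hm.run]
  · simp
  · simp [Phase.encode]
  · simpa using hc
  · simpa [hkeep] using H.stack.ext hext
  · simpa [hkeep] using H.frame.ext hext
  · exact (H.global.ext hext (congrFun htab 0) hkeep.2.2.2.2.1).ext (by simpa using .refl _ _)
      (by funext y; simp) (by simp)
  · intro x
    by_cases hx : x = m.reg 22
    · simp [hx, hkeep]
    · simp [hx, hkeep, htab, H.ren x hx]
  · intro y hy
    have hle := le_fresh m.ren t (m.reg 7)
    have : y < m'.reg 7 := by
      rw [hn]
      rcases hy with hy | hy | hy | hy
      · rcases Code.mem_names.1 hy with hy | hy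
        · simp only [Code.mem_fv, toTerm_fresh H.fv, occurs_rename] at hy
          obtain ⟨z, hz, rfl⟩ := hy
          exact (H.fv z (Code.mem_fv.2 hz)).trans_le hle
        · exact (mem_binders_fresh hy).2
      · exact (H.names y (.inr (.inl hy))).trans_le hle
      · exact (H.names y (.inl hy)).trans_le hle
      · exact (H.names y (.inr (.inr hy))).trans_le hle
    simpa using this
  · simp [hkeep]

theorem HoldsCode.tag_eq_one_iff {n p : ℕ} {h : ℕ → ℕ} {fl : Prop} {t : Code}
    (ht : HoldsCode B n h fl p t) : h p = 1 ↔ t.IsLam := by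
  cases ht <;> simp_all [Code.IsLam]

theorem HoldsCode.tag_eq_zero_iff {n p : ℕ} {h : ℕ → ℕ} {fl : Prop} {t : Code}
    (ht : HoldsCode B n h fl p t) : h p = 0 ↔ ∃ x, t = .var x := by
  cases ht <;> simp_all

end MaxMAM

namespace MaxMAM

open Term Code Ram

variable {B : ℕ} {inp : ℕ → ℕ} {m m' : Mem} {q q' : State}

/-! ### Simulation of the transitions -/

/-- From the memory `m`, that holds `q`, the RAM simulates a transition. -/
def Advances (B : ℕ) (inp : ℕ → ℕ) (N : ℕ) (m : Mem) (q : State) : Prop :=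
  ∃ b q' k, GStep b q q' ∧ Inv false q' ∧ 0 < k ∧ (b = true → k ≤ 6 * N + 6) ∧
    (b = false → k = 1 ∨ (k ≤ 3 * N + 2 ∧ q.phase = .eval ∧ (∃ x, q.code = .var x) ∧
      q'.phase = .eval ∧ ¬ Redex q'.code q'.stack)) ∧
    main.Its B inp k (fun m' => Holds B m' q' ∧ m'.reg 10 = 0) m

theorem fresh_binders {F : Frame} {π : Stack} {E : Env} {t : Code} {f : ℕ → ℕ} {n : ℕ}
    (hn : ∀ y, Occupied F π E y → y < n) (hf : ∀ x ∈ t.fv, f x < n) {y : ℕ}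
    (hy : y ∈ (fresh f t n).1.binders) : ¬ Occupied F π E y ∧ y ∉ (fresh f t n).1.fv :=
  ⟨fun h => absurd (hn y h) (by have := (mem_binders_fresh hy).1; omega),
    (wellNamed_fresh hf).2 y hy⟩

theorem Holds.occupied (H : Holds B m q) {y : ℕ} (hy : Occupied q.frame q.stack q.env y) :
    y < m.reg 7 := by
  refine H.names y ?_
  rcases hy with hy | hy | hy
  exacts [.inr (.inr (.inl hy)), .inr (.inl hy), .inr (.inr (.inr hy))]

theorem Holds.code_lt (H : Holds B m q) {y : ℕ} (hy : y ∈ q.code.names) : y < m.reg 7 :=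
  H.names y (.inl hy)

theorem ren_eq_id (h : ∀ x, m.tab 2 x = 0) : m.ren = id := by
  funext x
  simp [Mem.ren, h]

theorem ren_eq_ren1 {x y : ℕ} (h : ∀ z, m.tab 2 z = if z = x then y + 1 else 0) :
    m.ren = ren1 x y := by
  funext z
  by_cases hz : z = x <;> simp [Mem.ren, h, ren1, hz]

/-- The substitution of the variable is done by the renaming table while the body is copied. A
destructive substitution could damage an abstraction shared with the environment. -/
theorem advances_m1 {N : ℕ} {F : Frame} {x y : ℕ} {t : Code} {π : Stack} {E : Env}
    (hx : x ∈ t.fv) (H : Holds B m ⟨.eval, F, .lam x t, .var y :: π, E⟩) (h10 : m.reg 10 = 0)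
    (hi : Inv false ⟨.eval, F, .lam x t, .var y :: π, E⟩) (hN : t.size ≤ N) :
    Advances B inp N m ⟨.eval, F, .lam x t, .var y :: π, E⟩ := by
  have hy : y < m.reg 7 := H.occupied (.inr (.inl (by simp [Stack.mentions_cons, Code.names])))
  have hocc : ∀ z, Occupied F π E z → z < m.reg 7 := fun z hz => H.occupied
    (hz.imp_right (Or.imp_left fun h => Stack.mentions_cons.2 (.inr h)))
  have hfv : ∀ z ∈ t.fv, ren1 x y z < m.reg 7 := by
    intro z hz
    simp only [ren1]
    split_ifs
    · exact hy
    · exact H.code_lt (by simp [Code.names, fv_subset_names t hz])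
  have hu := toTerm_fresh hfv
  refine ⟨true, ⟨.eval, F, (fresh (ren1 x y) t (m.reg 7)).1, π, E⟩, copyTime t + 1 + 1,
    .m1 _ _ _ _ _ _ _ hx hu,
    hi.copy (nodup_fresh ..) (fun z hz => fresh_binders hocc hfv hz) ?_, by omega,
    fun _ => by have := copyTime_le t; omega, by simp, H.ready.run, H.wp_eval rfl ?_⟩
  · intro z hz
    rcases mem_fv_of_ren1 hu hz with rfl | h
    · simp [Code.fv]
    · exact .inr h
  obtain ⟨hv, h0, h1, hf, h2⟩ := holdsCode_lam.1 H.code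
  obtain ⟨hv', h1', h2'⟩ := holdsStack_cons.1 H.stack
  obtain ⟨hv'', h0'', h1''⟩ := holdsCode_var.1 h1'
  simp only [hx, if_true, true_implies] at hf
  simp [eval, evalLam, Cmd.wp, Op.wps, Op.wp, hv.get, h0, hv'.get, hv'.ne, hf, h10, hv''.get,
    h0'', h1'', h1, H.ready.fin]
  have hren : ∀ m1 : Mem, (∀ z, m1.tab 2 z = if z = x then y + 1 else m.tab 2 z) →
      m1.ren = ren1 x y := fun m1 h1 => ren_eq_ren1 fun z => by rw [h1, H.ren]
  refine Cmd.Its.mono (Copying.its (F := F) (t := t) (π := π) (E := E)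
    ⟨⟨?_, ?_, ?_, ?_⟩, ?_, ?_, ?_, ?_, ?_, ?_, ?_, ?_, ?_⟩) ?_
  · simp [H.ready.align]
  · simp [H.ready.le]
  · simp [H.ready.fin]
  · simp [H.ready.run]
  · simp
  · simp
  · simpa using h2
  · simpa using h2'
  · simpa using H.frame
  · exact H.global.ext (by simpa using .refl _ _) (by funext y; simp) (by simp)
  · intro z hz
    simp at hz
    simp [hz, H.ren]
  · simpa using hocc
  · rw [hren _ (by simp)]
    simpa using hfv
  · rintro m' ⟨h1, h2⟩
    rw [hren _ (by simp)] at h1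
    simp [h10] at h1 h2
    exact ⟨h1, h2⟩

theorem advances_m3 {N : ℕ} {F : Frame} {x : ℕ} {t u : Code} {π : Stack} {E : Env}
    (H : Holds B m ⟨.back, .erasing x t π :: F, u, [], E⟩) (h10 : m.reg 10 = 0)
    (hi : Inv false ⟨.back, .erasing x t π :: F, u, [], E⟩) (hx : x ∉ t.fv) (hN : t.size ≤ N) :
    Advances B inp N m ⟨.back, .erasing x t π :: F, u, [], E⟩ := by
  have hocc : ∀ z, Occupied F π E z → z < m.reg 7 := fun z hz => H.occupied <| by
    rcases hz with ⟨φ, h, hz⟩ | hz | hz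
    · exact .inl ⟨φ, by simp [h], hz⟩
    · exact .inl ⟨_, List.mem_cons_self .., .inr (.inr hz)⟩
    · exact .inr (.inr hz)
  have hfv : ∀ z ∈ t.fv, id z < m.reg 7 := fun z hz =>
    H.occupied (.inl ⟨_, List.mem_cons_self .., .inr (.inl (fv_subset_names t hz))⟩)
  have hu : (fresh id t (m.reg 7)).1.toTerm = t.toTerm :=
    (toTerm_fresh hfv).trans (rename_id _ fun _ _ => rfl)
  refine ⟨true, ⟨.eval, F, (fresh id t (m.reg 7)).1, π, E⟩, copyTime t + 1 + 1,
    .m3 _ _ _ _ _ _ _ hu,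
    hi.copy_erase (nodup_fresh ..) (fun z hz => fresh_binders hocc hfv hz) ?_, by omega,
    fun _ => by have := copyTime_le t; omega, by simp, H.ready.run, H.wp_back rfl ?_⟩
  · intro z hz
    rw [fv_eq_of_toTerm hu] at hz
    exact ⟨hz, fun h => hx (h ▸ hz)⟩
  obtain ⟨hv, h0, h1, h2, h3⟩ := holdsFrame_erasing.1 H.frame
  obtain ⟨hv', -, -, -, h4⟩ := holdsCode_lam.1 h1
  have hz := holdsStack_nil.1 H.stack
  simp [back, Cmd.wp, Op.wps, Op.wp, hz, hv.ne, h10, hv.get, h0, hv'.get]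
  have hren : ∀ m1 : Mem, (∀ z, m1.tab 2 z = m.tab 2 z) → m1.ren = id :=
    fun m1 h1 => ren_eq_id fun z => by rw [h1, H.ren]
  refine Cmd.Its.mono (Copying.its (F := F) (t := t) (π := π) (E := E)
    ⟨⟨?_, ?_, ?_, ?_⟩, ?_, ?_, ?_, ?_, ?_, ?_, ?_, ?_, ?_⟩) ?_
  · simp [H.ready.align]
  · simp [H.ready.le]
  · simp [H.ready.fin]
  · simp [H.ready.run]
  · simp
  · simp
  · simpa using h4
  · simpa using h2
  · simpa using h3
  · exact H.global.ext (by simpa using .refl _ _) (by simp) (by simp)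
  · intro z hz
    simp [H.ren]
  · simpa using hocc
  · rw [hren _ (by simp)]
    simpa using hfv
  · rintro m' ⟨h1, h2⟩
    rw [hren _ (by simp)] at h1
    simp [h10] at h1 h2
    exact ⟨h1, h2⟩

/-- A single iteration moves a pointer. This matters because the potential drops by a constant only
when an abstraction meets an argument. -/
theorem advances_share {N : ℕ} {F : Frame} {x : ℕ} {π : Stack} {E : Env} {e : Entry}
    (H : Holds B m ⟨.eval, F, .var x, π, E⟩) (h10 : m.reg 10 = 0)
    (hi : Inv false ⟨.eval, F, .var x, π, E⟩) (he : E.lookup x = some e)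
    (hl : (∃ n, e.label = .red n) ∨ e.label = .abs ∧ π ≠ []) (hr : Redex e.code π) :
    Advances B inp N m ⟨.eval, F, .var x, π, E⟩ := by
  refine ⟨false, ⟨.eval, F, e.code, π, E⟩, 1, .exp _ _ _ _ _ _ he hl rfl,
    hi.share (Env.lookup_eq_some he).1 hr, one_pos, by simp, by simp, H.ready.run,
    H.wp_eval rfl ?_⟩
  obtain ⟨hv, h0, h1⟩ := holdsCode_var.1 H.code
  have ht := H.global.lookup he
  have hz : m.reg 2 ≠ 0 := fun h => hr.2 (H.stack.eq_zero_iff.1 h)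
  have h1' := ht.code.tag_eq_one_iff.2 hr.1
  have fin : ∀ m' : Mem, (∀ r, r ≠ 1 → r < 14 → m'.reg r = m.reg r) →
      m'.reg 1 = m.heap (m.tab 0 x + 1) → m'.heap = m.heap → m'.tab = m.tab →
      Holds B m' ⟨.eval, F, e.code, π, E⟩ ∧ m'.reg 10 = 0 := by
    intro m' h1 h2 h3 h4
    have h5 := h1 5 (by omega) (by omega)
    refine ⟨⟨⟨?_, ?_, ?_, ?_⟩, ?_, ?_, ?_, ?_, ?_, ?_, ?_, ?_⟩, ?_⟩
    · rw [h5, H.ready.align]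
    · rw [h5]; exact H.ready.le
    · rw [h1 6 (by omega) (by omega), H.ready.fin]
    · rw [h1 9 (by omega) (by omega), H.ready.run]
    · rw [h1 8 (by omega) (by omega), H.mode]
    · rw [h1 0 (by omega) (by omega), H.phase]
    · rw [h5, h3, h2]; simpa using ht.code
    · rw [h5, h3, h1 2 (by omega) (by omega)]; exact H.stack
    · rw [h5, h3, h1 3 (by omega) (by omega)]; exact H.frame
    · exact H.global.ext (by rw [h5, h3]; exact .refl _ _) (by rw [h4])
        (h1 4 (by omega) (by omega))
    · rw [h4]; exact H.ren
    · intro y hy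
      rw [h1 7 (by omega) (by omega)]
      rcases hy with hy | hy
      · exact H.occupied (.inr (.inr ⟨e, (Env.lookup_eq_some he).1, .inr hy⟩))
      · exact H.names y (.inr hy)
    · rw [h1 10 (by omega) (by omega), h10]
  have hl' := ht.label
  rcases hl with ⟨n, hl⟩ | ⟨hl, -⟩
  all_goals
    rw [hl, Label.encode] at hl'
    simp [eval, evalVar, Cmd.wp, Op.wps, Op.wp, hv.get, h0, h1, H.ready.fin, ht.valid.ne,
      ht.valid.get, hl', h10, hz, ht.code.valid.get, h1']
    refine fin _ ?_ ?_ ?_ ?_ <;> simp <;> (intro r; intros; repeat rw [if_neg (by omega)])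

theorem advances_replace {N : ℕ} {F : Frame} {x n : ℕ} {π : Stack} {E : Env} {e : Entry}
    (H : Holds B m ⟨.eval, F, .var x, π, E⟩) (h10 : m.reg 10 = 0)
    (hi : Inv false ⟨.eval, F, .var x, π, E⟩) (he : E.lookup x = some e)
    (hl : e.label = .red n) (hr : ¬ Redex e.code π) (hN : e.code.size ≤ N) :
    Advances B inp N m ⟨.eval, F, .var x, π, E⟩ := by
  have hfv : ∀ z ∈ e.code.fv, id z < m.reg 7 := fun z hz => H.occupied
    (.inr (.inr ⟨e, (Env.lookup_eq_some he).1, .inr (fv_subset_names _ hz)⟩))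
  have hu : (fresh id e.code (m.reg 7)).1.toTerm = e.code.toTerm :=
    (toTerm_fresh hfv).trans (rename_id _ fun _ _ => rfl)
  have hocc := fun z => H.occupied (y := z)
  refine ⟨false, ⟨.eval, F, (fresh id e.code (m.reg 7)).1, π, E⟩, copyTime e.code + 1 + 1,
    .exp _ _ _ _ _ _ he (.inl ⟨n, hl⟩) hu,
    hi.exp (nodup_fresh ..) (fun z hz => (fresh_binders hocc hfv hz).1) ?_, by omega, by simp,
    fun _ => .inr ⟨by have := copyTime_le e.code; omega, rfl, ⟨x, rfl⟩, rfl, ?_⟩,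
    H.ready.run, H.wp_eval rfl ?_⟩
  · intro z hz
    rw [fv_eq_of_toTerm hu] at hz
    exact ⟨e, (Env.lookup_eq_some he).1, .inr hz⟩
  · rw [Redex, isLam_iff] at hr ⊢
    rwa [hu]
  obtain ⟨hv, h0, h1⟩ := holdsCode_var.1 H.code
  have ht := H.global.lookup he
  have hren : ∀ m1 : Mem, m1.tab = m.tab → m1.ren = id :=
    fun m1 h1 => ren_eq_id fun z => by rw [h1, H.ren]
  have fin : ∀ m' : Mem, (∀ r, r ≠ 8 → r < 11 → m'.reg r = m.reg r) → m'.reg 8 = 5 →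
      m'.reg 13 = 0 → m'.reg 11 = m.heap (m.tab 0 x + 1) → m'.heap = m.heap → m'.tab = m.tab →
      main.Its B inp (copyTime e.code + 1) (fun m' => Holds B m'
        ⟨.eval, F, (fresh id e.code (m.reg 7)).1, π, E⟩ ∧ m'.reg 10 = 0) m' := by
    intro m' h1 h8 h13 h11 h3 h4
    have h5 := h1 5 (by omega) (by omega)
    have h7 := h1 7 (by omega) (by omega)
    refine Cmd.Its.mono (Copying.its (F := F) (t := e.code) (π := π) (E := E)
      ⟨⟨?_, ?_, ?_, ?_⟩, h8, h13, ?_, ?_, ?_, ?_, ?_, ?_, ?_⟩) ?_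
    · rw [h5, H.ready.align]
    · rw [h5]; exact H.ready.le
    · rw [h1 6 (by omega) (by omega), H.ready.fin]
    · rw [h1 9 (by omega) (by omega), H.ready.run]
    · rw [h5, h3, h11]; exact ht.code
    · rw [h5, h3, h1 2 (by omega) (by omega)]; exact H.stack
    · rw [h5, h3, h1 3 (by omega) (by omega)]; exact H.frame
    · exact H.global.ext (by rw [h5, h3]; exact .refl _ _) (by rw [h4])
        (h1 4 (by omega) (by omega))
    · intro z _
      rw [h4, H.ren]
    · rw [h7]; exact hocc
    · rw [hren _ h4, h7]; exact hfv
    · rintro m'' ⟨h, h'⟩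
      rw [hren _ h4, h7] at h
      exact ⟨h, by rw [h', h1 10 (by omega) (by omega), h10]⟩
  have hl' := ht.label
  rw [hl, Label.encode] at hl'
  simp [eval, evalVar, replace, Cmd.wp, Op.wps, Op.wp, hv.get, h0, h1, H.ready.fin, ht.valid.ne,
    ht.valid.get, hl', h10, ht.code.valid.get]
  by_cases hz : m.reg 2 = 0
  · rw [if_pos hz]
    refine fin _ ?_ ?_ ?_ ?_ ?_ ?_ <;> simp <;> (intro r; intros; repeat rw [if_neg (by omega)])
  · have h1' : m.heap (m.heap (m.tab 0 x + 1)) ≠ 1 := fun h =>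
      hr ⟨ht.code.tag_eq_one_iff.1 h, fun h => hz (H.stack.eq_zero_iff.2 h)⟩
    rw [if_neg hz, if_neg h1']
    refine fin _ ?_ ?_ ?_ ?_ ?_ ?_ <;> simp <;> (intro r; intros; repeat rw [if_neg (by omega)])

end MaxMAM

namespace MaxMAM

open Term Code Ram

variable {B : ℕ} {inp : ℕ → ℕ} {m m' : Mem} {q q' : State}

theorem main_wp_bind {Q : Mem → Prop} (h : m.reg 8 = 7) :
    main.wp B inp Q m ↔ Ram.bind.wp B inp Q m := by
  simp [main, Cmd.wp, h]

theorem advances_m2 {N : ℕ} {F : Frame} {x : ℕ} {t v : Code} {π : Stack} {E : Env} {l : Label}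
    (hx : x ∈ t.fv) (hv : ∀ y, v ≠ .var y) (hl : Checks v E l)
    (H : Holds B m ⟨.eval, F, .lam x t, v :: π, E⟩) (h10 : m.reg 10 = 0)
    (hi : Inv false ⟨.eval, F, .lam x t, v :: π, E⟩) (hN : t.size ≤ N) (hN' : v.size ≤ N) :
    Advances B inp N m ⟨.eval, F, .lam x t, v :: π, E⟩ := by
  set n := m.reg 7 with hn
  have hocc' : ∀ z, Occupied F (v :: π) E z → z < n := fun z hz => H.occupied hz
  have hocc : ∀ z, Occupied F π E z → z < n := fun z hz => hocc' z
    (hz.imp_right (Or.imp_left fun h => Stack.mentions_cons.2 (.inr h)))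
  have hvn : ∀ z ∈ v.names, z < n := fun z hz => hocc' z
    (.inr (.inl (Stack.mentions_cons.2 (.inl hz))))
  have hfv : ∀ z ∈ t.fv, ren1 x n z < n + 1 := by
    intro z hz
    simp only [ren1]
    split_ifs
    · omega
    · exact (H.code_lt (by simp [Code.names, fv_subset_names t hz])).trans (Nat.lt_succ_self _)
  have hu := toTerm_fresh hfv
  have hbs : ∀ z ∈ (fresh (ren1 x n) t (n + 1)).1.binders, n + 1 ≤ z :=
    fun z hz => (mem_binders_fresh hz).1
  obtain ⟨s, hs, hout⟩ := hl
  obtain ⟨k, hk, hpath⟩ := comm_path (B := B) (inp := inp) hs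
  have hk' : k ≤ 3 * v.size := by
    simp only [State.weight, Stack.weight, Frame.weight] at hk
    have := codeWeight_le .eval v []
    omega
  refine ⟨true, ⟨.eval, F, (fresh (ren1 x n) t (n + 1)).1, π, ⟨n, v, l⟩ :: E⟩,
    -- The single iterations start the check, output its label, bind the entry and finish the copy;
    -- the check proper takes `k` and the copy of the body `copyTime t`.
    k + (copyTime t + 1 + 1 + 1) + 1,
    .m2 _ _ _ _ _ _ _ _ _ hx hv ⟨s, hs, hout⟩ hu ?_,
    hi.copy_entry (nodup_fresh ..) ?_ (fun h => by have := hbs _ h; omega)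
      (fun z hz => (wellNamed_fresh hfv).2 z hz) (fun z hz => mem_fv_of_ren1 hu hz), by omega,
    fun _ => by have := copyTime_le t; omega, by simp, H.ready.run, H.wp_eval rfl ?_⟩
  · rintro (h | h | ⟨φ, hφ, h⟩ | h)
    · exact lt_irrefl n (H.code_lt (fv_subset_names _ h))
    · exact lt_irrefl n (hocc' n (.inr (.inl (Stack.mentions_iff.2 (.inl h)))))
    · exact lt_irrefl n (hocc' n (.inl ⟨φ, hφ, Item.mentions_of (b := true) (.inl h)⟩))
    · exact lt_irrefl n (hocc' n (.inr (.inr (Env.mentions_iff.2 (.inl h)))))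
  · rintro z (hz | rfl) h
    · have := hbs z hz
      have := hocc' z h
      omega
    · exact lt_irrefl _ (hocc' _ h)
  obtain ⟨hp, h0, h1, hf, h2⟩ := holdsCode_lam.1 H.code
  obtain ⟨hp', h1', h2'⟩ := holdsStack_cons.1 H.stack
  simp only [hx, if_true, true_implies] at hf
  have ht0 : m.heap (m.heap (m.reg 2)) ≠ 0 := fun h => by
    obtain ⟨y, hy⟩ := h1'.tag_eq_zero_iff.1 h
    exact hv y hy
  simp [eval, evalLam, Cmd.wp, Op.wps, Op.wp, hp.get, h0, hp'.get, hp'.ne, hf, h10,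
    h1'.valid.get, ht0]
  rw [Cmd.its_add]
  refine Cmd.Its.mono (hpath _ ⟨⟨?_, ?_, ?_, ?_⟩, ?_, ?_, ?_, ?_, ?_, ?_, ?_, ?_⟩) ?_
  · simp [H.ready.align]
  · simp [H.ready.le]
  · simp [H.ready.fin]
  · simp [H.ready.run]
  · simp [H.mode]
  · simp [H.phase]
  · simpa using h1'
  · simp [holdsStack_nil]
  · simp [holdsFrame_nil]
  · exact H.global.ext (by simpa using .refl _ _) (by simp) (by simp)
  · intro z
    simp [H.ren]
  · rintro z (h | h | ⟨φ, h, -⟩ | h)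
    · simpa using hvn z h
    · exact absurd h (Stack.mentions_nil z)
    · simp at h
    · simpa using hocc z (.inr (.inr h))
  rintro m₁ ⟨H₁, K₁⟩
  refine ⟨H₁.ready.run, Cmd.wp_mono ?_ (hout.wp H₁ ?_)⟩
  swap
  · simpa using K₁.reg 10 (by simp)
  rintro m₂ ⟨h18, h8, K₂⟩
  have K := K₁.trans K₂
  have hE := H₁.global.ext K₂.ext (congrFun K₂.tab 0) (K₂.reg 4 (by simp))
  have R := H₁.ready.keep K₂
  clear K₂
  obtain ⟨kext, -, ktab, kreg⟩ := K
  have henv : s.env = E := by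
    clear hout hk hpath H₁ hE
    induction hs with
    | refl => rfl
    | tail _ h ih => obtain ⟨τ, h⟩ := h; rw [h.env_eq, ih]
  rw [henv] at hE
  simp at kext ktab kreg
  obtain ⟨k4, k6, k7, k9, k10, k19, k20, k21⟩ := kreg
  have p1 := hp.eq kext (c := 1) (by omega)
  have p2 := hp.eq kext (c := 2) (by omega)
  have p0' := hp'.eq kext (c := 0) (by omega)
  have p1' := hp'.eq kext (c := 1) (by omega)
  rw [Nat.add_zero] at p0'
  refine ⟨R.run, (main_wp_bind h8).2 ?_⟩
  simp [Ram.bind, Cmd.wp, Op.wps, Op.wp, k19, k20, k21, k7, (hp.ext kext).get, (hp'.ext kext).get,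
    p1, p0', h1, R.fin, R.alloc]
  intro h e e0 e1 e2 e3 e4
  have e' := Ready.ext e
  have q2 := (hp.ext kext).eq e' (c := 2) (by omega)
  have q1' := (hp'.ext kext).eq e' (c := 1) (by omega)
  have hren : ∀ m1 : Mem, (∀ z, m1.tab 2 z = if z = x then n + 1 else m.tab 2 z) →
      m1.ren = ren1 x n := fun m1 h1 => ren_eq_ren1 fun z => by rw [h1, H.ren]
  have hent : HoldsEntry B (m₂.reg 5 + 16) h (m₂.reg 5) ⟨n, v, l⟩ :=
    ⟨R.valid, by simp [e0, hn], by simpa [e1] using (h1'.ext kext).ext e', by simp [e2, h18]⟩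
  refine Cmd.Its.mono (Copying.its (F := F) (t := t) (π := π) (E := ⟨n, v, l⟩ :: E)
    ⟨⟨?_, ?_, ?_, ?_⟩, ?_, ?_, ?_, ?_, ?_, ⟨?_, ?_⟩, ?_, ?_, ?_⟩) ?_
  · simp [R.align]
  · have := R.le; simp; omega
  · simp [R.fin]
  · simp [R.run]
  · simp
  · simp
  · simpa [q2, p2] using (h2.ext kext).ext e'
  · simpa [q1', p1'] using (h2'.ext kext).ext e'
  · simpa using (H.frame.ext kext).ext e'
  · exact .cons (by simpa using hent) (by simp [e3]) (hE.env.ext e')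
  · intro z
    by_cases hz : z = n
    · refine .inr ⟨⟨n, v, l⟩, by simp [Env.lookup, hz], ?_⟩
      simpa [hz, hn] using hent
    · have hz' : n ≠ z := Ne.symm hz
      refine ((hE.table z).imp (fun h => ?_) fun ⟨d, h1, h2⟩ => ⟨d, ?_, ?_⟩)
      · simpa [Env.lookup, hz, hz', ← hn] using h
      · simpa [Env.lookup, hz'] using h1
      · simpa [hz, ← hn] using h2.ext e'
  · intro z hz
    simp at hz
    simp [hz, ktab, H.ren]
  · rintro z (h | h | ⟨d, hd, h⟩)
    · simpa using (hocc z (.inl h)).trans (Nat.lt_succ_self _)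
    · simpa using (hocc z (.inr (.inl h))).trans (Nat.lt_succ_self _)
    · simp only [Mem.reg_set]
      simp
      rcases List.mem_cons.1 hd with rfl | hd
      · rcases h with rfl | h
        · simp [hn]
        · exact (hvn z h).le
      · exact (hocc z (.inr (.inr ⟨d, hd, h⟩))).le
  · rw [hren _ (by simp [ktab, hn])]
    simpa using hfv
  · rintro m' ⟨h1, h2⟩
    rw [hren _ (by simp [ktab, hn])] at h1
    simp at h1 h2
    exact ⟨h1, h2⟩

theorem Holds.advances {N : ℕ} (H : Holds B m q) (h10 : m.reg 10 = 0) (hi : Inv false q)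
    (hg : Good q) (hN : q.All (fun t => t.size ≤ N)) (hq : ¬ Stopped q) :
    Advances B inp N m q := by
  obtain ⟨τ, s', h⟩ := (progress q).resolve_right hq
  cases h with
  | comm h =>
    exact ⟨false, s', 1, .comm h, h.inv hi, one_pos, by simp, by simp, H.ready.run,
      Cmd.wp_mono (fun m' hm => ⟨hm.1, (hm.2.reg 10 (by simp)).trans h10⟩) (h.wp H)⟩
  | m1 F x y t π E hx =>
    exact advances_m1 hx H h10 hi ((hereditary_size N).lam _ _ (hN.code rfl))
  | m2 F x t u π E l hx hu hl =>
    exact advances_m2 hx hu hl H h10 hi ((hereditary_size N).lam _ _ (hN.code rfl))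
      (hN.stack u (by simp))
  | m3 F x t u π E =>
    exact advances_m3 H h10 hi (hg.erases x t π (by simp))
      ((hereditary_size N).lam _ _ (hN.frame _ (List.mem_cons_self ..)).1)
  | ered F x u π E e n he hl =>
    by_cases hr : Redex e.code π
    · exact advances_share H h10 hi he (.inl ⟨n, hl⟩) hr
    · exact advances_replace H h10 hi he hl hr (hN.env e (Env.lookup_eq_some he).1)
  | eabs F x v u π E e he hl =>
    exact advances_share H h10 hi he (.inr ⟨hl, by simp⟩) ⟨hg.env.isLam he hl, by simp⟩

theorem Holds.halts (H : Holds B m q) (h10 : m.reg 10 = 0) (hq : Stopped q) :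
    main.Its B inp 1 (fun m' => m' = m.set 9 1) m := by
  obtain ⟨φ, F, t, π, E⟩ := q
  obtain ⟨rfl, rfl, rfl⟩ : φ = .back ∧ π = [] ∧ F = [] := hq
  refine ⟨H.ready.run, H.wp_back rfl ?_⟩
  have hz := holdsStack_nil.1 H.stack
  have hz' := holdsFrame_nil.1 H.frame
  simp [back, Cmd.wp, Op.wps, Op.wp, hz, hz', h10]
  rfl

end MaxMAM

namespace MaxMAM

open Term Code Ram

variable {B : ℕ} {inp : ℕ → ℕ} {m m' : Mem}

/-! ### Reading the input -/

theorem WellNamed.of_lam {x : ℕ} {t : Code} (h : (Code.lam x t).WellNamed) :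
    t.WellNamed ∧ x ∉ t.binders := by
  simp only [WellNamed, binders, List.nodup_cons, fv, List.mem_cons, Finset.mem_erase] at h ⊢
  grind

theorem WellNamed.of_app {t u : Code} (h : (Code.app t u).WellNamed) :
    t.WellNamed ∧ u.WellNamed ∧ ∀ x ∈ u.binders, x ∉ t.names := by
  simp only [WellNamed, binders, List.nodup_append, fv, List.mem_append, Finset.mem_union,
    Code.mem_names] at h ⊢
  grind

/-- The name `y` is the name of an occurrence of a variable, free or bound. -/
def Code.Uses (y : ℕ) : Code → Prop
  | var x => y = x
  | lam _ t => t.Uses y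
  | app t u => t.Uses y ∨ u.Uses y

theorem Code.Uses.mem_names {y : ℕ} {t : Code} (h : t.Uses y) : y ∈ t.names := by
  induction t <;> simp_all [Code.Uses, Code.names] <;> tauto

theorem Code.uses_of_mem_fv {y : ℕ} {t : Code} (h : y ∈ t.fv) : t.Uses y := by
  induction t <;> simp_all [Code.Uses, Code.fv]
  tauto

theorem Code.uses_iff {y : ℕ} {t : Code} (h : y ∉ t.binders) : t.Uses y ↔ y ∈ t.fv :=
  ⟨fun hy => (Code.mem_names.1 hy.mem_names).resolve_right h, Code.uses_of_mem_fv⟩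

/-- The input holds the code `t` from address `a` on. -/
def InputAt (inp : ℕ → ℕ) : ℕ → Code → Prop
  | a, .var x => inp a = 0 ∧ inp (a + 1) = x
  | a, .lam x t => inp a = 1 ∧ inp (a + 1) = x ∧ InputAt inp (a + 2) t
  | a, .app t u => inp a = 2 ∧ InputAt inp (a + 1) t ∧ InputAt inp (a + 1 + t.encode.length) u

theorem inputAt_of_getD {t : Code} {a : ℕ}
    (h : ∀ i < t.encode.length, inp (a + i) = t.encode.getD i 0) : InputAt inp a t := by
  induction t generalizing a with
  | var x => exact ⟨h 0 (by simp [encode]), h 1 (by simp [encode])⟩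
  | lam x t ih =>
    refine ⟨h 0 (by simp [encode]), h 1 (by simp [encode]), ih fun i hi => ?_⟩
    have := h (2 + i) (by simp [encode]; omega)
    rwa [← Nat.add_assoc, Nat.add_comm 2 i] at this
  | app t u ih ih' =>
    refine ⟨h 0 (by simp [encode]), ih fun i hi => ?_, ih' fun i hi => ?_⟩
    · have := h (1 + i) (by simp [encode]; omega)
      rw [← Nat.add_assoc] at this
      rw [this, Nat.add_comm 1 i]
      simp [encode, List.getElem?_append_left hi]
    · have := h (1 + t.encode.length + i) (by simp [encode]; omega)
      rw [← Nat.add_assoc, ← Nat.add_assoc] at this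
      rw [this, show 1 + t.encode.length + i = (t.encode.length + i) + 1 by omega]
      simp [encode, List.getElem?_append_right]

/-- The input has been scanned up to the code `t`. -/
structure Scanned (m : Mem) (t : Code) (m' : Mem) : Prop where
  mode : m'.reg 8 = 1
  run : m'.reg 9 = 0
  pos : m'.reg 11 = m.reg 11 + t.encode.length
  pending : m'.reg 23 + 1 = m.reg 23
  le : m.reg 7 ≤ m'.reg 7
  names : ∀ y ∈ t.names, y < m'.reg 7
  heap : m'.heap = m.heap
  tab : m'.tab = m.tab
  keep : ∀ r ∈ [0, 2, 3, 4, 10], m'.reg r = m.reg r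

theorem main_wp_scan {Q : Mem → Prop} (h : m.reg 8 = 1) :
    main.wp B inp Q m ↔ scan.wp B inp Q m := by
  simp [main, Cmd.wp, h]

/-- Register 23 counts the codes still expected: an application replaces one by two, a variable
completes one. In prefix notation the input ends when the count reaches zero. -/
theorem scan_code (t : Code) : ∀ m : Mem, m.reg 8 = 1 → m.reg 9 = 0 → m.reg 23 ≠ 0 →
    InputAt inp (m.reg 11) t → 32 ≤ m.reg 11 → m.reg 11 + t.encode.length ≤ B →
    main.Its B inp t.size (Scanned m t) m := by
  induction t with
  | var x =>
    rintro m h8 h9 h23 ⟨h0, h1⟩ ha hb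
    refine ⟨h9, (main_wp_scan h8).2 ?_⟩
    simp only [encode, List.length_cons, List.length_nil] at hb
    have b0 : m.reg 11 < B := by omega
    have b1 : m.reg 11 + 1 < B := by omega
    simp [scan, Cmd.wp, Op.wps, Op.wp, h23, h0, h1, ha, b0, b1, show 32 ≤ m.reg 11 + 1 by omega]
    refine ⟨?_, ?_, ?_, ?_, ?_, ?_, ?_, ?_, ?_⟩ <;> simp [h8, h9, encode, Code.names]
    all_goals omega
  | lam x t ih =>
    rintro m h8 h9 h23 ⟨h0, h1, h2⟩ ha hb
    rw [Code.size_lam]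
    refine ⟨h9, (main_wp_scan h8).2 ?_⟩
    simp only [encode, List.length_cons] at hb
    have b0 : m.reg 11 < B := by omega
    have b1 : m.reg 11 + 1 < B := by omega
    simp [scan, Cmd.wp, Op.wps, Op.wp, h23, h0, h1, ha, b0, b1, show 32 ≤ m.reg 11 + 1 by omega]
    refine (ih _ ?_ ?_ ?_ ?_ ?_ ?_).mono fun m' S => ?_
    · simp [h8]
    · simp [h9]
    · simp [h23]
    · simpa using h2
    · simp; omega
    · simp; omega
    obtain ⟨s1, s2, s3, s4, s5, s6, s7, s8, s9⟩ := S
    simp at s3 s4 s5 s7 s8 s9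
    refine ⟨s1, s2, ?_, s4, by omega, ?_, s7, s8, by simpa using s9⟩
    · simp [s3, encode]; omega
    · intro y hy
      rcases Finset.mem_insert.1 hy with rfl | hy
      · omega
      · exact s6 y hy
  | app t u ih ih' =>
    rintro m h8 h9 h23 ⟨h0, h1, h2⟩ ha hb
    rw [Code.size_app]
    refine ⟨h9, (main_wp_scan h8).2 ?_⟩
    simp only [encode, List.length_cons, List.length_append] at hb
    have b0 : m.reg 11 < B := by omega
    simp [scan, Cmd.wp, Op.wps, Op.wp, h23, h0, ha, b0]
    rw [Cmd.its_add]
    refine (ih _ ?_ ?_ ?_ ?_ ?_ ?_).mono fun m' S => ?_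
    · simp [h8]
    · simp [h9]
    · simp
    · simpa using h1
    · simp; omega
    · simp; omega
    obtain ⟨s1, s2, s3, s4, s5, s6, s7, s8, s9⟩ := S
    simp at s3 s4 s5 s7 s8 s9
    refine (ih' _ s1 s2 ?_ ?_ ?_ ?_).mono fun m'' S => ?_
    · omega
    · rwa [s3]
    · omega
    · omega
    obtain ⟨r1, r2, r3, r4, r5, r6, r7, r8, r9⟩ := S
    simp at r9
    refine ⟨r1, r2, ?_, by omega, by omega, ?_, r7.trans s7, r8.trans s8, by simp [r9, s9]⟩
    · simp [r3, s3, encode]; omega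
    · intro y hy
      rcases Finset.mem_union.1 hy with hy | hy
      · exact (s6 y hy).trans_le r5
      · exact r6 y hy

/-- The code `t` has been parsed. -/
structure Parsed (B : ℕ) (m : Mem) (t : Code) (m' : Mem) : Prop where
  ready : Ready B m'
  mode : m'.reg 8 = 3
  pos : m'.reg 11 = m.reg 11 + t.encode.length
  code : HoldsCode B (m'.reg 5) m'.heap True (m'.reg 12) t
  list : m'.reg 13 = m.reg 13
  ext : Ext (m.reg 5) m.heap (m'.reg 5) m'.heap
  tab : ∀ k, k ≠ 1 → m'.tab k = m.tab k
  used : ∀ y, t.Uses y → m'.tab 1 y = 1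
  unused : ∀ y, ¬ t.Uses y → m'.tab 1 y = m.tab 1 y
  keep : ∀ r ∈ [0, 2, 3, 4, 7, 10], m'.reg r = m.reg r

theorem main_wp_parseDown {Q : Mem → Prop} (h : m.reg 8 = 2) :
    main.wp B inp Q m ↔ parseDown.wp B inp Q m := by
  simp [main, Cmd.wp, h]

theorem main_wp_parseUp {Q : Mem → Prop} (h : m.reg 8 = 3) :
    main.wp B inp Q m ↔ parseUp.wp B inp Q m := by
  simp [main, Cmd.wp, h]

/-- The occurrence flag of an abstraction is read from a table that marks every name used so far.
Well-namedness makes it right: a binder has not been used before its abstraction, and is not rebound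
in its body, so a mark means a free occurrence in the body. -/
theorem parse_code (t : Code) : ∀ m : Mem, Ready B m → m.reg 8 = 2 →
    InputAt inp (m.reg 11) t → 32 ≤ m.reg 11 → m.reg 11 + t.encode.length ≤ B → t.WellNamed →
    (∀ x ∈ t.binders, m.tab 1 x = 0) →
    main.Its B inp (copyTime t) (Parsed B m t) m := by
  induction t with
  | var x =>
    rintro m hm h8 ⟨h0, h1⟩ ha hb - -
    refine ⟨hm.run, (main_wp_parseDown h8).2 ?_⟩
    simp only [encode, List.length_cons, List.length_nil] at hb
    have b0 : m.reg 11 < B := by omega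
    have b1 : m.reg 11 + 1 < B := by omega
    simp [parseDown, Cmd.wp, Op.wps, Op.wp, h0, h1, ha, b0, b1, hm.fin, hm.alloc,
      show 32 ≤ m.reg 11 + 1 by omega]
    intro h e e0 e1 _ _ _
    have e' := Ready.ext e
    have hle := hm.le
    refine ⟨⟨?_, ?_, ?_, ?_⟩, ?_, ?_, .var ?_ ?_ ?_, ?_, ?_, ?_, ?_, ?_, ?_⟩
    · simp [hm.align]
    · simp; omega
    · simp [hm.fin]
    · simp [hm.run]
    · simp
    · simp [encode]
    · simpa using hm.valid
    · simp [e0]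
    · simp [e1]
    · simp
    · simpa using e'
    · intro k hk
      funext y
      simp [hk]
    · rintro y rfl
      simp
    · intro y hy
      simp [Code.Uses] at hy
      simp [hy]
    · simp
  | lam x t ih =>
    rintro m hm h8 ⟨h0, h1, h2⟩ ha hb hw hz
    obtain ⟨hw', hxb⟩ := WellNamed.of_lam hw
    refine ⟨hm.run, (main_wp_parseDown h8).2 ?_⟩
    simp only [encode, List.length_cons] at hb
    have b0 : m.reg 11 < B := by omega
    have b1 : m.reg 11 + 1 < B := by omega
    simp [parseDown, Cmd.wp, Op.wps, Op.wp, h0, h1, ha, b0, b1, hm.alloc,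
      show 32 ≤ m.reg 11 + 1 by omega]
    intro h e e0 e1 _ _ e4
    have e' := Ready.ext e
    have hle := hm.le
    rw [Cmd.its_add]
    refine (ih _ ⟨?_, ?_, ?_, ?_⟩ ?_ ?_ ?_ ?_ hw' ?_).mono fun m2 C => ⟨C.ready.run, ?_⟩
    · simp [hm.align]
    · simp; omega
    · simp [hm.fin]
    · simp [hm.run]
    · simp [h8]
    · simpa using h2
    · simp; omega
    · simp; omega
    · intro y hy
      simpa using hz y (by simp [binders, hy])
    obtain ⟨hm2, h82, hpos, hc, hl, hext, htab, hu, hu', hkeep⟩ := C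
    simp at hpos hl hext htab hu' hkeep
    rw [main_wp_parseUp h82]
    have hp : Valid B (m2.reg 5) (m.reg 5) := (hm.valid).ext hext
    have g0 := (hm.valid.eq hext (c := 0) (by omega)).trans e0
    have g1 := (hm.valid.eq hext (c := 1) (by omega)).trans e1
    have g4 := (hm.valid.eq hext (c := 4) (by omega)).trans e4
    rw [Nat.add_zero] at g0
    have hflag : m2.tab 1 x = if x ∈ t.fv then 1 else 0 := by
      by_cases hx : x ∈ t.fv
      · rw [if_pos hx, hu x (Code.uses_of_mem_fv hx)]
      · rw [if_neg hx, hu' x (fun h => hx ((Code.uses_iff hxb).1 h)), hz x (by simp [binders])]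
    simp [parseUp, Cmd.wp, Op.wps, Op.wp, hl, hp.ne, hp.get, g0, g1, hm2.fin, hm2.alloc]
    intro h' d d0 d1 d2 d3 _
    have d' := Ready.ext d
    have k4 := (hp.eq d' (by omega)).trans g4
    have hle2 := hm2.le
    refine ⟨⟨?_, ?_, ?_, ?_⟩, ?_, ?_, .lam (q := m2.reg 12) ?_ ?_ ?_ ?_ (fun _ => ?_) ?_,
      ?_, ?_, ?_, ?_, ?_, ?_⟩
    · simp [hm2.align]
    · simp; omega
    · simp [hm2.fin]
    · simp [hm2.run]
    · simp [h82]
    · simp [hpos, encode]; omega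
    · simpa using hm2.valid
    · simp [d0]
    · simp [d1]
    · simp [d2]
    · simp [d3, hflag]
    · simpa using hc.ext d'
    · simp [k4]
    · simpa using (e'.trans hext).trans d'
    · simpa using htab
    · simpa [Code.Uses] using hu
    · simpa [Code.Uses] using hu'
    · simp [hkeep]
  | app t u ih ih' =>
    rintro m hm h8 ⟨h0, h1, h2⟩ ha hb hw hz
    obtain ⟨hwt, hwu, hb'⟩ := WellNamed.of_app hw
    refine ⟨hm.run, (main_wp_parseDown h8).2 ?_⟩
    simp only [encode, List.length_cons, List.length_append] at hb
    have b0 : m.reg 11 < B := by omega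
    simp [parseDown, Cmd.wp, Op.wps, Op.wp, h0, ha, b0, hm.alloc]
    intro h e e0 _ _ _ e4
    have e' := Ready.ext e
    have hle := hm.le
    rw [Cmd.its_add]
    refine (ih _ ⟨?_, ?_, ?_, ?_⟩ ?_ ?_ ?_ ?_ hwt ?_).mono fun m2 C => ⟨C.ready.run, ?_⟩
    · simp [hm.align]
    · simp; omega
    · simp [hm.fin]
    · simp [hm.run]
    · simp [h8]
    · simpa using h1
    · simp; omega
    · simp; omega
    · intro y hy
      simpa using hz y (by simp [binders, hy])
    obtain ⟨hm2, h82, hpos, hc, hl, hext, htab, hu, hu', hkeep⟩ := C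
    simp at hpos hl hext htab hu' hkeep
    rw [main_wp_parseUp h82]
    have hp : Valid B (m2.reg 5) (m.reg 5) := (hm.valid).ext hext
    have g0 := (hm.valid.eq hext (c := 0) (by omega)).trans e0
    have g4 := (hm.valid.eq hext (c := 4) (by omega)).trans e4
    rw [Nat.add_zero] at g0
    simp [parseUp, Cmd.wp, Op.wps, Op.wp, hl, hp.ne, hp.get, g0, g4, hm2.alloc]
    intro h' d d0 d1 d2 _ d4
    have d' := Ready.ext d
    have hle2 := hm2.le
    rw [Cmd.its_add]
    refine (ih' _ ⟨?_, ?_, ?_, ?_⟩ ?_ ?_ ?_ ?_ hwu ?_).mono fun m3 C => ⟨C.ready.run, ?_⟩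
    · simp [hm2.align]
    · simp; omega
    · simp [hm2.fin]
    · simp [hm2.run]
    · simp
    · simpa [hpos] using h2
    · simp [hpos]; omega
    · simp [hpos]; omega
    · intro y hy
      simp
      -- The binders of `u` do not occur in `t`, so parsing `t` has not marked them.
      rw [hu' y fun h => hb' y hy h.mem_names]
      exact hz y (by simp [binders, hy])
    obtain ⟨hm3, h83, hpos3, hc3, hl3, hext3, htab3, hu3, hu3', hkeep3⟩ := C
    simp at hpos3 hl3 hext3 htab3 hu3' hkeep3
    rw [main_wp_parseUp h83]
    have hp3 : Valid B (m3.reg 5) (m2.reg 5) := (hm2.valid).ext hext3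
    have f0 := (hm2.valid.eq hext3 (c := 0) (by omega)).trans d0
    have f1 := (hm2.valid.eq hext3 (c := 1) (by omega)).trans d1
    have f4 := (hm2.valid.eq hext3 (c := 4) (by omega)).trans d4
    rw [Nat.add_zero] at f0
    simp [parseUp, Cmd.wp, Op.wps, Op.wp, hl3, hp3.ne, hp3.get, f0, f1, hm3.alloc]
    intro h3 c c0 c1 c2 _ _
    have c' := Ready.ext c
    have k4 := (hp3.eq c' (by omega)).trans f4
    have hle3 := hm3.le
    refine ⟨⟨?_, ?_, ?_, ?_⟩, ?_, ?_, .app (q := m2.reg 12) (r := m3.reg 12) ?_ ?_ ?_ ?_ ?_ ?_,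
      ?_, ?_, ?_, ?_, ?_, ?_⟩
    · simp [hm3.align]
    · simp; omega
    · simp [hm3.fin]
    · simp [hm3.run]
    · simp [h83]
    · simp [hpos3, hpos, encode]; omega
    · simpa using hm3.valid
    · simp [c0]
    · simp [c1]
    · simp [c2]
    · simpa using ((hc.ext d').ext hext3).ext c'
    · simpa using hc3.ext c'
    · simp [k4]
    · simpa using (((e'.trans hext).trans d').trans hext3).trans c'
    · intro k hk
      simp [htab3 k hk, htab k hk]
    · intro y hy
      by_cases hyu : u.Uses y
      · simpa using hu3 y hyu
      · simp
        rw [hu3' y hyu, hu y (hy.resolve_right hyu)]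
    · intro y hy
      simp only [Code.Uses, not_or] at hy
      simp
      rw [hu3' y hy.2, hu' y hy.1]
    · simp [hkeep3, hkeep]

theorem main_wp_init {Q : Mem → Prop} (h : m.reg 8 = 0) :
    main.wp B inp Q m ↔ (Cmd.ops [.set 11 32, .set 23 1, .set 8 1]).wp B inp Q m := by
  simp [main, Cmd.wp, h]

/-- The initial memory. -/
def Mem.init : Mem := ⟨fun _ => 0, fun _ => 0, fun _ _ => 0⟩

theorem read_input {c : Code} (hc : c.WellNamed) (hi : InputAt inp 32 c)
    (hB : B = 32 + c.encode.length) :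
    main.Its B inp (c.size + (copyTime c + 1 + 1) + 1)
      (fun m' => Holds B m' (State.initial c) ∧ m'.reg 10 = 0) Mem.init := by
  refine ⟨rfl, (main_wp_init rfl).2 ?_⟩
  simp [Cmd.wp, Op.wps, Op.wp, Mem.init]
  rw [Cmd.its_add]
  refine (scan_code c _ ?_ ?_ ?_ ?_ ?_ ?_).mono fun m S => ⟨S.run, ?_⟩
  · simp
  · simp
  · simp
  · simpa using hi
  · simp
  · simp [hB]
  obtain ⟨s1, s2, s3, s4, s5, s6, s7, s8, s9⟩ := S
  simp at s3 s4 s7 s8 s9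
  rw [main_wp_scan s1]
  simp [scan, Cmd.wp, Op.wps, Op.wp, s4, s3, ← hB]
  rw [Cmd.its_add]
  refine (parse_code c _ ⟨?_, ?_, ?_, ?_⟩ ?_ ?_ ?_ ?_ hc ?_).mono fun m2 C => ⟨C.ready.run, ?_⟩
  · simp; omega
  · simp; omega
  · simp
  · simp [s2]
  · simp
  · simpa using hi
  · simp
  · simp [hB]
  · simp [s8]
  obtain ⟨hm2, h82, hpos, hc, hl, hext, htab, hu, hu', hkeep⟩ := C
  simp at hl htab hkeep
  simp [s9] at hkeep
  rw [main_wp_parseUp h82]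
  simp [parseUp, Cmd.wp, Op.wps, Op.wp, hl]
  refine ⟨⟨⟨?_, ?_, ?_, ?_⟩, ?_, ?_, ?_, ?_, ?_, ⟨?_, ?_⟩, ?_, ?_⟩, ?_⟩
  · simp [hm2.align]
  · simp [hm2.le]
  · simp [hm2.fin]
  · simp [hm2.run]
  · simp
  · simp [hkeep, State.initial, Phase.encode]
  · simpa [State.initial] using hc
  · simp [hkeep, State.initial, holdsStack_nil]
  · simp [hkeep, State.initial, holdsFrame_nil]
  · simp [hkeep, State.initial]
    exact .nil
  · intro x
    exact .inl ⟨rfl, by simp [htab, s8]⟩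
  · intro x
    simp [htab, s8]
  · rintro y (h | h | ⟨φ, h, -⟩ | ⟨d, h, -⟩)
    · simpa [hkeep] using s6 y h
    · exact absurd h (Stack.mentions_nil y)
    · simp [State.initial] at h
    · simp [State.initial] at h
  · simp [hkeep]

end MaxMAM

namespace MaxMAM

open Term Code Ram

/-! ### Reading the memory -/

section read

variable {B : ℕ} {X : ℕ → ℕ} {m : Mem}

/-- The memory `X` contains the heap `h`. -/
def HasHeap (B : ℕ) (h X : ℕ → ℕ) : Prop := ∀ a, 16 * B ≤ a → 8 ≤ a % 16 → X a = h a

variable {n : ℕ} {h : ℕ → ℕ}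

theorem HasHeap.eq (hX : HasHeap B h X) {p : ℕ} (hp : Valid B n p) {c : ℕ} (hc : c < 8) :
    X (p + c) = h (p + c) := hX _ (by have := hp.2.1; omega) (by have := hp.1; omega)

theorem HasHeap.eq_zero (hX : HasHeap B h X) {p : ℕ} (hp : Valid B n p) : X p = h p :=
  hX.eq hp (c := 0) (by omega)

theorem HoldsCode.read (hX : HasHeap B h X) {fl : Prop} {p : ℕ} {t : Code}
    (ht : HoldsCode B n h fl p t) : ReadCode X p t := by
  induction ht with
  | var hp h1 h2 =>
    rw [← h2, ← hX.eq hp (by omega)]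
    exact .var ((hX.eq_zero hp).trans h1)
  | lam hp h1 h2 h3 _ _ ih =>
    rw [← h2, ← hX.eq hp (by omega)]
    refine .lam ((hX.eq_zero hp).trans h1) ?_
    rwa [hX.eq hp (by omega), h3]
  | app hp h1 h2 h3 _ _ ih ih' =>
    refine .app ((hX.eq_zero hp).trans h1) ?_ ?_
    · rwa [hX.eq hp (by omega), h2]
    · rwa [hX.eq hp (by omega), h3]

theorem HoldsStack.read (hX : HasHeap B h X) {p : ℕ} {π : Stack}
    (hπ : HoldsStack B n h p π) : ReadStack X p π := by
  induction hπ with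
  | nil => exact .nil
  | cons hp h1 h2 h3 _ ih =>
    refine .cons hp.ne ?_ ?_
    · rw [hX.eq_zero hp, h1]
      exact h3.read hX
    · rwa [hX.eq hp (by omega), h2]

theorem HoldsFrame.read (hX : HasHeap B h X) {p : ℕ} {F : Frame}
    (hF : HoldsFrame B n h p F) : ReadFrame X p F := by
  induction hF with
  | nil => exact .nil
  | var hp h1 h2 h3 _ ih =>
    rw [← h2, ← hX.eq hp (by omega)]
    refine .var hp.ne ((hX.eq_zero hp).trans h1) ?_
    rwa [hX.eq hp (by omega), h3]
  | head hp h1 h2 h3 h4 h5 h6 _ ih =>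
    refine .head hp.ne ((hX.eq_zero hp).trans h1) ?_ ?_ ?_
    · rw [hX.eq hp (by omega), h2]
      exact h5.read hX
    · rw [hX.eq hp (by omega), h3]
      exact h6.read hX
    · rwa [hX.eq hp (by omega), h4]
  | erasing hp h1 h2 h3 h4 h5 h6 _ ih =>
    refine .erasing hp.ne ((hX.eq_zero hp).trans h1) ?_ ?_ ?_
    · rw [hX.eq hp (by omega), h2]
      exact h5.read hX
    · rw [hX.eq hp (by omega), h3]
      exact h6.read hX
    · rwa [hX.eq hp (by omega), h4]

theorem HoldsEnv.read (hX : HasHeap B h X) {p : ℕ} {E : Env}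
    (hE : HoldsEnv B n h p E) : ReadEnv X p E := by
  induction hE with
  | nil => exact .nil
  | @cons p r e E he h1 _ ih =>
    obtain ⟨hp, h2, h3, h4⟩ := he
    obtain ⟨x, u, l⟩ := e
    obtain rfl : X p = x := (hX.eq_zero hp).trans h2
    refine .cons hp.ne ?_ ((hX.eq hp (by omega)).trans h4) ?_
    · rw [hX.eq hp (by omega)]
      exact h3.read hX
    · rwa [hX.eq hp (by omega), h1]

theorem Holds.read {q : State} (H : Holds B m q) (hX : HasHeap B m.heap X)
    (hr : ∀ a < 5, X a = m.reg a) : ReadState X q where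
  phase := (hr 0 (by omega)).trans H.phase
  code := hr 1 (by omega) ▸ H.code.read hX
  stack := hr 2 (by omega) ▸ H.stack.read hX
  frame := hr 3 (by omega) ▸ H.frame.read hX
  env := hr 4 (by omega) ▸ H.global.env.read hX

end read

/-! ### Runs of the RAM -/

/-- The end of the input `c`. -/
def inputEnd (c : Code) : ℕ := 32 + c.encode.length

theorem rep_init (c : Code) :
    Rep (inputEnd c) (Config.init 32 c).mem (Config.init 32 c).mem Mem.init := by
  have hz : ∀ a, a < 32 ∨ inputEnd c ≤ a → (Config.init 32 c).mem a = 0 := by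
    intro a ha
    simp only [Config.init, inputEnd] at ha ⊢
    split_ifs with h
    · rw [List.getD_eq_default]
      omega
    · rfl
  refine ⟨fun a ha => hz a (by omega), fun _ _ _ => rfl, fun a ha _ => hz a (.inr (by omega)),
    fun k _ x => hz _ (.inr (by omega))⟩

theorem inputAt_init (c : Code) : InputAt (Config.init 32 c).mem 32 c :=
  inputAt_of_getD fun i _ => by simp [Config.init]

/-- In `n` iterations on the input `c`, the RAM simulates transitions, `m` of which are
multiplicative, up to the state `q`. -/
structure Ran (c : Code) (m n : ℕ) (q : State) : Prop where
  inv : Inv false q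
  good : Good q
  sizes : q.All (fun t => t.size ≤ c.size)
  env : q.env.length ≤ m
  pot : ∃ p, Pot c.size q p ∧ n + 5 * p ≤ 5 * potBound c.size m
  run : ∃ k X μ, n ≤ k ∧ k ≤ (main.len + 2) * n ∧
    main.iterate.run k (Config.init 32 c) = ⟨0, X⟩ ∧
    Rep (inputEnd c) (Config.init 32 c).mem X μ ∧ Holds (inputEnd c) μ q ∧ μ.reg 10 = 0

theorem le_inputEnd (c : Code) : 32 ≤ inputEnd c := Nat.le_add_right ..

theorem Ran.initial {c : Code} (h : c.WellNamed) :
    Ran c 0 (c.size + (copyTime c + 1 + 1) + 1) (State.initial c) where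
  inv := Inv.initial h
  good := Good.initial h
  sizes := (Reached.initial h).sizes
  env := le_rfl
  pot := ⟨_, Pot.initial c, by
    have := copyTime_le c
    have := c.size_pos
    unfold potBound
    omega⟩
  run := by
    obtain ⟨k, h1, h2, X, μ, h3, h4, h5⟩ := Cmd.correct_iterate main_wf (le_inputEnd c)
      (rep_init c) (read_input h (inputAt_init c) rfl)
    exact ⟨k, X, μ, h1, h2, h3, h4, h5⟩

/-- Iterations are paid for by five times the potential. A copied entry costs at most 3N+2
iterations and frees at least N units of potential, and 3N+2 ≤ 5N; a multiplicative transition costs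
at most 6N+6, which the growth of `potBound` covers; every other transition takes one iteration. -/
theorem Ran.step {c : Code} {m n : ℕ} {q : State} (h : Ran c m n q) (hq : ¬ Stopped q) :
    ∃ b q' n', GStep b q q' ∧ n < n' ∧ Ran c (m + if b then 1 else 0) n' q' := by
  obtain ⟨k, X, μ, hn, hk, hX, hR, H, h10⟩ := h.run
  obtain ⟨b, q', j, hg, hi, hj, hb, hb', hits⟩ := H.advances (inp := (Config.init 32 c).mem)
    h10 h.inv h.good h.sizes hq
  have hN := c.size_pos
  have hz := hg.sizes h.sizes
  have hl := hg.env_length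
  have henv := h.env
  refine ⟨b, q', n + j, hg, by omega, hi, hg.good h.good hi.clean, hz, by omega, ?_, ?_⟩
  · obtain ⟨p, hp, hpn⟩ := h.pot
    cases b with
    | false =>
      obtain ⟨p', hp', hlt, hle⟩ := hg.pot_false h.good hi.clean h.sizes hN hp
      refine ⟨p', hp', ?_⟩
      simp only [Bool.false_eq_true, if_false, Nat.add_zero]
      rcases hb' rfl with rfl | ⟨h1, h2, h3, h4, h5⟩
      · omega
      · have := hle h2 h3 h4 h5
        omega
    | true =>
      obtain ⟨p', hp', hle⟩ := hg.pot_true hz hp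
      refine ⟨p', hp', ?_⟩
      have h1 := hb rfl
      simp only [if_true] at hl ⊢
      rw [potBound_succ]
      have : 4 * c.size * q'.env.length ≤ 4 * c.size * (m + 1) :=
        Nat.mul_le_mul_left _ (by omega)
      have h2 : 4 * c.size * (2 * m + 5) = 4 * c.size * (m + 1) + 4 * c.size * (m + 4) := by ring
      have h3 : 4 * c.size * 4 ≤ 4 * c.size * (m + 4) := Nat.mul_le_mul_left _ (by omega)
      omega
  · obtain ⟨k', h1, h2, X', μ', h3, h4, h5⟩ := Cmd.correct_iterate main_wf (le_inputEnd c) hR hits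
    exact ⟨k + k', X', μ', by omega, by rw [Nat.mul_add]; omega,
      by rw [Program.run_add, hX, h3], h4, h5⟩

theorem Ran.read {c : Code} {m n : ℕ} {q : State} (h : Ran c m n q) :
    ∃ k ≤ (main.len + 2) * (n + 1) + 2,
      ReadState (main.iterate.run k (Config.init 32 c)).mem q ∧
      (Stopped q → main.iterate.Halted (main.iterate.run k (Config.init 32 c))) := by
  obtain ⟨k, X, μ, hn, hk, hX, hR, H, h10⟩ := h.run
  by_cases hq : Stopped q
  · obtain ⟨k', -, h2, X', μ', h3, h4, rfl⟩ := Cmd.correct_iterate main_wf (le_inputEnd c) hR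
      (H.halts (inp := (Config.init 32 c).mem) h10 hq)
    have h9 : X' 9 ≠ 0 := by simp [h4.reg 9 (by omega)]
    obtain ⟨h5, h6⟩ := Cmd.iterate_halted (c := main) h9
    -- One more iteration sets the stop flag; then the test and the exit jump take two steps.
    refine ⟨k + k' + 2, by rw [Nat.mul_add]; omega, ?_⟩
    rw [Program.run_add, Program.run_add, hX, h3]
    refine ⟨?_, fun _ => h5⟩
    rw [h6]
    exact H.read h4.heap fun a ha => by
      rw [h4.reg a (by omega), Mem.reg_set, if_neg (by omega)]
  · refine ⟨k, by rw [Nat.mul_add]; omega, ?_, fun h => absurd h hq⟩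
    rw [hX]
    exact H.read hR.heap fun a ha => hR.reg a (by omega)

/-- A constant that bounds the running time of the RAM. -/
def ramFactor : ℕ := (main.len + 2) * 161 + 2

theorem Ran.time_le {c : Code} {m n : ℕ} {q : State} (h : Ran c m n q) :
    (main.len + 2) * (n + 1) + 2 ≤ ramFactor * ((1 + m ^ 2) * c.size) := by
  obtain ⟨p, -, hp⟩ := h.pot
  have h1 := potBound_le c.size m
  have h2 : 0 < (1 + m ^ 2) * c.size := Nat.mul_pos (by omega) c.size_pos
  generalize (1 + m ^ 2) * c.size = M at *
  have h3 : (main.len + 2) * (n + 1) ≤ (main.len + 2) * (161 * M) :=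
    Nat.mul_le_mul_left _ (by omega)
  calc (main.len + 2) * (n + 1) + 2 ≤ (main.len + 2) * (161 * M) + 2 * M := by omega
    _ = ramFactor * M := by rw [ramFactor]; ring

/-! ### The RAM follows the executions -/

theorem SEq.refl (s : State) : SEq (Equiv.refl ℕ) s s := by
  have hc : ∀ t : Code, t.Equiv (Equiv.refl ℕ) t := fun t =>
    equiv_iff.2 (rename_id _ fun _ _ => rfl)
  have hπ : ∀ π : Stack, List.Forall₂ (Code.Equiv (Equiv.refl ℕ)) π π := fun π =>
    List.forall₂_same.2 fun t _ => hc t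
  refine ⟨rfl, hc _, hπ _, List.forall₂_same.2 fun φ _ => ?_,
    List.forall₂_same.2 fun e _ => ⟨rfl, hc _, rfl⟩⟩
  cases φ with
  | var x => exact .var x
  | head t π => exact .head (hc t) (hπ π)
  | erasing x t π => exact .erasing (hc _) (hπ π)

theorem SEq.stopped_iff {σ : Equiv.Perm ℕ} {s s' : State} (h : SEq σ s s') :
    Stopped s ↔ Stopped s' := by
  have h1 := h.stack.length_eq
  have h2 := h.frame.length_eq
  simp only [Stopped, ← List.length_eq_zero_iff, h1, h2, h.phase]

/-- The RAM's state stays equivalent to that of any execution, transition by transition. Equality of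
decodings is carried along separately, through determinism of the strategy, because the permutation
of names could move free names. -/
theorem Exec.ran {c : Code} (hc : c.WellNamed) {q : State} (ρ : Exec (State.initial c) q) :
    ∃ q' n σ, Ran c ρ.numMul n q' ∧ SEq σ q' q ∧ q'.decode = q.decode := by
  induction ρ with
  | nil => exact ⟨_, _, _, Ran.initial hc, SEq.refl _, rfl⟩
  | @snoc q q₁ ρ τ h ih =>
    obtain ⟨q', n, σ, hr, hσ, hd⟩ := ih
    have hρ := ρ.reached hc
    have hq : ¬ Stopped q' := fun hst => (hσ.stopped_iff.1 hst).final _ _ h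
    obtain ⟨b, q₁', n', hg', -, hr'⟩ := hr.step hq
    obtain ⟨hg, hi⟩ := h.gstep hρ.inv hρ.good.erases
    obtain ⟨rfl, σ', hσ'⟩ := hg'.deterministic hg hσ hr.good.clean hρ.good.clean hr.good.erases
      hρ.good.erases
    refine ⟨q₁', n', σ', hr', hσ', ?_⟩
    have e := hg.decode hρ.good hi.clean
    have e' := hg'.decode hr.good hr'.good.clean
    cases hτ : τ.IsMul with
    | false =>
      simp only [hτ, Bool.false_eq_true, if_false] at e e'
      rw [e, e', hd]
    | true =>
      simp only [hτ, if_true, hd] at e e'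
      exact e'.deterministic e

theorem Exec.reachesWithin {c : Code} (hc : c.WellNamed) {q : State}
    (ρ : Exec (State.initial c) q) :
    main.iterate.ReachesWithin 32 c q (ramFactor * ((1 + ρ.numMul ^ 2) * c.size)) := by
  obtain ⟨q', n, σ, hr, hσ, hd⟩ := ρ.ran hc
  obtain ⟨k, hk, h1, h2⟩ := hr.read
  exact ⟨k, hk.trans hr.time_le,
    ⟨q', h1, hd, hσ.phase, σ, hσ.code, hσ.stack, hσ.frame, hσ.env⟩,
    fun hf => h2 (hσ.stopped_iff.2 (final_iff.1 hf))⟩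

/-! ### The maximal strategy is reasonably implementable -/

theorem halts_of_normalizes {t s : Term} (d : Derivation MaxStep t s) {c : Code}
    (hc : c.WellNamed) (ht : c.toTerm = t) (hs : ∀ u, ¬ MaxStep s u) :
    ∃ n ≤ ramFactor * ((1 + d.length ^ 2) * c.size),
      main.iterate.Halted (main.iterate.run n (Config.init 32 c)) ∧
      ReadTerm (main.iterate.run n (Config.init 32 c)).mem s := by
  obtain ⟨q, ρ, ⟨h1, h2⟩, h3⟩ := exists_simulation_stopped d hc ht hs
  obtain ⟨q', n, σ, hr, hσ, hd⟩ := ρ.ran hc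
  obtain ⟨k, hk, h4, h5⟩ := hr.read
  have hst := hσ.stopped_iff.2 h3
  refine ⟨k, h1 ▸ hk.trans hr.time_le, h5 hst, q'.code, q'.env, h4.code, h4.env, ?_⟩
  rw [← h2, ← hd, State.decode, hst.2.1, hst.2.2]
  rfl

theorem Program.run_of_halted {P : Program} {n k : ℕ} {c : Config}
    (h : P.Halted (P.run n c)) (hk : n ≤ k) : P.run k c = P.run n c := by
  induction k, hk using Nat.le_induction with
  | base => rfl
  | succ k _ ih => rw [Program.run, ih, show P.step (P.run n c) = none from h, Option.getD_none]

/-- As long as the machine does not stop, the number of iterations grows without bound. The RAM is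
then back at its first instruction at arbitrarily late times, where it has not halted; this gives
`normalizes_of_halts`. -/
theorem Ran.exists {c : Code} (hc : c.WellNamed) (j : ℕ) :
    ∃ m n q, Ran c m n q ∧ Nonempty (Derivation MaxStep c.toTerm q.decode) ∧
      (j ≤ n ∨ Stopped q) := by
  induction j with
  | zero => exact ⟨_, _, _, Ran.initial hc, ⟨.nil _⟩, .inl (Nat.zero_le _)⟩
  | succ j ih =>
    obtain ⟨m, n, q, hr, ⟨d⟩, hj⟩ := ih
    by_cases hq : Stopped q
    · exact ⟨m, n, q, hr, ⟨d⟩, .inr hq⟩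
    · obtain ⟨b, q', n', hg, hn, hr'⟩ := hr.step hq
      have := hj.resolve_right hq
      refine ⟨_, n', q', hr', ?_, .inl (by omega)⟩
      have e := hg.decode hr.good hr'.good.clean
      cases b with
      | false =>
        simp only [Bool.false_eq_true, if_false] at e
        exact ⟨e ▸ d⟩
      | true => exact ⟨d.snoc (maxStep_iff_ms.2 (by simpa using e))⟩

theorem normalizes_of_halts {c : Code} (hc : c.WellNamed) {n : ℕ}
    (h : main.iterate.Halted (main.iterate.run n (Config.init 32 c))) :
    ∃ s, Nonempty (Derivation MaxStep c.toTerm s) ∧ ∀ u, ¬ MaxStep s u := by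
  obtain ⟨m, j, q, hr, hd, hj⟩ := Ran.exists hc n
  refine ⟨q.decode, hd, fun u hu => ?_⟩
  rcases hj with hj | hq
  · obtain ⟨k, X, -, hk, -, hX, -⟩ := hr.run
    have := Program.run_of_halted h (hj.trans hk)
    rw [← this, hX] at h
    exact Cmd.iterate_not_halted h
  · exact (maxStep_iff_ms.1 hu).not_nf (hq.nf hr.good)

theorem reasonablyImplementable_maxStep : ReasonablyImplementable MaxStep := by
  refine ⟨main.iterate, 32,
    MvPolynomial.C ramFactor * ((1 + MvPolynomial.X 0 ^ 2) * MvPolynomial.X 1), ?_⟩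
  rintro t c hc rfl
  refine ⟨fun s d hs => ?_, fun ⟨n, hn⟩ => normalizes_of_halts hc hn⟩
  simpa [Code.size] using halts_of_normalizes d hc rfl hs

end MaxMAM

/-! ### The theorem. -/

theorem mainTheorem2 :
    (∀ (t s : MaxMAM.Term) (d : MaxMAM.Derivation MaxMAM.MaxStep t s) (c : MaxMAM.Code),
      c.WellNamed → c.toTerm = t →
      ∃ (q : MaxMAM.State) (ρ : MaxMAM.Exec (MaxMAM.State.initial c) q),
        MaxMAM.Simulates ρ d) ∧
    (∃ K : ℕ, ∀ (t s : MaxMAM.Term) (d : MaxMAM.Derivation MaxMAM.MaxStep t s) (c : MaxMAM.Code)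
      (q : MaxMAM.State) (ρ : MaxMAM.Exec (MaxMAM.State.initial c) q),
      c.WellNamed → c.toTerm = t → MaxMAM.Simulates ρ d →
      ρ.length ≤ K * ((1 + d.length ^ 2) * t.size)) ∧
    (∃ (P : MaxMAM.Program) (base K : ℕ),
      ∀ (t s : MaxMAM.Term) (d : MaxMAM.Derivation MaxMAM.MaxStep t s) (c : MaxMAM.Code)
      (q : MaxMAM.State) (ρ : MaxMAM.Exec (MaxMAM.State.initial c) q),
      c.WellNamed → c.toTerm = t → MaxMAM.Simulates ρ d →
      P.ReachesWithin base c q (K * ((1 + d.length ^ 2) * t.size))) ∧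
    MaxMAM.ReasonablyImplementable MaxMAM.MaxStep := by
  open MaxMAM in
  refine ⟨fun t s d c hc ht => exists_simulation d hc ht, ⟨32, ?_⟩,
    ⟨Ram.main.iterate, 32, ramFactor, ?_⟩, reasonablyImplementable_maxStep⟩
  · rintro t s d c q ρ hc rfl ⟨h, -⟩
    exact h ▸ ρ.length_le hc
  · rintro t s d c q ρ hc rfl ⟨h, -⟩
    exact h ▸ ρ.reachesWithin hc
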